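/- **Setting.** Let $\mathcal A$ be a finite or countable set with $|\mathcal A|>1$, $\Omega=\mathcal A^{\mathbb N}$ (discrete topology on $\mathcal A$, product topology and product $\sigma$-algebra $\mathcal F$ on $\Omega$), and let $T:\Omega\to\Omega$, $(T\omega)_n=\omega_{n+1}$, be the left shift. Let $I=[0,1]$, let $m$ be Lebesgue measure on $I$, let $\{U_a\}_{a\in\mathcal A}$ be pairwise disjoint non-empty open subintervals of $I$, $I_a=\overline{U_a}$, $U=\bigcup_a U_a$, with $m(I\setminus U)=0$, and let $f:I\to I$ be a Borel map such that 1. for each $a\in\mathcal A$, $f|_{U_a}$ extends to a strictly monotonic function $f_a\in C^1(I_a)$; 2. for all $a,b\in\mathcal A$, if $f(U_a)\cap U_b\neq\emptyset$ then $U_b\subset f(U_a)$; 3. there are an integer $q\ge1$ and $\tau>1$ with $|(f^q)'(x)|\ge\tau$ for all $x\in\bigcap_{j=0}^{q-1}f^{-j}(U)$; 4. for each $a\in\mathcal A$ there are $b,c\in\mathcal A$ with $U_b\subset f(U_a)$ and $U_a\subset f(U_c)$. Let $\mu$ be an $f$-invariant Borel probability measure on $I$ with a density $p=d\mu/dm$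 that is continuous and strictly positive on $I$. Put $\Omega_S=\{\omega\in\Omega: U_{\omega_{j+1}}\subset f(U_{\omega_j})\text{ for all }j\ge0\}$ and assume that $T:\Omega_S\to\Omega_S$ is topologically mixing, i.e. for all non-empty relatively open $V,W\subset\Omega_S$ one has $V\cap T^{-n}W\ne\emptyset$ for all sufficiently large $n$. For $\omega\in\Omega_S$ let $\Theta(\omega)$ be the unique point of $\bigcap_{n\ge1}\overline{\bigcap_{j=0}^{n-1}f^{-j}(U_{\omega_j})}$. For $\mu$-almost every $x$ (namely every $x$ all of whose iterates lie in $U$) let $\Phi(x)=(\xi_0(x),\xi_1(x),\dots)\in\Omega$, where $\xi_j(x)=a$ iff $f^j(x)\in U_a$, and let $\mathbb P=\mu\circ\Phi^{-1}$. Assume that $\mathbb P$ is $\psi$-mixing: there are $\psi_k\ge0$ ($k\ge0$) with $\psi_k\to0$ and $$|\mathbb P(E\cap T^{-(n+k)}F)-\mathbb P(E)\mathbb P(F)|\le\psi_k\,\mathbb P(E)\mathbb P(F)$$ for all $k,n\ge0$, all $E$ in the $\sigma$-algebra generated by the coordinates $0,\dots,n-1$, and all $F\in\mathcal F$. Let $t>0$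 and let $1\le d_1<\dots<d_\ell$ be integers, $\ell\ge1$. For $\omega\in\Omega$ and $n\ge1$ let $A_n^\omega=\{\gamma\in\Omega:\gamma_j=\omega_j,\ 0\le j<n\}$, and for a cylinder $A$ and $N\ge1$ let $$S_N^A=\sum_{k=1}^N\prod_{i=1}^\ell 1_A\circ T^{d_ik},$$ a random variable on $(\Omega,\mathcal F,\mathbb P)$. If $\mathbb P(A_n^\omega)>0$ put $N_n^\omega=\lfloor t\,\mathbb P(A_n^\omega)^{-\ell}\rfloor$. For $s>0$ and $0\le\rho<1$ let $PA(s,\rho)$ be the Pólya–Aeppli distribution on $\mathbb N=\{0,1,2,\dots\}$, given by $PA(s,\rho)\{0\}=e^{-s}$ and $$PA(s,\rho)\{k\}=e^{-s}\sum_{j=1}^k\binom{k-1}{j-1}\frac{s^j}{j!}\rho^{k-j}(1-\rho)^j\qquad(k\ge1).$$ **Corollary 3.8.** Let $\omega\in\Omega$ be a periodic point of $T$ with minimal period $r\ge1$ such that $\mathbb P(A_n^\omega)>0$ for every $n\ge1$. Put $$\kappa(r)=\operatorname{lcm}\Big\{\frac{r}{\gcd(r,d_i)}:1\le i\le\ell\Big\},\qquad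 a=\frac{\kappa(r)}{r}\sum_{i=1}^\ell d_i,\qquad \rho_\omega=\Big(\prod_{j=0}^{r-1}\big|f'_{\omega_j}(\Theta(T^j\omega))\big|\Big)^{-a}.$$ Then $0\le\rho_\omega<1$, and the distribution of $S_{N_n^\omega}^{A_n^\omega}$ under $\mathbb P$ converges weakly to $PA(t(1-\rho_\omega),\rho_\omega)$ as $n\to\infty$. -/

import Mathlib

open MeasureTheory Filter Topology

noncomputable section

namespace MarkovRecurrence

/-! ### One-sided shift spaces -/

section Shift

variable {A : Type*}

/-- The left shift on the space of one-sided sequences. -/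
def shift (ω : ℕ → A) : ℕ → A := fun n => ω (n + 1)

/-- The cylinder `[ω₀, …, ω_{n-1}]`. -/
def cylinder (ω : ℕ → A) (n : ℕ) : Set (ℕ → A) := {γ | ∀ j < n, γ j = ω j}

/-- The `σ`-algebra generated by the events `{ω_j = a}`, `j ∈ J`, `a ∈ A`. -/
@[reducible] def coordSigma (A : Type*) (J : Set ℕ) : MeasurableSpace (ℕ → A) :=
  MeasurableSpace.generateFrom {s | ∃ j ∈ J, ∃ a : A, s = {ω | ω j = a}}

/-- `ψ`-mixing: `|P(E ∩ T^{-(n+m)} F) - P(E) P(F)| ≤ ψ_m P(E) P(F)` whenever `E` depends on the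
coordinates `0, …, n - 1` only and `F` is measurable, where `ψ_m → 0`. -/
def IsPsiMixing [MeasurableSpace A] (P : Measure (ℕ → A)) : Prop :=
  ∃ ψ : ℕ → ℝ, (∀ m, 0 ≤ ψ m) ∧ Tendsto ψ atTop (𝓝 0) ∧
    ∀ (m n : ℕ) (E F : Set (ℕ → A)),
      MeasurableSet[coordSigma A {j | j < n}] E → MeasurableSet F →
      |P.real (E ∩ (shift^[n + m]) ⁻¹' F) - P.real E * P.real F| ≤ ψ m * P.real E * P.real F

/-- The topological Markov shift of a transition relation. -/
def markovShift (S : A → A → Prop) : Set (ℕ → A) := {ω | ∀ j, S (ω j) (ω (j + 1))}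

/-- Topological mixing of the shift on `markovShift S` (which is mapped into itself by the
shift), for nonempty relatively open sets `Ω_S ∩ V` and `Ω_S ∩ W`. -/
def IsTopologicallyMixing [TopologicalSpace A] (S : A → A → Prop) : Prop :=
  ∀ V W : Set (ℕ → A), IsOpen V → IsOpen W →
    (markovShift S ∩ V).Nonempty → (markovShift S ∩ W).Nonempty →
    ∃ N : ℕ, ∀ n ≥ N, (markovShift S ∩ V ∩ (shift^[n]) ⁻¹' W).Nonempty

/-- The support of `P`: the sequences all of whose cylinders have positive measure. -/
def cylinderSupport [MeasurableSpace A] (P : Measure (ℕ → A)) : Set (ℕ → A) :=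
  {ω | ∀ n ≥ 1, 0 < P (cylinder ω n)}

/-- The count `S_N^C = ∑_{k=1}^N ∏_i 1_C ∘ T^{d_i k}` of multiple recurrences to `C`. -/
def recurrenceCount {ℓ : ℕ} (d : Fin ℓ → ℕ) (C : Set (ℕ → A)) (N : ℕ) (γ : ℕ → A) : ℕ :=
  ∑ k ∈ Finset.Icc 1 N, ∏ i, C.indicator (fun _ => 1) (shift^[d i * k] γ)

/-- The time scale `N_n^ω = ⌊t P[ω₀, …, ω_{n-1}]^{-ℓ}⌋`. -/
def timeScale [MeasurableSpace A] (P : Measure (ℕ → A)) (ℓ : ℕ) (t : ℝ) (ω : ℕ → A) (n : ℕ) : ℕ :=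
  ⌊t * (P.real (cylinder ω n) ^ ℓ)⁻¹⌋₊

end Shift

/-- `κ(r) = lcm {r / gcd(r, d_i)}`. -/
def kappa {ℓ : ℕ} (d : Fin ℓ → ℕ) (r : ℕ) : ℕ := Finset.univ.lcm fun i => r / Nat.gcd r (d i)

/-- The exponent `a = (κ(r) / r) ∑_i d_i`. -/
def exponent {ℓ : ℕ} (d : Fin ℓ → ℕ) (r : ℕ) : ℝ := (kappa d r : ℝ) / r * ∑ i, (d i : ℝ)

/-! ### The Pólya–Aeppli distribution -/

/-- The weights of the Pólya–Aeppli distribution. -/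
def polyaAeppliWeight (t p : ℝ) (k : ℕ) : ℝ :=
  if k = 0 then Real.exp (-t) else
    Real.exp (-t) * ∑ j ∈ Finset.Icc 1 k,
      ((k - 1).choose (j - 1) : ℝ) * (t ^ j / (j.factorial : ℝ)) * p ^ (k - j) * (1 - p) ^ j

/-- The Pólya–Aeppli distribution on `ℕ`, a probability measure for `0 < t` and `0 ≤ p < 1`. -/
def polyaAeppli (t p : ℝ) : Measure ℕ :=
  Measure.sum fun k => ENNReal.ofReal (polyaAeppliWeight t p k) • Measure.dirac k

theorem polyaAeppliWeight_nonneg {t p : ℝ} (ht : 0 < t) (hp : 0 ≤ p) (hp1 : p < 1) (k : ℕ) :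
    0 ≤ polyaAeppliWeight t p k := by
  have : 0 < 1 - p := by linarith
  unfold polyaAeppliWeight
  split_ifs <;> positivity

theorem hasSum_polyaAeppliWeight {t p : ℝ} (ht : 0 < t) (hp : 0 ≤ p) (hp1 : p < 1) :
    HasSum (polyaAeppliWeight t p) 1 := by
  have hq : 0 < 1 - p := by linarith
  set g : ℕ × ℕ → ℝ := fun x =>
    (t ^ (x.1 + 1) / ((x.1 + 1).factorial : ℝ)) * (1 - p) ^ (x.1 + 1) *
      (((x.2 + x.1).choose x.1 : ℝ) * p ^ x.2) with hg
  have hg0 : 0 ≤ g := fun x => by simp only [hg]; positivity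
  have hin : ∀ i, HasSum (fun b => g (i, b)) (t ^ (i + 1) / ((i + 1).factorial : ℝ)) := by
    intro i
    have h := (hasSum_choose_mul_geometric_of_norm_lt_one i
      (r := p) (by rwa [Real.norm_of_nonneg hp])).mul_left
      ((t ^ (i + 1) / ((i + 1).factorial : ℝ)) * (1 - p) ^ (i + 1))
    have hne : (1 - p) ^ (i + 1) ≠ 0 := (pow_pos hq _).ne'
    rwa [mul_one_div, mul_div_assoc, div_self hne, mul_one] at h
  have hexp : HasSum (fun i : ℕ => t ^ (i + 1) / ((i + 1).factorial : ℝ)) (Real.exp t - 1) := by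
    have h := NormedSpace.expSeries_div_hasSum_exp t
    rw [← Real.exp_eq_exp_ℝ, ← hasSum_nat_add_iff' 1] at h
    simpa using h
  have hsg : Summable g := by
    rw [summable_prod_of_nonneg hg0]
    refine ⟨fun i => (hin i).summable, ?_⟩
    simp_rw [fun i => (hin i).tsum_eq]
    exact hexp.summable
  have hG : HasSum g (Real.exp t - 1) := by
    have h1 := hsg.hasSum.prod_fiberwise hin
    rw [← h1.unique hexp]
    exact hsg.hasSum
  have hG2 := (Finset.HasAntidiagonal.sigmaAntidiagonalEquivProd (A := ℕ)).hasSum_iff.mpr hG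
  have hG3 : HasSum (fun m => ∑ x ∈ Finset.HasAntidiagonal.antidiagonal m, g x)
      (Real.exp t - 1) := by
    refine hG2.sigma fun m => ?_
    have := hasSum_fintype
      (fun x : Finset.HasAntidiagonal.antidiagonal m => (g ∘
        Finset.HasAntidiagonal.sigmaAntidiagonalEquivProd) ⟨m, x⟩)
    convert this using 1
    exact (Finset.sum_coe_sort (Finset.HasAntidiagonal.antidiagonal m) g).symm
  have h4 := hG3.mul_left (Real.exp (-t))
  have hterm : ∀ m, polyaAeppliWeight t p (m + 1) =
      Real.exp (-t) * ∑ x ∈ Finset.HasAntidiagonal.antidiagonal m, g x := by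
    intro m
    rw [polyaAeppliWeight, if_neg (Nat.succ_ne_zero m)]
    congr 1
    rw [Finset.Nat.sum_antidiagonal_eq_sum_range_succ_mk, ← Finset.Ico_add_one_right_eq_Icc,
      Finset.sum_Ico_eq_sum_range]
    refine Finset.sum_congr (by simp) fun i hi => ?_
    have hi' : i ≤ m := by
      have := Finset.mem_range.mp hi
      omega
    have e1 : m - i + i = m := by omega
    have e2 : m + 1 - (i + 1) = m - i := by omega
    simp only [hg, Nat.add_comm 1 i, e1, e2, Nat.add_sub_cancel]
    ring
  have htot : Real.exp (-t) * (Real.exp t - 1) =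
      1 - ∑ i ∈ Finset.range 1, polyaAeppliWeight t p i := by
    simp [polyaAeppliWeight, mul_sub, ← Real.exp_add]
  rw [← hasSum_nat_add_iff' 1, ← htot]
  simpa only [hterm] using h4

theorem isProbabilityMeasure_polyaAeppli {t p : ℝ} (ht : 0 < t) (hp : 0 ≤ p) (hp1 : p < 1) :
    IsProbabilityMeasure (polyaAeppli t p) :=
  (hasSum_polyaAeppliWeight ht hp hp1).isProbabilityMeasure_sum_dirac
    fun k => polyaAeppliWeight_nonneg ht hp hp1 k

/-! ### Expanding Markov interval maps -/

/-- An expanding Markov map `f` of `I = [0, 1]` with branches indexed by `A`. The map is a Borel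
function on the line of which only the restriction to `[0, 1]` is used. -/
structure MarkovIntervalMap (A : Type*) where
  /-- left end point of the open interval `U_a` -/
  left : A → ℝ
  /-- right end point of the open interval `U_a` -/
  right : A → ℝ
  /-- the map `f` -/
  toFun : ℝ → ℝ
  /-- the extension `f_a` of the restriction of `f` to `U_a` -/
  branch : A → ℝ → ℝ
  left_nonneg : ∀ a, 0 ≤ left a
  left_lt_right : ∀ a, left a < right a
  right_le_one : ∀ a, right a ≤ 1
  disjoint : Pairwise fun a b => Disjoint (Set.Ioo (left a) (right a)) (Set.Ioo (left b) (right b))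
  /-- the intervals `U_a` cover `I` up to a Lebesgue null set -/
  null_compl : volume (Set.Icc (0 : ℝ) 1 \ ⋃ a, Set.Ioo (left a) (right a)) = 0
  measurable : Measurable toFun
  mapsTo : Set.MapsTo toFun (Set.Icc 0 1) (Set.Icc 0 1)
  branch_eqOn : ∀ a, Set.EqOn (branch a) toFun (Set.Ioo (left a) (right a))
  branch_contDiffOn : ∀ a, ContDiffOn ℝ 1 (branch a) (Set.Icc (left a) (right a))
  branch_strict : ∀ a, StrictMonoOn (branch a) (Set.Icc (left a) (right a)) ∨
    StrictAntiOn (branch a) (Set.Icc (left a) (right a))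
  markov : ∀ a b,
    (toFun '' Set.Ioo (left a) (right a) ∩ Set.Ioo (left b) (right b)).Nonempty →
    Set.Ioo (left b) (right b) ⊆ toFun '' Set.Ioo (left a) (right a)
  /-- some iterate `f^q` is uniformly expanding wherever `x, f x, …, f^{q-1} x` all lie in
  `U = ⋃ a, U_a` -/
  expanding : ∃ q : ℕ, 1 ≤ q ∧ ∃ τ : ℝ, 1 < τ ∧
    ∀ x : ℝ, (∀ j < q, toFun^[j] x ∈ ⋃ a, Set.Ioo (left a) (right a)) →
      τ ≤ |deriv (toFun^[q]) x|
  exists_transition : ∀ a, ∃ b c,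
    Set.Ioo (left b) (right b) ⊆ toFun '' Set.Ioo (left a) (right a) ∧
    Set.Ioo (left a) (right a) ⊆ toFun '' Set.Ioo (left c) (right c)

namespace MarkovIntervalMap

variable {A : Type*} (F : MarkovIntervalMap A)

/-- The open interval `U_a`. -/
def U (a : A) : Set ℝ := Set.Ioo (F.left a) (F.right a)

/-- The transition relation: `S_{a,b} = 1` iff `U_b ⊆ f(U_a)`. -/
def trans (a b : A) : Prop := F.U b ⊆ F.toFun '' F.U a

/-- The derivative `f_a'` on `I_a = [left a, right a]` (one-sided at the end points). -/
def branchDeriv (a : A) (x : ℝ) : ℝ :=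
  derivWithin (F.branch a) (Set.Icc (F.left a) (F.right a)) x

/-- The coding map `Θ`: for `ω ∈ Ω_S`, the unique point of
`⋂_{n ≥ 1} closure (⋂_{j < n} f^{-j}(U_{ω_j}))`. -/
def coding (ω : ℕ → A) : ℝ :=
  Classical.epsilon fun x : ℝ =>
    ∀ n ≥ 1, x ∈ closure {y : ℝ | ∀ j < n, F.toFun^[j] y ∈ F.U (ω j)}

open Classical in
/-- The itinerary `Φ(x) = (ξ₀(x), ξ₁(x), …)`, where `ξ_j(x)` is the `a` with `f^j(x) ∈ U_a`
(an arbitrary fixed letter if there is none). -/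
def itinerary [Nonempty A] (x : ℝ) (j : ℕ) : A :=
  if h : ∃ a, F.toFun^[j] x ∈ F.U a then h.choose else Classical.arbitrary A

/-- The symbolic measure `μ ∘ Φ⁻¹`. -/
def symbolicMeasure [Nonempty A] [MeasurableSpace A] (μ : Measure ℝ) : Measure (ℕ → A) :=
  μ.map F.itinerary

theorem itinerary_eq [Nonempty A] {x : ℝ} {j : ℕ} {a : A} (h : F.toFun^[j] x ∈ F.U a) :
    F.itinerary x j = a := by
  have hex : ∃ a, F.toFun^[j] x ∈ F.U a := ⟨a, h⟩
  rw [itinerary, dif_pos hex]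
  by_contra hne
  exact Set.disjoint_left.mp (F.disjoint hne) hex.choose_spec h

theorem measurable_itinerary [Nonempty A] [Countable A] [MeasurableSpace A]
    [MeasurableSingletonClass A] : Measurable F.itinerary := by
  refine measurable_pi_iff.mpr fun j => measurable_to_countable' fun a => ?_
  have hm : ∀ b, MeasurableSet ((F.toFun^[j]) ⁻¹' F.U b) := fun b =>
    (F.measurable.iterate j) measurableSet_Ioo
  have hset : (fun x => F.itinerary x j) ⁻¹' {a} = (F.toFun^[j]) ⁻¹' F.U a ∪
      ((⋃ b, (F.toFun^[j]) ⁻¹' F.U b)ᶜ ∩ {_x | Classical.arbitrary A = a}) := by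
    ext x
    by_cases hex : ∃ b, F.toFun^[j] x ∈ F.U b
    · obtain ⟨b, hb⟩ := hex
      have hn : x ∉ (⋃ b, (F.toFun^[j]) ⁻¹' F.U b)ᶜ := fun h => h (Set.mem_iUnion.mpr ⟨b, hb⟩)
      have hiff : F.itinerary x j = a ↔ F.toFun^[j] x ∈ F.U a := by
        constructor
        · intro h
          rw [← h, F.itinerary_eq hb]
          exact hb
        · exact F.itinerary_eq
      simp only [Set.mem_preimage, Set.mem_singleton_iff, Set.mem_union, Set.mem_inter_iff, hn,
        false_and, or_false, hiff]
    · have hy : x ∈ (⋃ b, (F.toFun^[j]) ⁻¹' F.U b)ᶜ := by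
        simpa using hex
      have hna : ¬ F.toFun^[j] x ∈ F.U a := fun h => hex ⟨a, h⟩
      have he : F.itinerary x j = Classical.arbitrary A := by
        rw [itinerary, dif_neg hex]
      simp only [Set.mem_preimage, Set.mem_singleton_iff, Set.mem_union, Set.mem_inter_iff, hy,
        true_and, hna, false_or, he, Set.mem_ofPred_eq]
  rw [hset]
  exact (hm a).union ((MeasurableSet.iUnion hm).compl.inter (MeasurableSet.const _))

instance isProbabilityMeasure_symbolicMeasure [Nonempty A] [Countable A] [MeasurableSpace A]
    [MeasurableSingletonClass A] (μ : Measure ℝ) [IsProbabilityMeasure μ] :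
    IsProbabilityMeasure (F.symbolicMeasure μ) :=
  Measure.isProbabilityMeasure_map F.measurable_itinerary.aemeasurable

/-- `ρ_ω = (∏_{j < r} |f'_{ω_j}(Θ(T^j ω))|)^{-a}`, where `r` is the minimal period of `ω`. -/
def rho {ℓ : ℕ} (d : Fin ℓ → ℕ) (ω : ℕ → A) : ℝ :=
  (∏ j ∈ Finset.range (Function.minimalPeriod shift ω),
    |F.branchDeriv (ω j) (F.coding (shift^[j] ω))|) ^
      (-exponent d (Function.minimalPeriod shift ω))

end MarkovIntervalMap

end MarkovRecurrence

end

noncomputable section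

namespace MarkovRecurrence

/-! ### The Pólya–Aeppli recursion -/

/-! Call `m` a hit when the word ω₀…ω_{n-1} is read at every time d_i m; the count is the number of
hits up to N. The Pólya–Aeppli weights are determined by total mass 1 and the Panjer recursion k w_k
= s(1-ρ) Σ_{i<k} (i+1) ρ^i w_{k-1-i}. It therefore suffices that the laws of the counts satisfy this
recursion up to o(1) with s = t(1-ρ), and that their means stay bounded
(`tendsto_polyaAeppliWeight`).

The recursion comes from k P(S = k) = Σ_m P(hit at m, S = k) (`sum_real_hit_inter_eq`). Near a hit
at m, up to a distance h proportional to n, periodicity of ω allows further hits only at distances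
divisible by κ, and two such hits force all those in between. The hits near m thus form a clump
m-κv, …, m+κu, described by events that longer words of ω are read. Prolonging a run by κ multiplies
its probability asymptotically by the overlap factor ρ, so by inclusion–exclusion a clump has
probability about P(A_n)^ℓ ρ^{v+u}(1-ρ)², and i+1 pairs (v,u) have v+u = i. Hits whose windows are
far from those of m decouple by ψ-mixing, and their number may be replaced by the full count. Hits
at intermediate distance are negligible: only O(n) times are concerned, and each costs an extra
factor exponentially small in n. Summing over N ~ t P(A_n)^{-ℓ} times gives the recursion
(`LimitData.tendsto_recursion`).

The dynamics enters through two facts on cylinders. Expansion makes cylinder intervals, hence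
cylinder probabilities, exponentially small. By the Markov property f maps the cylinder interval of
ω onto that of Tω, so a change of variables gives the limiting mass ratio |f'(Θω)| p(ΘTω)/p(Θω);
along a period the densities cancel and P(A_{n+r})/P(A_n) tends to the inverse multiplier. The same
argument for Lebesgue measure, combined with expansion of f^q, shows that the multiplier exceeds 1.
Multiplying over the ℓ words yields ρ = ρ_ω. -/

theorem sum_succ_mul_choose (K J : ℕ) :
    ∑ i ∈ Finset.range (K + 1), (i + 1) * (K - i).choose J = (K + 2).choose (J + 2) := by
  induction K with
  | zero =>
    cases J with
    | zero => simp
    | succ J => simp [Nat.choose_eq_zero_of_lt (show 2 < J + 1 + 2 by omega)]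
  | succ K ih =>
    rw [Finset.sum_range_succ']
    have h1 : ∀ i ∈ Finset.range (K + 1), (i + 1 + 1) * (K + 1 - (i + 1)).choose J =
        (i + 1) * (K - i).choose J + (K - i).choose J := by
      intro i _
      rw [Nat.add_sub_add_right]
      ring
    -- The hockey-stick identity; the weighted sum is its iterate.
    have h2 : ∀ K, ∑ i ∈ Finset.range (K + 1), (K - i).choose J = (K + 1).choose (J + 1) := by
      intro K
      induction K with
      | zero =>
        cases J with
        | zero => simp
        | succ J => simp [Nat.choose_eq_zero_of_lt (show 1 < J + 1 + 1 by omega)]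
      | succ K ih =>
        rw [Finset.sum_range_succ']
        simp only [Nat.add_sub_add_right, Nat.sub_zero]
        rw [ih, Nat.choose_succ_succ (K + 1) J, add_comm]
    rw [Finset.sum_congr rfl h1, Finset.sum_add_distrib, ih, h2 K]
    simp only [zero_add, one_mul, Nat.sub_zero]
    have e1 := Nat.choose_succ_succ (K + 2) (J + 1)
    have e2 := Nat.choose_succ_succ (K + 1) J
    simp only [Nat.succ_eq_add_one, add_assoc, Nat.reduceAdd] at e1 e2 ⊢
    omega

theorem polyaAeppliWeight_succ (s p : ℝ) (k : ℕ) :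
    polyaAeppliWeight s p (k + 1) = Real.exp (-s) * ∑ l ∈ Finset.range (k + 1),
      (k.choose l : ℝ) * (s ^ (l + 1) / ((l + 1).factorial : ℝ)) * p ^ (k - l) *
        (1 - p) ^ (l + 1) := by
  rw [polyaAeppliWeight, if_neg (Nat.succ_ne_zero k), ← Finset.Ico_add_one_right_eq_Icc,
    Finset.sum_Ico_eq_sum_range]
  congr 1
  refine Finset.sum_congr (by simp) fun i _ => ?_
  rw [Nat.add_comm 1 i, Nat.add_sub_add_right]
  simp

/-- The Panjer recursion of the Pólya–Aeppli weights. -/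
theorem polyaAeppliWeight_recursion (s p : ℝ) (k : ℕ) :
    (k : ℝ) * polyaAeppliWeight s p k = s * (1 - p) *
      ∑ i ∈ Finset.range k, ((i : ℝ) + 1) * p ^ i * polyaAeppliWeight s p (k - 1 - i) := by
  cases k with
  | zero => simp
  | succ k =>
    have h0 : polyaAeppliWeight s p 0 = Real.exp (-s) := by simp [polyaAeppliWeight]
    -- The weight at 0 has no sum formula, so the summand i = k is split off and only i < k is
    -- expanded. The powers of p combine to an exponent independent of i, which allows the order of
    -- summation to be exchanged.
    have hlast : ∀ i ∈ Finset.range k, ((i : ℝ) + 1) * p ^ i *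
        polyaAeppliWeight s p (k + 1 - 1 - i) = Real.exp (-s) * ∑ l ∈ Finset.range k,
          (((i + 1) * (k - 1 - i).choose l : ℕ) : ℝ) *
            ((s ^ (l + 1) / ((l + 1).factorial : ℝ)) * p ^ (k - 1 - l) * (1 - p) ^ (l + 1)) := by
      intro i hi
      have hi' := Finset.mem_range.mp hi
      obtain ⟨m, hm⟩ : ∃ m, k = m + i + 1 := ⟨k - i - 1, by omega⟩
      have e1 : k + 1 - 1 - i = m + 1 := by omega
      have e2 : k - 1 - i = m := by omega
      rw [e1, e2, polyaAeppliWeight_succ, mul_left_comm, Finset.mul_sum]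
      congr 1
      have hsub : Finset.range (m + 1) ⊆ Finset.range k := by
        intro x hx
        have := Finset.mem_range.mp hx
        exact Finset.mem_range.mpr (by omega)
      rw [← Finset.sum_subset hsub]
      · refine Finset.sum_congr rfl fun l hl => ?_
        have hl' := Finset.mem_range.mp hl
        have e3 : k - 1 - l = i + (m - l) := by omega
        rw [e3, pow_add]
        push_cast
        ring
      · intro l _ hl
        have : m < l := by
          by_contra h
          exact hl (Finset.mem_range.mpr (by omega))
        simp [Nat.choose_eq_zero_of_lt this]
    rw [Finset.sum_range_succ, Finset.sum_congr rfl hlast, ← Finset.mul_sum, Finset.sum_comm]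
    have e0 : k + 1 - 1 - k = 0 := by omega
    rw [e0, h0, polyaAeppliWeight_succ, Finset.sum_range_succ']
    have hin : ∀ l ∈ Finset.range k, ∑ i ∈ Finset.range k,
        (((i + 1) * (k - 1 - i).choose l : ℕ) : ℝ) *
            ((s ^ (l + 1) / ((l + 1).factorial : ℝ)) * p ^ (k - 1 - l) * (1 - p) ^ (l + 1)) =
        ((k + 1).choose (l + 2) : ℝ) *
          ((s ^ (l + 1) / ((l + 1).factorial : ℝ)) * p ^ (k - 1 - l) * (1 - p) ^ (l + 1)) := by
      intro l hl
      have hl' := Finset.mem_range.mp hl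
      obtain ⟨m, rfl⟩ : ∃ m, k = m + 1 := ⟨k - 1, by omega⟩
      rw [← Finset.sum_mul, ← Nat.cast_sum, Nat.add_sub_cancel, sum_succ_mul_choose]
    rw [Finset.sum_congr rfl hin]
    -- Comparison of the coefficients of s^(l+2), through (k+1)·C(k,l+1) = (l+2)·C(k+1,l+2).
    have hterm : ∀ l ∈ Finset.range k, ((k + 1 : ℕ) : ℝ) * ((k.choose (l + 1) : ℝ) *
        (s ^ (l + 1 + 1) / ((l + 1 + 1).factorial : ℝ)) * p ^ (k - (l + 1)) *
          (1 - p) ^ (l + 1 + 1)) = s * (1 - p) * (((k + 1).choose (l + 2) : ℝ) *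
          ((s ^ (l + 1) / ((l + 1).factorial : ℝ)) * p ^ (k - 1 - l) * (1 - p) ^ (l + 1))) := by
      intro l _
      have e3 : k - 1 - l = k - (l + 1) := by omega
      have e4 : ((k + 1 : ℕ) : ℝ) * (k.choose (l + 1) : ℝ) =
          ((k + 1).choose (l + 2) : ℝ) * ((l + 1 + 1 : ℕ) : ℝ) := by
        exact_mod_cast Nat.add_one_mul_choose_eq k (l + 1)
      have hf : ((l + 1).factorial : ℝ) ≠ 0 := by positivity
      have hf2 : ((l + 1 + 1 : ℕ) : ℝ) ≠ 0 := by positivity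
      rw [e3, Nat.factorial_succ (l + 1)]
      calc _ = (((k + 1 : ℕ) : ℝ) * (k.choose (l + 1) : ℝ)) *
            (s ^ (l + 1 + 1) / (((l + 1 + 1) * (l + 1).factorial : ℕ) : ℝ)) *
              p ^ (k - (l + 1)) * (1 - p) ^ (l + 1 + 1) := by ring
        _ = _ := by
          rw [e4]
          push_cast
          push_cast at hf2
          field_simp
          ring
    have := Finset.sum_congr rfl hterm
    rw [← Finset.mul_sum, ← Finset.mul_sum] at this
    simp only [zero_add, Nat.choose_zero_right, Nat.cast_one, pow_one, Nat.factorial_one,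
      Nat.sub_zero, one_mul, div_one]
    calc _ = Real.exp (-s) * (((k + 1 : ℕ) : ℝ) * ∑ l ∈ Finset.range k, ((k.choose (l + 1) : ℝ) *
        (s ^ (l + 1 + 1) / ((l + 1 + 1).factorial : ℝ)) * p ^ (k - (l + 1)) *
          (1 - p) ^ (l + 1 + 1)) + ((k + 1 : ℕ) : ℝ) * (s * p ^ k * (1 - p))) := by ring
      _ = _ := by
        rw [this]
        push_cast
        ring

/-! ### Convergence from an asymptotic Panjer recursion -/

/-- Probability weights with bounded means that satisfy the Panjer recursion of a Pólya–Aeppli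
law asymptotically converge to the weights of this law. -/
theorem tendsto_polyaAeppliWeight {s p : ℝ} (hs : 0 < s) (hp : 0 ≤ p) (hp1 : p < 1)
    {q : ℕ → ℕ → ℝ} (hq : ∀ n k, 0 ≤ q n k) (hsum : ∀ n K, ∑ k ∈ Finset.range K, q n k ≤ 1)
    {C : ℝ} (htail : ∀ᶠ n in atTop, ∀ K : ℕ, (K : ℝ) * (1 - ∑ k ∈ Finset.range K, q n k) ≤ C)
    (hrec : ∀ k : ℕ, 0 < k → Tendsto (fun n => (k : ℝ) * q n k - s * (1 - p) *
      ∑ i ∈ Finset.range k, ((i : ℝ) + 1) * p ^ i * q n (k - 1 - i)) atTop (𝓝 0)) (k : ℕ) :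
    Tendsto (fun n => q n k) atTop (𝓝 (polyaAeppliWeight s p k)) := by
  set w := polyaAeppliWeight s p with hw
  have hw0 : w 0 = Real.exp (-s) := by simp [hw, polyaAeppliWeight]
  have hw0pos : 0 < w 0 := hw0 ▸ Real.exp_pos _
  -- The recursion is linear, so by induction it fixes the weights up to the common factor q n 0.
  have hratio : ∀ k, Tendsto (fun n => w 0 * q n k - w k * q n 0) atTop (𝓝 0) := by
    intro k
    induction k using Nat.strong_induction_on with
    | _ k ih =>
      rcases Nat.eq_zero_or_pos k with rfl | hk
      · simp
      have hk' : (k : ℝ) ≠ 0 := by positivity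
      have h1 := (hrec k hk).const_mul (w 0)
      have h2 : Tendsto (fun n => s * (1 - p) * ∑ i ∈ Finset.range k, ((i : ℝ) + 1) * p ^ i *
          (w 0 * q n (k - 1 - i) - w (k - 1 - i) * q n 0)) atTop
          (𝓝 (s * (1 - p) * ∑ i ∈ Finset.range k, ((i : ℝ) + 1) * p ^ i * 0)) := by
        refine (tendsto_finsetSum _ fun i hi => ?_).const_mul _
        have := Finset.mem_range.mp hi
        exact (ih (k - 1 - i) (by omega)).const_mul _
      have h3 := (h1.add h2).const_mul ((k : ℝ)⁻¹)
      simp only [mul_zero, Finset.sum_const_zero, add_zero] at h3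
      refine h3.congr fun n => ?_
      have hwk := polyaAeppliWeight_recursion s p k
      rw [← hw] at hwk
      have e1 : ∑ i ∈ Finset.range k, ((i : ℝ) + 1) * p ^ i *
          (w 0 * q n (k - 1 - i) - w (k - 1 - i) * q n 0) =
          w 0 * (∑ i ∈ Finset.range k, ((i : ℝ) + 1) * p ^ i * q n (k - 1 - i)) -
          (∑ i ∈ Finset.range k, ((i : ℝ) + 1) * p ^ i * w (k - 1 - i)) * q n 0 := by
        rw [Finset.mul_sum, Finset.sum_mul, ← Finset.sum_sub_distrib]
        exact Finset.sum_congr rfl fun i _ => by ring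
      rw [e1]
      set X := ∑ i ∈ Finset.range k, ((i : ℝ) + 1) * p ^ i * q n (k - 1 - i)
      set Y := ∑ i ∈ Finset.range k, ((i : ℝ) + 1) * p ^ i * w (k - 1 - i)
      have : w k = (k : ℝ)⁻¹ * (s * (1 - p) * Y) := by
        rw [← hwk]
        field_simp
      rw [this]
      field_simp
      ring
  have hwsum : HasSum w 1 := hasSum_polyaAeppliWeight hs hp hp1
  -- Normalisation fixes that factor: for K large, the first K weights carry almost all the mass, of
  -- w by summability and of q n by `htail` uniformly in large n.
  have h0 : Tendsto (fun n => q n 0) atTop (𝓝 (w 0)) := by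
    rw [Metric.tendsto_atTop]
    intro ε hε
    have hC : ∀ᶠ K : ℕ in atTop, |C| / K < ε / 4 :=
      (tendsto_const_div_atTop_nhds_zero_nat |C|).eventually (gt_mem_nhds (by positivity))
    have hW := (hwsum.tendsto_sum_nat).eventually (Metric.ball_mem_nhds (1 : ℝ)
      (show (0 : ℝ) < ε / 4 by positivity))
    obtain ⟨K, hK1, hK2, hK3⟩ := (hC.and (hW.and (eventually_gt_atTop 0))).exists
    have hlim : Tendsto (fun n => ∑ k ∈ Finset.range K, (w 0 * q n k - w k * q n 0)) atTop
        (𝓝 0) := by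
      simpa using tendsto_finsetSum (Finset.range K) fun k _ => hratio k
    have hev := hlim.eventually (Metric.ball_mem_nhds (0 : ℝ) (show (0 : ℝ) < ε / 4 by positivity))
    rw [← eventually_atTop]
    filter_upwards [hev, htail] with n hn ht
    have hs1 := ht K
    have hs2 := hsum n K
    simp only [Real.dist_eq] at hn hK2
    rw [Real.dist_eq]
    rw [sub_zero, Finset.sum_sub_distrib, ← Finset.mul_sum, ← Finset.sum_mul] at hn
    set Q := ∑ k ∈ Finset.range K, q n k
    set W := ∑ k ∈ Finset.range K, w k
    have hKpos : (0 : ℝ) < K := by exact_mod_cast hK3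
    have h1Q : 1 - Q < ε / 4 := by
      refine lt_of_le_of_lt ?_ hK1
      rw [le_div_iff₀ hKpos]
      linarith [le_abs_self C]
    have hq0 : q n 0 ≤ 1 := by
      have := hsum n 1
      simpa using this
    have hw01 : w 0 ≤ 1 := by rw [hw0]; exact Real.exp_le_one_iff.mpr (by linarith)
    have e : q n 0 - w 0 = q n 0 * (1 - W) - w 0 * (1 - Q) - (w 0 * Q - W * q n 0) := by ring
    have b1 : |q n 0 * (1 - W)| ≤ ε / 4 := by
      rw [abs_mul, abs_of_nonneg (hq n 0), abs_sub_comm]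
      calc _ ≤ 1 * |W - 1| := by gcongr
        _ ≤ _ := by linarith
    have b2 : |w 0 * (1 - Q)| ≤ ε / 4 := by
      rw [abs_mul, abs_of_pos hw0pos, abs_of_nonneg (by linarith)]
      calc _ ≤ 1 * (1 - Q) := by gcongr
        _ ≤ _ := by linarith
    rw [e]
    calc _ ≤ |q n 0 * (1 - W)| + |w 0 * (1 - Q)| + |w 0 * Q - W * q n 0| :=
          (abs_sub _ _).trans (by gcongr; exact abs_sub _ _)
      _ < ε := by linarith
  have h1 := ((hratio k).add (h0.const_mul (w k))).const_mul (w 0)⁻¹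
  have e : (w 0)⁻¹ * (0 + w k * w 0) = w k := by field_simp; ring
  rw [e] at h1
  refine h1.congr fun n => ?_
  field_simp
  ring

/-- Convergence in distribution of integer-valued random variables from convergence of the point
probabilities. -/
theorem tendstoInDistribution_nat_of_tendsto {Ω : Type*} [MeasurableSpace Ω] {P : Measure Ω}
    [IsProbabilityMeasure P] {S : ℕ → Ω → ℕ} (hS : ∀ n, Measurable (S n)) {ν : Measure ℕ}
    [IsProbabilityMeasure ν]
    (h : ∀ k, Tendsto (fun n => P.real {x | S n x = k}) atTop (𝓝 (ν.real {k}))) :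
    TendstoInDistribution S atTop id (fun _ => P) ν where
  forall_aemeasurable n := (hS n).aemeasurable
  aemeasurable_limit := aemeasurable_id
  tendsto := by
    -- In a discrete space the singletons form a π-system containing a neighbourhood of each point
    -- inside every open set.
    refine IsPiSystem.tendsto_probabilityMeasure_of_tendsto_of_mem
      (S := Set.range fun k : ℕ => ({k} : Set ℕ)) ?_ ?_ ?_ ?_
    · rintro _ ⟨a, rfl⟩ _ ⟨b, rfl⟩ ⟨c, hc1, hc2⟩
      exact ⟨a, by
        rw [Set.mem_singleton_iff] at hc1 hc2
        simp [← hc1, ← hc2]⟩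
    · rintro _ ⟨a, rfl⟩
      exact measurableSet_singleton a
    · intro u _ x hx
      exact ⟨{x}, ⟨x, rfl⟩, by simp, by simpa using hx⟩
    · rintro _ ⟨a, rfl⟩
      rw [← NNReal.tendsto_coe]
      have e : ∀ n, P.real {x | S n x = a} = (P.map (S n)).real {a} := fun n => by
        rw [map_measureReal_apply (hS n) (measurableSet_singleton a)]
        rfl
      have h' := h a
      simp only [e] at h'
      rw [← Measure.map_id (μ := ν)] at h'
      exact h'

theorem polyaAeppli_real_singleton {s p : ℝ} (hs : 0 < s) (hp : 0 ≤ p) (hp1 : p < 1) (k : ℕ) :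
    (polyaAeppli s p).real {k} = polyaAeppliWeight s p k := by
  rw [measureReal_def, polyaAeppli, Measure.sum_apply _ (measurableSet_singleton k),
    tsum_eq_single k]
  · simp [polyaAeppliWeight_nonneg hs hp hp1 k]
  · intro b hb
    simp [hb]

/-! ### Events prescribing the coordinates in a set of times -/

section Atoms

variable {A : Type*}

theorem shift_iterate_apply (m : ℕ) (γ : ℕ → A) (s : ℕ) : shift^[m] γ s = γ (s + m) := by
  induction m generalizing γ with
  | zero => rfl
  | succ m ih =>
    rw [Function.iterate_succ_apply, ih]
    rfl

/-- The event that the coordinates in `K` agree with those of `x`. -/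
def atom (x : ℕ → A) (K : Set ℕ) : Set (ℕ → A) := {γ | ∀ s ∈ K, γ s = x s}

theorem atom_union (x : ℕ → A) (K L : Set ℕ) : atom x (K ∪ L) = atom x K ∩ atom x L := by
  ext γ
  simp only [atom, Set.mem_ofPred_eq, Set.mem_union, Set.mem_inter_iff]
  exact ⟨fun h => ⟨fun s hs => h s (Or.inl hs), fun s hs => h s (Or.inr hs)⟩,
    fun h s hs => hs.elim (h.1 s) (h.2 s)⟩

theorem atom_congr {x y : ℕ → A} {K : Set ℕ} (h : ∀ s ∈ K, x s = y s) : atom x K = atom y K := by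
  ext γ
  simp only [atom, Set.mem_ofPred_eq]
  exact forall₂_congr fun s hs => by rw [h s hs]

@[simp] theorem atom_empty (x : ℕ → A) : atom x ∅ = Set.univ := by
  ext γ
  simp [atom]

theorem atom_eq_biInter (x : ℕ → A) (K : Set ℕ) : atom x K = ⋂ s ∈ K, {γ | γ s = x s} := by
  ext γ
  simp [atom]

theorem measurableSet_coordSigma_atom (x : ℕ → A) {K J : Set ℕ} (h : K ⊆ J) :
    MeasurableSet[coordSigma A J] (atom x K) := by
  rw [atom_eq_biInter]
  exact MeasurableSet.biInter K.to_countable fun s hs =>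
    MeasurableSpace.measurableSet_generateFrom ⟨s, h hs, x s, rfl⟩

theorem atom_eq_preimage_shift (x : ℕ → A) {K : Set ℕ} {c : ℕ} (h : ∀ s ∈ K, c ≤ s) :
    atom x K = shift^[c] ⁻¹' atom (shift^[c] x) {s | s + c ∈ K} := by
  ext γ
  simp only [atom, Set.mem_ofPred_eq, Set.mem_preimage, shift_iterate_apply]
  refine ⟨fun hγ s hs => hγ _ hs, fun hγ s hs => ?_⟩
  obtain ⟨u, rfl⟩ := Nat.exists_eq_add_of_le' (h s hs)
  exact hγ u hs

theorem cylinder_eq_atom (x : ℕ → A) (n : ℕ) : cylinder x n = atom x {s | s < n} := rfl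

variable [MeasurableSpace A]

theorem measurable_shift : Measurable (shift : (ℕ → A) → (ℕ → A)) :=
  measurable_pi_iff.mpr fun n => measurable_pi_apply (n + 1)

theorem real_preimage_shift {P : Measure (ℕ → A)} (hinv : MeasurePreserving shift P P) (c : ℕ)
    {E : Set (ℕ → A)} (hE : MeasurableSet E) : P.real (shift^[c] ⁻¹' E) = P.real E := by
  rw [measureReal_def, (hinv.iterate c).measure_preimage hE.nullMeasurableSet, measureReal_def]

variable [MeasurableSingletonClass A]

theorem measurableSet_atom (x : ℕ → A) (K : Set ℕ) : MeasurableSet (atom x K) := by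
  rw [atom_eq_biInter]
  exact MeasurableSet.biInter K.to_countable fun s _ =>
    (measurable_pi_apply s : Measurable fun γ : ℕ → A => γ s) (measurableSet_singleton (x s))

/-- `ψ`-mixing at the single gap `g`, with constant `ε`. -/
def MixesAt (P : Measure (ℕ → A)) (g : ℕ) (ε : ℝ) : Prop :=
  ∀ (n : ℕ) (E F : Set (ℕ → A)), MeasurableSet[coordSigma A {j | j < n}] E → MeasurableSet F →
    |P.real (E ∩ (shift^[n + g]) ⁻¹' F) - P.real E * P.real F| ≤ ε * P.real E * P.real F

/-! ### Approximate factorisation over separated windows. -/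

variable {P : Measure (ℕ → A)}


/-- An interval window carrying a word of `ω` has the measure of the cylinder of this word. -/
theorem real_atom_window (hinv : MeasurePreserving shift P P) 
    {x ω : ℕ → A} {c L : ℕ} (h : ∀ s < L, x (c + s) = ω s) :
    P.real (atom x {s | c ≤ s ∧ s < c + L}) = P.real (cylinder ω L) := by
  rw [atom_eq_preimage_shift (c := c) x fun s hs => hs.1,
    real_preimage_shift hinv c (measurableSet_atom _ _), cylinder_eq_atom]
  have e : {s | s + c ∈ {s | c ≤ s ∧ s < c + L}} = {s | s < L} := by
    ext s
    simp only [Set.mem_ofPred_eq]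
    omega
  rw [e]
  congr 1
  refine atom_congr fun s hs => ?_
  rw [shift_iterate_apply, add_comm, h s hs]

/-- The cut c splits the past from the future: the atom over K is an event of the first c
coordinates, and the atom over L is a preimage under the shift by c + g, to which mixing at gap g
applies. -/
theorem abs_real_atom_union_sub_le (hinv : MeasurePreserving shift P P) {g : ℕ} {ε : ℝ}
    (hmix : MixesAt P g ε) (x : ℕ → A)
    {K L : Set ℕ} {c : ℕ} (hK : ∀ s ∈ K, s < c) (hL : ∀ s ∈ L, c + g ≤ s) :
    |P.real (atom x (K ∪ L)) - P.real (atom x K) * P.real (atom x L)| ≤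
      ε * P.real (atom x K) * P.real (atom x L) := by
  have h := hmix c (atom x K) (atom (shift^[c + g] x) {s | s + (c + g) ∈ L})
    (measurableSet_coordSigma_atom x hK) (measurableSet_atom _ _)
  rw [← atom_eq_preimage_shift x hL] at h
  have e : P.real (atom x L) = P.real (atom (shift^[c + g] x) {s | s + (c + g) ∈ L}) := by
    rw [atom_eq_preimage_shift x hL, real_preimage_shift hinv _ (measurableSet_atom _ _)]
  rw [atom_union, e]
  exact h

/-- The union of the first `k` pairs of windows and an initial window. -/
def windowUnion (K₀ : Set ℕ) (V W : ℕ → Set ℕ) (k : ℕ) : Set ℕ :=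
  K₀ ∪ {s | ∃ i < k, s ∈ V i ∪ W i}

theorem windowUnion_succ (K₀ : Set ℕ) (V W : ℕ → Set ℕ) (k : ℕ) :
    windowUnion K₀ V W (k + 1) = (windowUnion K₀ V W k ∪ V k) ∪ W k := by
  ext s
  simp only [windowUnion, Set.mem_union, Set.mem_ofPred_eq, Nat.lt_succ_iff_lt_or_eq]
  constructor
  · rintro (h | ⟨i, hi | rfl, h⟩)
    · exact Or.inl (Or.inl (Or.inl h))
    · exact Or.inl (Or.inl (Or.inr ⟨i, hi, h⟩))
    · rcases h with h | h
      · exact Or.inl (Or.inr h)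
      · exact Or.inr h
  · rintro (((h | ⟨i, hi, h⟩) | h) | h)
    · exact Or.inl h
    · exact Or.inr ⟨i, Or.inl hi, h⟩
    · exact Or.inr ⟨k, Or.inr rfl, Or.inl h⟩
    · exact Or.inr ⟨k, Or.inr rfl, Or.inr h⟩

/-- Consecutive windows `K₀ < V 0 < W 0 < V 1 < W 1 < …` separated by gaps of length `g`, with
cut points `c i` before `V i` and `e i` between `V i` and `W i`. -/
structure Separated (g : ℕ) (c e : ℕ → ℕ) (K₀ : Set ℕ) (V W : ℕ → Set ℕ) (k : ℕ) : Prop where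
  initial_lt : ∀ i < k, ∀ s ∈ K₀, s < c i
  le_left : ∀ i < k, ∀ s ∈ V i, c i + g ≤ s
  left_lt : ∀ i < k, ∀ s ∈ V i, s < e i
  le_right : ∀ i < k, ∀ s ∈ W i, e i + g ≤ s
  right_lt : ∀ j < k, ∀ i < j, ∀ s ∈ W i, s < c j
  cut_le : ∀ i < k, c i ≤ e i
  cut_le' : ∀ j < k, ∀ i < j, e i ≤ c j


theorem Separated.of_succ {g : ℕ} {c e : ℕ → ℕ} {K₀ : Set ℕ} {V W : ℕ → Set ℕ} {k : ℕ}
    (h : Separated g c e K₀ V W (k + 1)) : Separated g c e K₀ V W k where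
  initial_lt i hi := h.initial_lt i (by omega)
  le_left i hi := h.le_left i (by omega)
  left_lt i hi := h.left_lt i (by omega)
  le_right i hi := h.le_right i (by omega)
  right_lt j hj := h.right_lt j (by omega)
  cut_le i hi := h.cut_le i (by omega)
  cut_le' j hj := h.cut_le' j (by omega)

theorem Separated.lt_cut {g : ℕ} {c e : ℕ → ℕ} {K₀ : Set ℕ} {V W : ℕ → Set ℕ} {k : ℕ}
    (h : Separated g c e K₀ V W (k + 1)) : ∀ s ∈ windowUnion K₀ V W k, s < c k := by
  rintro s (hs | ⟨i, hi, hs | hs⟩)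
  · exact h.initial_lt k (by omega) s hs
  · exact (h.left_lt i (by omega) s hs).trans_le (h.cut_le' k (by omega) i hi)
  · exact h.right_lt k (by omega) i hi s hs

/-- Windows are peeled off from the right. Each pair costs two applications of mixing, hence the
exponent 2k. -/
theorem real_atom_windowUnion_le [IsProbabilityMeasure P]
    (hinv : MeasurePreserving shift P P) {g : ℕ} {ε : ℝ}
    (hmix : MixesAt P g ε) (hε : 0 ≤ ε) (x : ℕ → A)
    {c e : ℕ → ℕ} {K₀ : Set ℕ} {V W : ℕ → Set ℕ} {k : ℕ} (h : Separated g c e K₀ V W k) :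
    P.real (atom x (windowUnion K₀ V W k)) ≤ (1 + ε) ^ (2 * k) * (P.real (atom x K₀) *
      ∏ i ∈ Finset.range k, P.real (atom x (V i)) * P.real (atom x (W i))) := by
  induction k with
  | zero => simp [windowUnion]
  | succ k ih =>
    have h1 := abs_real_atom_union_sub_le hinv hmix x h.lt_cut (h.le_left k (by omega))
    have h2 := abs_real_atom_union_sub_le hinv hmix x (K := windowUnion K₀ V W k ∪ V k)
      (L := W k) (c := e k) (by
        rintro s (hs | hs)
        · exact (h.lt_cut s hs).trans_le (h.cut_le k (by omega))
        · exact h.left_lt k (by omega) s hs) (h.le_right k (by omega))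
    rw [windowUnion_succ, Finset.prod_range_succ]
    have i1 := (abs_le.mp h1).2
    have i2 := (abs_le.mp h2).2
    have ih := ih h.of_succ
    set a := P.real (atom x (windowUnion K₀ V W k))
    set b := P.real (atom x (windowUnion K₀ V W k ∪ V k))
    set v := P.real (atom x (V k)) with hv
    set w := P.real (atom x (W k)) with hw
    have hv0 : 0 ≤ v := measureReal_nonneg
    have hw0 : 0 ≤ w := measureReal_nonneg
    calc _ ≤ (1 + ε) * b * w := by linarith
      _ ≤ (1 + ε) * ((1 + ε) * a * v) * w := by gcongr; linarith
      _ ≤ (1 + ε) * ((1 + ε) * ((1 + ε) ^ (2 * k) * (P.real (atom x K₀) *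
          ∏ i ∈ Finset.range k, P.real (atom x (V i)) * P.real (atom x (W i)))) * v) * w := by
        gcongr
      _ = _ := by ring

theorem le_real_atom_windowUnion [IsProbabilityMeasure P]
    (hinv : MeasurePreserving shift P P) {g : ℕ} {ε : ℝ}
    (hmix : MixesAt P g ε) (hε : ε ≤ 1) (x : ℕ → A)
    {c e : ℕ → ℕ} {K₀ : Set ℕ} {V W : ℕ → Set ℕ} {k : ℕ} (h : Separated g c e K₀ V W k) :
    (1 - ε) ^ (2 * k) * (P.real (atom x K₀) *
      ∏ i ∈ Finset.range k, P.real (atom x (V i)) * P.real (atom x (W i))) ≤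
      P.real (atom x (windowUnion K₀ V W k)) := by
  induction k with
  | zero => simp [windowUnion]
  | succ k ih =>
    have h1 := abs_real_atom_union_sub_le hinv hmix x h.lt_cut (h.le_left k (by omega))
    have h2 := abs_real_atom_union_sub_le hinv hmix x (K := windowUnion K₀ V W k ∪ V k)
      (L := W k) (c := e k) (by
        rintro s (hs | hs)
        · exact (h.lt_cut s hs).trans_le (h.cut_le k (by omega))
        · exact h.left_lt k (by omega) s hs) (h.le_right k (by omega))
    rw [windowUnion_succ, Finset.prod_range_succ]
    have i1 := (abs_le.mp h1).1
    have i2 := (abs_le.mp h2).1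
    have ih := ih h.of_succ
    set a := P.real (atom x (windowUnion K₀ V W k))
    set b := P.real (atom x (windowUnion K₀ V W k ∪ V k))
    set v := P.real (atom x (V k)) with hv
    set w := P.real (atom x (W k)) with hw
    have hv0 : 0 ≤ v := measureReal_nonneg
    have hw0 : 0 ≤ w := measureReal_nonneg
    have hε' : 0 ≤ 1 - ε := by linarith
    calc _ = (1 - ε) * ((1 - ε) * ((1 - ε) ^ (2 * k) * (P.real (atom x K₀) *
          ∏ i ∈ Finset.range k, P.real (atom x (V i)) * P.real (atom x (W i)))) * v) * w := by
            ring
      _ ≤ (1 - ε) * ((1 - ε) * a * v) * w := by gcongr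
      _ ≤ (1 - ε) * b * w := by gcongr; linarith
      _ ≤ _ := by linarith

end Atoms

/-! ### Decoupling -/

/-- The relative error of decoupling `k` pairs of windows by mixing with constant `ε`. -/
def decouplingError (k : ℕ) (ε : ℝ) : ℝ :=
  (1 + ε) ^ (2 * k) / ((1 - ε) ^ (2 * k)) ^ 2 - (1 - ε) ^ (2 * k) / ((1 + ε) ^ (2 * k)) ^ 2

theorem tendsto_decouplingError (k : ℕ) : Tendsto (decouplingError k) (𝓝 0) (𝓝 0) := by
  have h : ContinuousAt (decouplingError k) 0 := by
    unfold decouplingError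
    refine ContinuousAt.sub (ContinuousAt.div (by fun_prop) (by fun_prop) (by simp))
      (ContinuousAt.div (by fun_prop) (by fun_prop) (by simp))
  simpa [decouplingError] using h.tendsto

/-- A joint probability x and two marginals e, f, all known only up to factors l and u from the
reference products ab, a, b, are compared with one another. This transfers window-by-window
factorisation to a decoupling of two interleaved families. -/
theorem abs_sub_mul_le_of_comparable {l u x e f a b : ℝ} (hl : 0 < l) (hl1 : l ≤ 1) (hu : 1 ≤ u)
    (ha : 0 ≤ a) (hb : 0 ≤ b) (hx1 : l * (a * b) ≤ x) (hx2 : x ≤ u * (a * b)) (he1 : l * a ≤ e)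
    (he2 : e ≤ u * a) (hf1 : l * b ≤ f) (hf2 : f ≤ u * b) :
    |x - e * f| ≤ (u / l ^ 2 - l / u ^ 2) * (e * f) := by
  have hu0 : 0 < u := by linarith
  have hef1 : l ^ 2 * (a * b) ≤ e * f := by
    calc _ = (l * a) * (l * b) := by ring
      _ ≤ _ := by gcongr; exact le_trans (by positivity) he1
  have hef2 : e * f ≤ u ^ 2 * (a * b) := by
    calc _ ≤ (u * a) * (u * b) := by
          gcongr
          exact le_trans (by positivity) hf1
      _ = _ := by ring
  have hef : 0 ≤ e * f := le_trans (by positivity) hef1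
  have h1 : x ≤ u / l ^ 2 * (e * f) := by
    rw [div_mul_eq_mul_div, le_div_iff₀ (by positivity)]
    calc x * l ^ 2 ≤ u * (a * b) * l ^ 2 := by gcongr
      _ = u * (l ^ 2 * (a * b)) := by ring
      _ ≤ _ := by gcongr
  have h2 : l / u ^ 2 * (e * f) ≤ x := by
    rw [div_mul_eq_mul_div, div_le_iff₀ (by positivity)]
    calc l * (e * f) ≤ l * (u ^ 2 * (a * b)) := by gcongr
      _ = l * (a * b) * u ^ 2 := by ring
      _ ≤ _ := by gcongr
  have h3 : 1 ≤ u / l ^ 2 := by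
    rw [one_le_div (by positivity)]
    nlinarith
  have h4 : l / u ^ 2 ≤ 1 := by
    rw [div_le_one (by positivity)]
    nlinarith
  rw [abs_le]
  constructor <;> nlinarith

variable {A : Type*}

/-! ### Families of windows along an arithmetic pattern -/

/-- The times in the windows `[a i, a i + L i)`, `i < ℓ`. -/
def windows (ℓ : ℕ) (a L : ℕ → ℕ) : Set ℕ := {s | ∃ i < ℓ, a i ≤ s ∧ s < a i + L i}

/-- The event that, for each `i < ℓ`, the word `ω₀ … ω_{L i - 1}` is read at time `a i`. -/
def wordsAt (ω : ℕ → A) (ℓ : ℕ) (a L : ℕ → ℕ) : Set (ℕ → A) :=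
  {γ | ∀ i < ℓ, ∀ s < L i, γ (a i + s) = ω s}

theorem wordsAt_eq_atom {ω x : ℕ → A} {ℓ : ℕ} {a L : ℕ → ℕ} (hx : x ∈ wordsAt ω ℓ a L) :
    wordsAt ω ℓ a L = atom x (windows ℓ a L) := by
  ext γ
  constructor
  · rintro h s ⟨i, hi, h1, h2⟩
    obtain ⟨u, rfl⟩ := Nat.exists_eq_add_of_le h1
    rw [h i hi u (by omega), hx i hi u (by omega)]
  · intro h i hi s hs
    rw [h (a i + s) ⟨i, hi, by omega, by omega⟩, hx i hi s hs]

/-- Disjoint windows can be filled independently. A witness turns the event into an atom, the form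
in which the window estimates are stated. -/
theorem nonempty_wordsAt (ω : ℕ → A) (ℓ : ℕ) (a L : ℕ → ℕ)
    (h : ∀ j < ℓ, ∀ i < j, a i + L i ≤ a j) : (wordsAt ω ℓ a L).Nonempty := by
  induction ℓ with
  | zero => exact ⟨ω, fun i hi => absurd hi (Nat.not_lt_zero i)⟩
  | succ ℓ ih =>
    obtain ⟨x, hx⟩ := ih fun j hj => h j (by omega)
    refine ⟨fun s => if s < a ℓ then x s else ω (s - a ℓ), fun i hi s hs => ?_⟩
    rcases Nat.lt_succ_iff_lt_or_eq.mp hi with hi | rfl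
    · have := h ℓ (by omega) i hi
      simp only [if_pos (show a i + s < a ℓ by omega)]
      exact hx i hi s hs
    · simp

theorem Separated.mono {g : ℕ} {c e : ℕ → ℕ} {K₀ K₀' : Set ℕ} {V V' W W' : ℕ → Set ℕ} {k : ℕ}
    (h : Separated g c e K₀ V W k) (h₀ : K₀' ⊆ K₀) (hV : ∀ i, V' i ⊆ V i) (hW : ∀ i, W' i ⊆ W i) :
    Separated g c e K₀' V' W' k where
  initial_lt i hi s hs := h.initial_lt i hi s (h₀ hs)
  le_left i hi s hs := h.le_left i hi s (hV i hs)
  left_lt i hi s hs := h.left_lt i hi s (hV i hs)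
  le_right i hi s hs := h.le_right i hi s (hW i hs)
  right_lt j hj i hi s hs := h.right_lt j hj i hi s (hW i hs)
  cut_le := h.cut_le
  cut_le' := h.cut_le'

variable [MeasurableSpace A] [MeasurableSingletonClass A]

/-! ### Decoupling of words and remote events -/

/-- Two measures on a countable discrete space compare as their values on points do. -/
theorem measure_le_of_singleton_le {X : Type*} [Countable X] [MeasurableSpace X]
    [MeasurableSingletonClass X] {μ ν : Measure X} (h : ∀ x, μ {x} ≤ ν {x}) (B : Set X) :
    μ B ≤ ν B := by
  have e : ∀ μ : Measure X, μ B = ∑' x : B, μ {(x : X)} := fun μ => by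
    conv_lhs => rw [← Set.biUnion_of_singleton B]
    rw [measure_biUnion B.to_countable]
    · intro x _ y _ hxy
      simpa [Function.onFun] using hxy
    · intro x _
      exact measurableSet_singleton x
  rw [e μ, e ν]
  exact ENNReal.tsum_le_tsum fun x => h x

/-- The event `F` depends on the coordinates in `K` only. -/
def DependsOnCoords (F : Set (ℕ → A)) (K : Set ℕ) : Prop :=
  ∀ γ γ' : ℕ → A, (∀ s ∈ K, γ s = γ' s) → γ ∈ F → γ' ∈ F

/-- A decoupling estimate for atoms extends to all events depending on finitely many
coordinates. -/
theorem abs_real_inter_sub_le_of_atom [Countable A] {P : Measure (ℕ → A)}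
    [IsProbabilityMeasure P] {E F : Set (ℕ → A)} {K : Set ℕ}
    (hK : K.Finite) (hF : DependsOnCoords F K) {δ : ℝ} (hδ : 0 ≤ δ)
    (h : ∀ x : ℕ → A, |P.real (E ∩ atom x K) - P.real E * P.real (atom x K)| ≤
      δ * (P.real E * P.real (atom x K))) :
    |P.real (E ∩ F) - P.real E * P.real F| ≤ δ * (P.real E * P.real F) := by
  -- Projected to the coordinates in K, the space becomes countable, where inequalities between
  -- measures may be checked on points, that is, on atoms.
  have := hK.to_subtype
  set π : (ℕ → A) → (K → A) := fun γ s => γ s with hπ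
  have hπm : Measurable π := measurable_pi_iff.mpr fun s => measurable_pi_apply (s : ℕ)
  set B : Set (K → A) := π '' F with hB
  have hBm : MeasurableSet B := B.to_countable.measurableSet
  have hFB : F = π ⁻¹' B := by
    ext γ
    constructor
    · exact fun hγ => ⟨γ, hγ, rfl⟩
    · rintro ⟨γ', hγ', he⟩
      exact hF γ' γ (fun s hs => congrFun he ⟨s, hs⟩) hγ'
  obtain ⟨x₀⟩ := nonempty_of_isProbabilityMeasure P
  have hsing : ∀ c : K → A, ∃ x : ℕ → A, π ⁻¹' {c} = atom x K := by
    classical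
    intro c
    refine ⟨fun s => if h : s ∈ K then c ⟨s, h⟩ else x₀ s, ?_⟩
    ext γ
    simp only [hπ, Set.mem_preimage, Set.mem_singleton_iff, funext_iff, Subtype.forall, atom,
      Set.mem_ofPred_eq]
    exact forall₂_congr fun s hs => by rw [dif_pos hs]
  have hcyl : ∀ c : K → A, |P.real (E ∩ π ⁻¹' {c}) - P.real E * P.real (π ⁻¹' {c})| ≤
      δ * (P.real E * P.real (π ⁻¹' {c})) := fun c => by
    obtain ⟨x, hx⟩ := hsing c
    rw [hx]
    exact h x
  have hmap : ∀ C : Set (K → A), (P.restrict E).map π C = P (E ∩ π ⁻¹' C) := fun C => by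
    have hC : MeasurableSet C := C.to_countable.measurableSet
    rw [Measure.map_apply hπm hC, Measure.restrict_apply (hπm hC), Set.inter_comm]
  have hmap' : ∀ C : Set (K → A), P.map π C = P (π ⁻¹' C) := fun C =>
    Measure.map_apply hπm C.to_countable.measurableSet
  have he : 0 ≤ P.real E := measureReal_nonneg
  have hup : P.real (E ∩ F) ≤ (1 + δ) * P.real E * P.real F := by
    have h1 := measure_le_of_singleton_le (μ := (P.restrict E).map π)
      (ν := ENNReal.ofReal ((1 + δ) * P.real E) • P.map π) (fun c => by
        rw [hmap, Measure.smul_apply, hmap', smul_eq_mul, ← ofReal_measureReal,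
          ← ofReal_measureReal, ← ENNReal.ofReal_mul (by positivity)]
        apply ENNReal.ofReal_le_ofReal
        linarith [(abs_le.mp (hcyl c)).2]) B
    rw [hmap, Measure.smul_apply, hmap', ← hFB, smul_eq_mul, ← ofReal_measureReal,
      ← ofReal_measureReal, ← ENNReal.ofReal_mul (by positivity)] at h1
    exact (ENNReal.ofReal_le_ofReal_iff (by positivity)).mp h1
  have hlow : (1 - δ) * P.real E * P.real F ≤ P.real (E ∩ F) := by
    rcases le_or_gt δ 1 with hδ1 | hδ1
    · have h0 : 0 ≤ (1 - δ) * P.real E := mul_nonneg (by linarith) he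
      have h1 := measure_le_of_singleton_le (ν := (P.restrict E).map π)
        (μ := ENNReal.ofReal ((1 - δ) * P.real E) • P.map π) (fun c => by
          rw [hmap, Measure.smul_apply, hmap', smul_eq_mul, ← ofReal_measureReal,
            ← ofReal_measureReal, ← ENNReal.ofReal_mul h0]
          apply ENNReal.ofReal_le_ofReal
          linarith [(abs_le.mp (hcyl c)).1]) B
      rw [hmap, Measure.smul_apply, hmap', ← hFB, smul_eq_mul, ← ofReal_measureReal,
        ← ofReal_measureReal, ← ENNReal.ofReal_mul h0] at h1
      exact (ENNReal.ofReal_le_ofReal_iff measureReal_nonneg).mp h1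
    -- For δ > 1 the lower bound is nonpositive.
    · refine le_trans ?_ measureReal_nonneg
      have : 0 ≤ (δ - 1) * (P.real E * P.real F) :=
        mul_nonneg (by linarith) (by positivity)
      linarith
  rw [abs_le]
  constructor <;> linarith

section Mixing

variable {d : ℕ → ℕ} {ℓ : ℕ}

theorem mul_add_le_mul (hd : StrictMono d) {i j m : ℕ} (h : i < j) : d i * m + m ≤ d j * m := by
  calc d i * m + m = (d i + 1) * m := by ring
    _ ≤ _ := Nat.mul_le_mul_right m (hd h)

theorem le_mul_of_strictMono (hd : StrictMono d) (hd0 : 1 ≤ d 0) (i m : ℕ) : m ≤ d i * m :=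
  Nat.le_mul_of_pos_left m (hd0.trans (hd.monotone (Nat.zero_le i)))

/-- The windows near the times `d i * m`, and the complementary windows that keep the distance `n`
from them. -/
theorem separated_of_far (hd : StrictMono d) (hd0 : 1 ≤ d 0) {m n : ℕ} (hm : 5 * n ≤ m)
    (ℓ : ℕ) :
    Separated n (fun i => d i * m - 2 * n) (fun i => d i * m + 2 * n) {s | s + 2 * n < d 0 * m}
      (fun i => {s | d i * m ≤ s + n ∧ s < d i * m + 2 * n})
      (fun i => {s | d i * m + 3 * n ≤ s ∧ (i + 1 < ℓ → s + 2 * n < d (i + 1) * m)}) ℓ where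
  initial_lt i hi s hs := by
    have : d 0 * m ≤ d i * m := Nat.mul_le_mul_right m (hd.monotone (Nat.zero_le i))
    simp only [Set.mem_ofPred_eq] at hs
    omega
  le_left i hi s hs := by
    have := le_mul_of_strictMono hd hd0 i m
    simp only [Set.mem_ofPred_eq] at hs
    omega
  left_lt i hi s hs := hs.2
  le_right i hi s hs := by
    simp only [Set.mem_ofPred_eq] at hs
    omega
  right_lt j hj i hi s hs := by
    have h1 := hs.2 (by omega)
    have : d (i + 1) * m ≤ d j * m := Nat.mul_le_mul_right m (hd.monotone hi)
    omega
  cut_le i hi := by omega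
  cut_le' j hj i hi := by
    have := mul_add_le_mul (m := m) hd hi
    omega

variable {P : Measure (ℕ → A)} [IsProbabilityMeasure P]

/-- The atoms over K, over L and over K ∪ L all factorise along one and the same separated scheme: K
meets only the left windows around d_i m, and L only the initial and right windows between them. -/
theorem abs_real_atom_inter_atom_sub_le (hinv : MeasurePreserving shift P P)
    (hd : StrictMono d) (hd0 : 1 ≤ d 0) (hℓ : 1 ≤ ℓ) {m n : ℕ} (hm : 5 * n ≤ m)
    {ε : ℝ} (hmix : MixesAt P n ε) (hε : 0 ≤ ε) (hε1 : ε < 1) {K L : Set ℕ}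
    (hK : ∀ s ∈ K, ∃ i < ℓ, d i * m ≤ s + n ∧ s < d i * m + 2 * n)
    (hL : ∀ s ∈ L, ∀ i < ℓ, s + 2 * n < d i * m ∨ d i * m + 3 * n ≤ s) (x : ℕ → A) :
    |P.real (atom x K ∩ atom x L) - P.real (atom x K) * P.real (atom x L)| ≤
      decouplingError ℓ ε * (P.real (atom x K) * P.real (atom x L)) := by
  have hsep := separated_of_far hd hd0 hm ℓ
  set V : ℕ → Set ℕ := fun i => {s | d i * m ≤ s + n ∧ s < d i * m + 2 * n} with hV
  set W : ℕ → Set ℕ := fun i => {s | d i * m + 3 * n ≤ s ∧ (i + 1 < ℓ → s + 2 * n < d (i + 1) * m)}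
    with hW
  set K₀ : Set ℕ := {s | s + 2 * n < d 0 * m} with hK₀
  have hL' : ∀ s ∈ L, s ∈ K₀ ∨ ∃ i < ℓ, s ∈ W i := by
    intro s hs
    by_cases h0 : s + 2 * n < d 0 * m
    · exact Or.inl h0
    · right
      have h0' : d 0 * m + 3 * n ≤ s := (hL s hs 0 hℓ).resolve_left h0
      -- The window containing s is indexed by the last d_i m that s has passed.
      have hg := Nat.findGreatest_spec (P := fun i => d i * m + 3 * n ≤ s) (Nat.zero_le (ℓ - 1)) h0'
      refine ⟨Nat.findGreatest (fun i => d i * m + 3 * n ≤ s) (ℓ - 1), ?_, hg, fun hlt => ?_⟩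
      · have := Nat.findGreatest_le (P := fun i => d i * m + 3 * n ≤ s) (ℓ - 1)
        omega
      · exact (hL s hs _ hlt).resolve_right
          (Nat.findGreatest_is_greatest (P := fun i => d i * m + 3 * n ≤ s) (n := ℓ - 1)
            (Nat.lt_succ_self _) (by omega))
  have e1 : windowUnion ∅ (fun i => K ∩ V i) (fun _ => ∅) ℓ = K := by
    ext s
    simp only [windowUnion, Set.empty_union, Set.union_empty, Set.mem_ofPred_eq, Set.mem_inter_iff]
    constructor
    · rintro ⟨i, _, h, _⟩
      exact h
    · intro h
      obtain ⟨i, hi, hs⟩ := hK s h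
      exact ⟨i, hi, h, hs⟩
  have e2 : windowUnion (L ∩ K₀) (fun _ => ∅) (fun i => L ∩ W i) ℓ = L := by
    ext s
    simp only [windowUnion, Set.empty_union, Set.mem_union, Set.mem_ofPred_eq, Set.mem_inter_iff]
    constructor
    · rintro (h | ⟨i, _, h, _⟩)
      · exact h.1
      · exact h
    · intro h
      rcases hL' s h with h' | ⟨i, hi, h'⟩
      · exact Or.inl ⟨h, h'⟩
      · exact Or.inr ⟨i, hi, h, h'⟩
  have e3 : windowUnion (L ∩ K₀) (fun i => K ∩ V i) (fun i => L ∩ W i) ℓ = K ∪ L := by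
    conv_rhs => rw [← e1, ← e2]
    ext s
    simp only [windowUnion, Set.empty_union, Set.union_empty, Set.mem_union, Set.mem_ofPred_eq]
    constructor
    · rintro (h | ⟨i, hi, h | h⟩)
      · exact Or.inr (Or.inl h)
      · exact Or.inl ⟨i, hi, h⟩
      · exact Or.inr (Or.inr ⟨i, hi, h⟩)
    · rintro (⟨i, hi, h⟩ | h | ⟨i, hi, h⟩)
      · exact Or.inr ⟨i, hi, Or.inl h⟩
      · exact Or.inl h
      · exact Or.inr ⟨i, hi, Or.inr h⟩
  have s1 := hsep.mono (K₀' := ∅) (V' := fun i => K ∩ V i) (W' := fun _ => ∅) (by simp)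
    (fun i => Set.inter_subset_right) (by simp)
  have s2 := hsep.mono (K₀' := L ∩ K₀) (V' := fun _ => ∅) (W' := fun i => L ∩ W i)
    Set.inter_subset_right (by simp) (fun i => Set.inter_subset_right)
  have s3 := hsep.mono (K₀' := L ∩ K₀) (V' := fun i => K ∩ V i) (W' := fun i => L ∩ W i)
    Set.inter_subset_right (fun i => Set.inter_subset_right) (fun i => Set.inter_subset_right)
  have u1 := real_atom_windowUnion_le hinv hmix hε x s1
  have l1 := le_real_atom_windowUnion hinv hmix hε1.le x s1
  have u2 := real_atom_windowUnion_le hinv hmix hε x s2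
  have l2 := le_real_atom_windowUnion hinv hmix hε1.le x s2
  have u3 := real_atom_windowUnion_le hinv hmix hε x s3
  have l3 := le_real_atom_windowUnion hinv hmix hε1.le x s3
  simp only [atom_empty, probReal_univ, one_mul, mul_one] at u1 l1 u2 l2
  rw [e1] at u1 l1
  rw [e2] at u2 l2
  rw [e3, atom_union, Finset.prod_mul_distrib, mul_left_comm (P.real (atom x (L ∩ K₀)))] at u3 l3
  have hl : 0 < 1 - ε := by linarith
  exact abs_sub_mul_le_of_comparable (pow_pos hl _) (pow_le_one₀ hl.le (by linarith))
    (one_le_pow₀ (by linarith)) (Finset.prod_nonneg fun _ _ => measureReal_nonneg)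
    (mul_nonneg measureReal_nonneg (Finset.prod_nonneg fun _ _ => measureReal_nonneg))
    l3 u3 l1 u1 l2 u2

theorem decouplingError_nonneg (k : ℕ) {ε : ℝ} (hε : 0 ≤ ε) (hε1 : ε < 1) :
    0 ≤ decouplingError k ε := by
  have hl : 0 < (1 - ε) ^ (2 * k) := pow_pos (by linarith) _
  have hl1 : (1 - ε) ^ (2 * k) ≤ 1 := pow_le_one₀ (by linarith) (by linarith)
  have hu : 1 ≤ (1 + ε) ^ (2 * k) := one_le_pow₀ (by linarith)
  rw [decouplingError, sub_nonneg, div_le_div_iff₀ (by positivity) (by positivity)]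
  have h1 : ((1 - ε) ^ (2 * k)) ^ 2 ≤ 1 := pow_le_one₀ hl.le hl1
  have h2 : 1 ≤ ((1 + ε) ^ (2 * k)) ^ 2 := one_le_pow₀ hu
  nlinarith

/-- Words read near the times `d i * m` decouple from events at other times. -/
theorem abs_real_wordsAt_inter_sub_le [Countable A] (hinv : MeasurePreserving shift P P)
    (hd : StrictMono d) (hd0 : 1 ≤ d 0) (hℓ : 1 ≤ ℓ) {m n : ℕ} (hm : 5 * n ≤ m)
    {ε : ℝ} (hmix : MixesAt P n ε) (hε : 0 ≤ ε) (hε1 : ε < 1) (ω : ℕ → A) {a L : ℕ → ℕ}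
    (ha : ∀ i < ℓ, d i * m ≤ a i + n) (haL : ∀ i < ℓ, a i + L i ≤ d i * m + 2 * n)
    {K : Set ℕ} (hK : K.Finite)
    (hKd : ∀ s ∈ K, ∀ i < ℓ, s + 2 * n < d i * m ∨ d i * m + 3 * n ≤ s)
    {F : Set (ℕ → A)} (hF : DependsOnCoords F K) :
    |P.real (wordsAt ω ℓ a L ∩ F) - P.real (wordsAt ω ℓ a L) * P.real F| ≤
      decouplingError ℓ ε * (P.real (wordsAt ω ℓ a L) * P.real F) := by
  classical
  obtain ⟨x, hx⟩ := nonempty_wordsAt ω ℓ a L fun j hj i hi => by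
    have := mul_add_le_mul (m := m) hd hi
    have := ha j hj
    have := haL i (by omega)
    omega
  have hwin : ∀ s ∈ windows ℓ a L, ∃ i < ℓ, d i * m ≤ s + n ∧ s < d i * m + 2 * n := by
    rintro s ⟨i, hi, h1, h2⟩
    have := ha i hi
    have := haL i hi
    exact ⟨i, hi, by omega, by omega⟩
  rw [wordsAt_eq_atom hx]
  refine abs_real_inter_sub_le_of_atom hK hF
    (decouplingError_nonneg ℓ hε hε1) fun y => ?_
  -- The windows of the words are disjoint from K, so one sequence can equal y on K and x on the
  -- windows.
  have h := abs_real_atom_inter_atom_sub_le hinv hd hd0 hℓ hm hmix hε hε1 hwin hKd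
    (fun s => if s ∈ K then y s else x s)
  rw [atom_congr (K := K) (y := y) fun s hs => if_pos hs,
    atom_congr (K := windows ℓ a L) (y := x) fun s hs => if_neg fun hsK => ?_] at h
  · exact h
  · obtain ⟨i, hi, h1, h2⟩ := hwin s hs
    rcases hKd s hsK i hi with h' | h' <;> omega

theorem real_wordsAt_bounds (hinv : MeasurePreserving shift P P)
    (hd : StrictMono d) (hd0 : 1 ≤ d 0) {m n : ℕ} (hm : 5 * n ≤ m)
    {ε : ℝ} (hmix : MixesAt P n ε) (hε : 0 ≤ ε) (hε1 : ε < 1) (ω : ℕ → A) {a L : ℕ → ℕ}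
    (ha : ∀ i < ℓ, d i * m ≤ a i + n) (haL : ∀ i < ℓ, a i + L i ≤ d i * m + 2 * n) :
    (1 - ε) ^ (2 * ℓ) * ∏ i ∈ Finset.range ℓ, P.real (cylinder ω (L i)) ≤
        P.real (wordsAt ω ℓ a L) ∧
      P.real (wordsAt ω ℓ a L) ≤
        (1 + ε) ^ (2 * ℓ) * ∏ i ∈ Finset.range ℓ, P.real (cylinder ω (L i)) := by
  obtain ⟨x, hx⟩ := nonempty_wordsAt ω ℓ a L fun j hj i hi => by
    have := mul_add_le_mul (m := m) hd hi
    have := ha j hj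
    have := haL i (by omega)
    omega
  set V : ℕ → Set ℕ := fun i => {s | i < ℓ ∧ a i ≤ s ∧ s < a i + L i} with hV
  have hsep := (separated_of_far hd hd0 hm ℓ).mono (K₀' := ∅) (V' := V) (W' := fun _ => ∅) (by simp)
    (fun i s hs => by
      have := ha i hs.1
      have := haL i hs.1
      simp only [hV, Set.mem_ofPred_eq] at hs ⊢
      omega) (by simp)
  have hu := real_atom_windowUnion_le hinv hmix hε x hsep
  have hl := le_real_atom_windowUnion hinv hmix hε1.le x hsep
  have e : windowUnion ∅ V (fun _ => ∅) ℓ = windows ℓ a L := by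
    ext s
    simp only [windowUnion, windows, hV, Set.empty_union, Set.union_empty, Set.mem_ofPred_eq]
    constructor
    · rintro ⟨i, hi, _, h⟩
      exact ⟨i, hi, h⟩
    · rintro ⟨i, hi, h⟩
      exact ⟨i, hi, hi, h⟩
  have e2 : ∏ i ∈ Finset.range ℓ, P.real (atom x (V i)) =
      ∏ i ∈ Finset.range ℓ, P.real (cylinder ω (L i)) := by
    refine Finset.prod_congr rfl fun i hi => ?_
    have hi' := Finset.mem_range.mp hi
    rw [← real_atom_window hinv (x := x) (c := a i) fun s hs => hx i hi' s hs]
    simp [hV, hi']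
  simp only [atom_empty, probReal_univ, one_mul, mul_one] at hu hl
  rw [e, e2, ← wordsAt_eq_atom hx] at hu hl
  exact ⟨hl, hu⟩

/-- The words `ω₀ … ω_{n-1}` at the times `d i * m` together with a word `y₀ … y_{h-1}` read before
all of them have small probability. -/
theorem real_wordsAt_inter_before_le (hinv : MeasurePreserving shift P P)
    (hd : StrictMono d) {m n : ℕ} (hm : n ≤ m) {ε : ℝ}
    (hmix : MixesAt P 0 ε) (hε : 0 ≤ ε) (ω y : ℕ → A) {b h : ℕ} (hb : b + h ≤ d 0 * m) :
    P.real (wordsAt ω ℓ (fun i => d i * m) (fun _ => n) ∩ {γ | ∀ s < h, γ (b + s) = y s}) ≤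
      (1 + ε) ^ (2 * ℓ) * (P.real (cylinder y h) * P.real (cylinder ω n) ^ ℓ) := by
  rcases Set.eq_empty_or_nonempty
    (wordsAt ω ℓ (fun i => d i * m) (fun _ => n) ∩ {γ | ∀ s < h, γ (b + s) = y s}) with he | ⟨x, hx⟩
  · rw [he, measureReal_empty]
    positivity
  -- Gap 0 suffices for an upper bound up to a constant: the windows only need to be disjoint and
  -- ordered.
  have hsep : Separated 0 (fun i => d i * m) (fun i => d i * m + n) {s | b ≤ s ∧ s < b + h}
      (fun i => {s | d i * m ≤ s ∧ s < d i * m + n}) (fun _ => ∅) ℓ :=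
    { initial_lt := fun i hi s hs => by
        have : d 0 * m ≤ d i * m := Nat.mul_le_mul_right m (hd.monotone (Nat.zero_le i))
        exact (hs.2.trans_le hb).trans_le this
      le_left := fun i hi s hs => hs.1
      left_lt := fun i hi s hs => hs.2
      le_right := fun i hi s hs => absurd hs (Set.notMem_empty s)
      right_lt := fun j hj i hi s hs => absurd hs (Set.notMem_empty s)
      cut_le := fun i hi => Nat.le_add_right _ _
      cut_le' := fun j hj i hi => by
        have := mul_add_le_mul (m := m) hd hi
        omega }
  refine le_trans (measureReal_mono (s₂ := atom x (windowUnion _ _ _ ℓ)) ?_)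
    ((real_atom_windowUnion_le hinv hmix hε x hsep).trans_eq ?_)
  · rintro γ ⟨h1, h2⟩ s (hs | ⟨i, hi, hs | hs⟩)
    · obtain ⟨u, rfl⟩ := Nat.exists_eq_add_of_le hs.1
      have hu : u < h := by have := hs.2; omega
      rw [h2 u hu, hx.2 u hu]
    · obtain ⟨u, rfl⟩ := Nat.exists_eq_add_of_le hs.1
      have hu : u < n := by have := hs.2; omega
      rw [h1 i hi u hu, hx.1 i hi u hu]
    · exact absurd hs (Set.notMem_empty s)
  · rw [real_atom_window hinv hx.2]
    simp only [atom_empty, probReal_univ, mul_one]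
    rw [Finset.prod_congr rfl fun i hi =>
      real_atom_window hinv (hx.1 i (Finset.mem_range.mp hi)), Finset.prod_const,
      Finset.card_range]

/-- The words `ω₀ … ω_{n-1}` at the times `d i * m` together with a word `y₀ … y_{h-1}` read after
all of them have small probability. -/
theorem real_wordsAt_inter_after_le (hinv : MeasurePreserving shift P P)
    (hd : StrictMono d) {m n : ℕ} (hm : n ≤ m) {ε : ℝ}
    (hmix : MixesAt P 0 ε) (hε : 0 ≤ ε) (ω y : ℕ → A) {b h : ℕ}
    (hb : d ℓ * m + n ≤ b) :
    P.real (wordsAt ω (ℓ + 1) (fun i => d i * m) (fun _ => n) ∩ {γ | ∀ s < h, γ (b + s) = y s}) ≤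
      (1 + ε) ^ (2 * (ℓ + 1)) * (P.real (cylinder y h) * P.real (cylinder ω n) ^ (ℓ + 1)) := by
  rcases Set.eq_empty_or_nonempty
    (wordsAt ω (ℓ + 1) (fun i => d i * m) (fun _ => n) ∩ {γ | ∀ s < h, γ (b + s) = y s})
    with he | ⟨x, hx⟩
  · rw [he, measureReal_empty]
    positivity
  -- The additional word occupies the right window of the last pair; all other right windows are
  -- empty.
  have hsep : Separated 0 (fun i => d i * m) (fun i => d i * m + n) ∅
      (fun i => {s | d i * m ≤ s ∧ s < d i * m + n})
      (fun i => {s | i = ℓ ∧ b ≤ s ∧ s < b + h}) (ℓ + 1) :=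
    { initial_lt := fun i hi s hs => absurd hs (Set.notMem_empty s)
      le_left := fun i hi s hs => hs.1
      left_lt := fun i hi s hs => hs.2
      le_right := fun i hi s hs => by
        obtain ⟨rfl, h1, h2⟩ := hs
        omega
      right_lt := fun j hj i hi s hs => by
        have := hs.1
        omega
      cut_le := fun i hi => Nat.le_add_right _ _
      cut_le' := fun j hj i hi => by
        have := mul_add_le_mul (m := m) hd hi
        omega }
  refine le_trans (measureReal_mono (s₂ := atom x (windowUnion _ _ _ (ℓ + 1))) ?_)
    ((real_atom_windowUnion_le hinv hmix hε x hsep).trans_eq ?_)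
  · rintro γ ⟨h1, h2⟩ s (hs | ⟨i, hi, hs | hs⟩)
    · exact absurd hs (Set.notMem_empty s)
    · obtain ⟨u, rfl⟩ := Nat.exists_eq_add_of_le hs.1
      have hu : u < n := by have := hs.2; omega
      rw [h1 i hi u hu, hx.1 i hi u hu]
    · obtain ⟨u, rfl⟩ := Nat.exists_eq_add_of_le hs.2.1
      have hu : u < h := by have := hs.2.2; omega
      rw [h2 u hu, hx.2 u hu]
  · rw [Finset.prod_mul_distrib, Finset.prod_congr rfl fun i hi =>
      real_atom_window hinv (hx.1 i (Finset.mem_range.mp hi)), Finset.prod_const,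
      Finset.card_range, Finset.prod_eq_single ℓ]
    · simp only [true_and, atom_empty, probReal_univ, one_mul]
      rw [real_atom_window hinv hx.2, mul_comm (P.real (cylinder y h))]
    · intro i _ hi
      simp [hi]
    · simp

end Mixing

/-! ### Overlaps of occurrences of a periodic word -/

section Overlaps

variable {A : Type*}

/-- The sequence `ω` has minimal period `r`, the times `d 0 < … < d ℓ` are positive, and `κ` is the
smallest step `j` for which all `d i * j` are periods of `ω`. -/
structure PeriodicData (ω : ℕ → A) (d : ℕ → ℕ) (ℓ r κ : ℕ) : Prop where
  strictMono : StrictMono d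
  one_le : 1 ≤ d 0
  r_pos : 0 < r
  dvd_iff : ∀ m, r ∣ m ↔ shift^[m] ω = ω
  κ_pos : 0 < κ
  κ_dvd_iff : ∀ j, κ ∣ j ↔ ∀ i < ℓ + 1, r ∣ d i * j

/-- The event that `ω₀ … ω_{n-1}` is read at all the times `d i * m`, `i ≤ ℓ`. -/
def hit (ω : ℕ → A) (d : ℕ → ℕ) (ℓ n m : ℕ) : Set (ℕ → A) :=
  wordsAt ω (ℓ + 1) (fun i => d i * m) (fun _ => n)

/-- The event that `ω₀ … ω_{n + d i * j - 1}` is read at all the times `d i * m`, `i ≤ ℓ`. -/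
def run (ω : ℕ → A) (d : ℕ → ℕ) (ℓ n m j : ℕ) : Set (ℕ → A) :=
  wordsAt ω (ℓ + 1) (fun i => d i * m) (fun i => n + d i * j)

theorem mem_hit {ω : ℕ → A} {d : ℕ → ℕ} {ℓ n m : ℕ} {γ : ℕ → A} :
    γ ∈ hit ω d ℓ n m ↔ ∀ i < ℓ + 1, ∀ s < n, γ (d i * m + s) = ω s := Iff.rfl

theorem mem_run {ω : ℕ → A} {d : ℕ → ℕ} {ℓ n m j : ℕ} {γ : ℕ → A} :
    γ ∈ run ω d ℓ n m j ↔ ∀ i < ℓ + 1, ∀ s < n + d i * j, γ (d i * m + s) = ω s := Iff.rfl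

namespace PeriodicData

variable {ω : ℕ → A} {d : ℕ → ℕ} {ℓ r κ : ℕ}

theorem apply_add (D : PeriodicData ω d ℓ r κ) {m : ℕ} (h : r ∣ m) (s : ℕ) : ω (s + m) = ω s := by
  conv_rhs => rw [← (D.dvd_iff m).mp h]
  rw [shift_iterate_apply]

theorem le_last (D : PeriodicData ω d ℓ r κ) {i : ℕ} (hi : i < ℓ + 1) : d i ≤ d ℓ :=
  D.strictMono.monotone (Nat.lt_succ_iff.mp hi)

theorem last_pos (D : PeriodicData ω d ℓ r κ) : 1 ≤ d ℓ :=
  D.one_le.trans (D.strictMono.monotone (Nat.zero_le ℓ))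

theorem run_subset_run (D : PeriodicData ω d ℓ r κ) {n m j i : ℕ} (hκ : κ ∣ i) (hij : i ≤ j) :
    run ω d ℓ n m j ⊆ run ω d ℓ n (m + i) (j - i) := by
  intro γ hγ
  rw [mem_run] at hγ ⊢
  intro u hu s hs
  obtain ⟨t, rfl⟩ := Nat.exists_eq_add_of_le hij
  rw [Nat.add_sub_cancel_left] at hs
  have h := hγ u hu (s + d u * i) (by rw [mul_add]; omega)
  rw [D.apply_add ((D.κ_dvd_iff i).mp hκ u hu)] at h
  rw [← h]
  congr 1
  ring

theorem run_subset_hit (D : PeriodicData ω d ℓ r κ) {n m j i : ℕ} (hκ : κ ∣ i) (hij : i ≤ j) :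
    run ω d ℓ n m j ⊆ hit ω d ℓ n (m + i) := fun _ hγ u hu s hs =>
  mem_run.mp (D.run_subset_run hκ hij hγ) u hu s (Nat.lt_add_right _ hs)

/-- Since d_u j ≤ n, the two copies of the word at d_u m and d_u (m + j) overlap or abut. As d_u j
is a period of ω, together they spell one longer prefix of ω. -/
theorem hit_inter_hit (D : PeriodicData ω d ℓ r κ) {n m j : ℕ} (hκ : κ ∣ j) (hj : d ℓ * j ≤ n) :
    hit ω d ℓ n m ∩ hit ω d ℓ n (m + j) = run ω d ℓ n m j := by
  refine Set.Subset.antisymm ?_ fun γ hγ => ⟨?_, D.run_subset_hit hκ le_rfl hγ⟩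
  · rintro γ ⟨h1, h2⟩
    rw [mem_hit] at h1 h2
    rw [mem_run]
    intro u hu s hs
    rcases lt_or_ge s n with hsn | hsn
    · exact h1 u hu s hsn
    · have hle : d u * j ≤ n := (Nat.mul_le_mul_right j (D.le_last hu)).trans hj
      obtain ⟨t, rfl⟩ := Nat.exists_eq_add_of_le' (hle.trans hsn)
      rw [D.apply_add ((D.κ_dvd_iff j).mp hκ u hu), ← h2 u hu t (by omega)]
      congr 1
      ring
  · exact D.run_subset_hit (dvd_zero κ) (Nat.zero_le j) hγ

/-- The two copies overlap in at least r letters. Agreement on one full period makes d_u j a period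
of ω for every u, which is divisibility by κ. -/
theorem dvd_of_hit_of_hit (D : PeriodicData ω d ℓ r κ) {n m j : ℕ} (hj : d ℓ * j + r ≤ n)
    {γ : ℕ → A} (h1 : γ ∈ hit ω d ℓ n m) (h2 : γ ∈ hit ω d ℓ n (m + j)) : κ ∣ j := by
  rw [D.κ_dvd_iff]
  rw [mem_hit] at h1 h2
  intro u hu
  rw [D.dvd_iff]
  have hle : d u * j ≤ d ℓ * j := Nat.mul_le_mul_right j (D.le_last hu)
  have key : ∀ s < r, ω (s + d u * j) = ω s := by
    intro s hs
    rw [← h2 u hu s (by omega), ← h1 u hu (s + d u * j) (by omega)]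
    congr 1
    ring
  funext s
  rw [shift_iterate_apply, ← Nat.mod_add_div s r, add_right_comm,
    D.apply_add (dvd_mul_right r _), D.apply_add (dvd_mul_right r _),
    key _ (Nat.mod_lt s D.r_pos)]

/-! ### Clumps -/

/-- The event that `m` lies in a clump of hits reaching exactly `v` steps back and `u` steps
ahead. -/
def clump (ω : ℕ → A) (d : ℕ → ℕ) (ℓ κ n m v u : ℕ) : Set (ℕ → A) :=
  run ω d ℓ n (m - κ * v) (κ * (v + u)) \
    (run ω d ℓ n (m - κ * (v + 1)) (κ * (v + 1 + u)) ∪ run ω d ℓ n (m - κ * v) (κ * (v + (u + 1))))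

variable {n m h : ℕ}

theorem run_eq_inter (D : PeriodicData ω d ℓ r κ) (hn : 2 * d ℓ * h + r ≤ n) (hm : h ≤ m)
    {v u : ℕ} (hv : κ * v ≤ h) (hu : κ * u ≤ h) :
    run ω d ℓ n (m - κ * v) (κ * (v + u)) =
      hit ω d ℓ n (m - κ * v) ∩ hit ω d ℓ n (m + κ * u) := by
  rw [← D.hit_inter_hit (dvd_mul_right κ _)]
  · congr 2
    rw [mul_add]
    omega
  · calc d ℓ * (κ * (v + u)) = d ℓ * (κ * v + κ * u) := by rw [mul_add]
      _ ≤ d ℓ * (2 * h) := Nat.mul_le_mul_left _ (by omega)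
      _ ≤ n := by linarith

theorem run_subset_hit_add (D : PeriodicData ω d ℓ r κ) (hm : h ≤ m)
    {v u w : ℕ} (hv : κ * v ≤ h) (hw : w ≤ u) :
    run ω d ℓ n (m - κ * v) (κ * (v + u)) ⊆ hit ω d ℓ n (m + κ * w) := by
  have := D.run_subset_hit (n := n) (m := m - κ * v) (dvd_mul_right κ (v + w))
    (Nat.mul_le_mul_left κ (Nat.add_le_add_left hw v))
  have e : m - κ * v + κ * (v + w) = m + κ * w := by
    rw [mul_add]
    omega
  rwa [e] at this

theorem run_subset_hit_sub (D : PeriodicData ω d ℓ r κ) (hm : h ≤ m)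
    {v u w : ℕ} (hv : κ * v ≤ h) (hw : w ≤ v) :
    run ω d ℓ n (m - κ * v) (κ * (v + u)) ⊆ hit ω d ℓ n (m - κ * w) := by
  have := D.run_subset_hit (n := n) (m := m - κ * v) (dvd_mul_right κ (v - w))
    (Nat.mul_le_mul_left κ ((Nat.sub_le v w).trans (Nat.le_add_right v u)))
  have h1 : κ * w ≤ κ * v := Nat.mul_le_mul_left κ hw
  have e : m - κ * v + κ * (v - w) = m - κ * w := by
    rw [Nat.mul_sub]
    omega
  rwa [e] at this

/-- Clumps are defined through runs, whose probabilities are computable. Within the reach h a run is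
fixed by its end hits, so a clump means hits at both ends and none one step beyond. -/
theorem mem_clump_iff (D : PeriodicData ω d ℓ r κ) (hn : 2 * d ℓ * h + r ≤ n) (hm : h ≤ m)
    {v u : ℕ} (hv : κ * (v + 1) ≤ h) (hu : κ * (u + 1) ≤ h) {γ : ℕ → A} :
    γ ∈ clump ω d ℓ κ n m v u ↔ (γ ∈ hit ω d ℓ n (m - κ * v) ∧ γ ∈ hit ω d ℓ n (m + κ * u)) ∧
      γ ∉ hit ω d ℓ n (m - κ * (v + 1)) ∧ γ ∉ hit ω d ℓ n (m + κ * (u + 1)) := by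
  have hv' : κ * v ≤ h := (Nat.mul_le_mul_left κ (Nat.le_succ v)).trans hv
  have hu' : κ * u ≤ h := (Nat.mul_le_mul_left κ (Nat.le_succ u)).trans hu
  rw [clump, D.run_eq_inter hn hm hv' hu', D.run_eq_inter hn hm hv hu', D.run_eq_inter hn hm hv' hu]
  simp only [Set.mem_sdiff, Set.mem_inter_iff, Set.mem_union]
  tauto

theorem run_inter_run (D : PeriodicData ω d ℓ r κ) (hn : 2 * d ℓ * h + r ≤ n) (hm : h ≤ m)
    {v u : ℕ} (hv : κ * (v + 1) ≤ h) (hu : κ * (u + 1) ≤ h) :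
    run ω d ℓ n (m - κ * (v + 1)) (κ * (v + 1 + u)) ∩ run ω d ℓ n (m - κ * v) (κ * (v + (u + 1))) =
      run ω d ℓ n (m - κ * (v + 1)) (κ * (v + 1 + (u + 1))) := by
  have hv' : κ * v ≤ h := (Nat.mul_le_mul_left κ (Nat.le_succ v)).trans hv
  have hu' : κ * u ≤ h := (Nat.mul_le_mul_left κ (Nat.le_succ u)).trans hu
  refine Set.Subset.antisymm ?_ fun γ hγ => ?_
  · rw [D.run_eq_inter hn hm hv hu', D.run_eq_inter hn hm hv' hu, D.run_eq_inter hn hm hv hu]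
    rintro γ ⟨⟨h1, _⟩, _, h2⟩
    exact ⟨h1, h2⟩
  · have h1 := D.run_subset_hit_sub hm hv (Nat.le_succ v) hγ
    have h2 := D.run_subset_hit_add hm hv (Nat.le_succ u) hγ
    rw [D.run_eq_inter hn hm hv hu] at hγ
    rw [D.run_eq_inter hn hm hv hu', D.run_eq_inter hn hm hv' hu]
    exact ⟨⟨hγ.1, h2⟩, h1, hγ.2⟩

theorem clump_subset_hit (D : PeriodicData ω d ℓ r κ) (hm : h ≤ m)
    {v u : ℕ} (hv : κ * v ≤ h) : clump ω d ℓ κ n m v u ⊆ hit ω d ℓ n m := by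
  have := (D.run_subset_hit_add (n := n) hm hv (Nat.zero_le u))
  rw [mul_zero, add_zero] at this
  exact Set.sdiff_subset.trans this

theorem clump_unique (D : PeriodicData ω d ℓ r κ) (hn : 2 * d ℓ * h + r ≤ n) (hm : h ≤ m)
    {v u v' u' : ℕ} (hv : κ * (v + 1) ≤ h) (hu : κ * (u + 1) ≤ h) (hv' : κ * (v' + 1) ≤ h)
    (hu' : κ * (u' + 1) ≤ h) {γ : ℕ → A} (h1 : γ ∈ clump ω d ℓ κ n m v u)
    (h2 : γ ∈ clump ω d ℓ κ n m v' u') : v = v' ∧ u = u' := by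
  have aux : ∀ {v u v' u' : ℕ}, κ * (v + 1) ≤ h → κ * (u + 1) ≤ h → κ * (v' + 1) ≤ h →
      κ * (u' + 1) ≤ h → γ ∈ clump ω d ℓ κ n m v u → γ ∈ clump ω d ℓ κ n m v' u' →
      v' ≤ v ∧ u' ≤ u := by
    intro v u v' u' hv hu hv' hu' h1 h2
    have hv'' : κ * v' ≤ h := (Nat.mul_le_mul_left κ (Nat.le_succ v')).trans hv'
    rw [D.mem_clump_iff hn hm hv hu] at h1
    constructor
    · by_contra hlt
      exact h1.2.1 (D.run_subset_hit_sub hm hv'' (by omega) h2.1)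
    · by_contra hlt
      exact h1.2.2 (D.run_subset_hit_add hm hv'' (by omega) h2.1)
  have a1 := aux hv hu hv' hu' h1 h2
  have a2 := aux hv' hu' hv hu h2 h1
  omega

open Classical in
/-- The number of hits at the times in `T`. -/
def hitCount (ω : ℕ → A) (d : ℕ → ℕ) (ℓ n : ℕ) (T : Finset ℕ) (γ : ℕ → A) : ℕ :=
  (T.filter fun m => γ ∈ hit ω d ℓ n m).card

/-- A nearby hit sits at a multiple of κ from m and forces all hits between itself and m. One beyond
the ends of the clump would produce a hit at an excluded neighbour, so exactly the v + u + 1 points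
of the progression remain. -/
theorem hitCount_clump (D : PeriodicData ω d ℓ r κ) (hn : 2 * d ℓ * h + r ≤ n) (hm : h ≤ m)
    {v u : ℕ} (hv : κ * (v + 1) ≤ h) (hu : κ * (u + 1) ≤ h) {γ : ℕ → A}
    (hγ : γ ∈ clump ω d ℓ κ n m v u) : hitCount ω d ℓ n (Finset.Icc (m - h) (m + h)) γ =
      v + u + 1 := by
  classical
  have hv' : κ * v ≤ h := (Nat.mul_le_mul_left κ (Nat.le_succ v)).trans hv
  have hu' : κ * u ≤ h := (Nat.mul_le_mul_left κ (Nat.le_succ u)).trans hu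
  have hhit : γ ∈ hit ω d ℓ n m := D.clump_subset_hit hm hv' hγ
  have hle : ∀ j ≤ h, d ℓ * j + r ≤ n := fun j hj => by
    have := Nat.mul_le_mul_left (d ℓ) hj
    linarith [Nat.zero_le (d ℓ * h)]
  have hlen : ∀ j ≤ h, d ℓ * j ≤ n := fun j hj => by linarith [hle j hj]
  have hmem := (D.mem_clump_iff hn hm hv hu).mp hγ
  have e : (Finset.Icc (m - h) (m + h)).filter (fun m' => γ ∈ hit ω d ℓ n m') =
      (Finset.range (v + u + 1)).image fun j => m - κ * v + κ * j := by
    ext m'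
    simp only [Finset.mem_filter, Finset.mem_Icc, Finset.mem_image, Finset.mem_range]
    constructor
    · rintro ⟨⟨h1, h2⟩, h3⟩
      rcases le_total m m' with hmm | hmm
      · obtain ⟨j, rfl⟩ := Nat.exists_eq_add_of_le hmm
        have hj : j ≤ h := by omega
        obtain ⟨w, rfl⟩ := D.dvd_of_hit_of_hit (hle j hj) hhit h3
        have hwu : w ≤ u := by
          by_contra hlt
          have hr : γ ∈ run ω d ℓ n m (κ * w) := by
            rw [← D.hit_inter_hit (dvd_mul_right κ w) (hlen _ hj)]
            exact ⟨hhit, h3⟩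
          exact hmem.2.2 (D.run_subset_hit (dvd_mul_right κ (u + 1))
            (Nat.mul_le_mul_left κ (by omega)) hr)
        refine ⟨v + w, by omega, ?_⟩
        rw [mul_add]
        omega
      · obtain ⟨j, rfl⟩ := Nat.exists_eq_add_of_le hmm
        have hj : j ≤ h := by omega
        obtain ⟨w, rfl⟩ := D.dvd_of_hit_of_hit (hle j hj) h3 hhit
        have hwv : w ≤ v := by
          by_contra hlt
          have hr : γ ∈ run ω d ℓ n m' (κ * w) := by
            rw [← D.hit_inter_hit (dvd_mul_right κ w) (hlen _ hj)]
            exact ⟨h3, hhit⟩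
          have hvw : κ * (v + 1) ≤ κ * w := Nat.mul_le_mul_left κ (by omega)
          have := D.run_subset_hit (dvd_mul_right κ (w - (v + 1)))
            (Nat.mul_le_mul_left κ (by omega)) hr
          have e : m' + κ * (w - (v + 1)) = m' + κ * w - κ * (v + 1) := by
            rw [Nat.mul_sub]
            omega
          rw [e] at this
          exact hmem.2.1 this
        refine ⟨v - w, by omega, ?_⟩
        have : κ * w ≤ κ * v := Nat.mul_le_mul_left κ hwv
        rw [Nat.mul_sub]
        omega
    · rintro ⟨j, hj, rfl⟩
      have hj' : κ * j ≤ κ * v + κ * u := by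
        rw [← mul_add]
        exact Nat.mul_le_mul_left κ (by omega)
      exact ⟨⟨by omega, by omega⟩,
        D.run_subset_hit (dvd_mul_right κ j) (Nat.mul_le_mul_left κ (by omega)) hγ.1⟩
  rw [hitCount, e, Finset.card_image_of_injective, Finset.card_range]
  intro i j hij
  exact Nat.eq_of_mul_eq_mul_left D.κ_pos (Nat.add_left_cancel hij)

/-- Follow consecutive hits in steps of κ in both directions from m. Without a stop within k steps
there would be k + 1 hits within distance h. -/
theorem exists_clump (D : PeriodicData ω d ℓ r κ) (hn : 2 * d ℓ * h + r ≤ n) (hm : h ≤ m)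
    {k : ℕ} (hk : κ * (k + 1) ≤ h) {γ : ℕ → A} (hγ : γ ∈ hit ω d ℓ n m)
    (hcount : hitCount ω d ℓ n (Finset.Icc (m - h) (m + h)) γ ≤ k) :
    ∃ v u, v + u < k ∧ γ ∈ clump ω d ℓ κ n m v u := by
  classical
  have hle : ∀ w ≤ k + 1, κ * w ≤ h := fun w hw => (Nat.mul_le_mul_left κ hw).trans hk
  have hkc : ∀ f : ℕ → ℕ, Function.Injective f → (∀ w ≤ k, m ≤ f w + h) →
      (∀ w ≤ k, f w ≤ m + h) → ¬ ∀ w ≤ k, γ ∈ hit ω d ℓ n (f w) := by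
    intro f hf h1 h2 hall
    have : (Finset.range (k + 1)).image f ⊆
        (Finset.Icc (m - h) (m + h)).filter fun m' => γ ∈ hit ω d ℓ n m' := by
      intro x hx
      obtain ⟨w, hw, rfl⟩ := Finset.mem_image.mp hx
      have hw' : w ≤ k := Nat.lt_succ_iff.mp (Finset.mem_range.mp hw)
      have := h1 w hw'
      simp only [Finset.mem_filter, Finset.mem_Icc]
      exact ⟨⟨by omega, h2 w hw'⟩, hall w hw'⟩
    have hc := Finset.card_le_card this
    rw [Finset.card_image_of_injective _ hf, Finset.card_range] at hc
    rw [hitCount] at hcount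
    omega
  have hu : ∃ u, u ≤ k ∧ γ ∈ hit ω d ℓ n (m + κ * u) ∧ γ ∉ hit ω d ℓ n (m + κ * (u + 1)) := by
    by_contra hne
    push Not at hne
    refine hkc (fun w => m + κ * w) (fun i j hij =>
      Nat.eq_of_mul_eq_mul_left D.κ_pos (Nat.add_left_cancel hij)) (fun w _ => by omega)
      (fun w hw => by have := hle w (by omega); omega) fun w => ?_
    induction w with
    | zero => simpa using hγ
    | succ w ih => exact fun hw => hne w (by omega) (ih (by omega))
  have hv : ∃ v, v ≤ k ∧ γ ∈ hit ω d ℓ n (m - κ * v) ∧ γ ∉ hit ω d ℓ n (m - κ * (v + 1)) := by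
    by_contra hne
    push Not at hne
    have hall : ∀ w ≤ k, γ ∈ hit ω d ℓ n (m - κ * w) := by
      intro w
      induction w with
      | zero => simpa using hγ
      | succ w ih => exact fun hw => hne w (by omega) (ih (by omega))
    refine hkc (fun w => m - κ * k + κ * w) (fun i j hij =>
      Nat.eq_of_mul_eq_mul_left D.κ_pos (Nat.add_left_cancel hij))
      (fun w hw => by have := hle k (by omega); omega)
      (fun w hw => by have := hle w (by omega); have := hle k (by omega); omega) fun w hw => ?_
    have h1 : κ * w ≤ κ * k := Nat.mul_le_mul_left κ hw
    have h2 := hle k (by omega)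
    have e : m - κ * k + κ * w = m - κ * (k - w) := by
      rw [Nat.mul_sub]
      omega
    simp only [e]
    exact hall _ (Nat.sub_le k w)
  obtain ⟨u, huk, hu1, hu2⟩ := hu
  obtain ⟨v, hvk, hv1, hv2⟩ := hv
  have hcl := (D.mem_clump_iff hn hm (hle (v + 1) (by omega)) (hle (u + 1) (by omega))).mpr
    ⟨⟨hv1, hu1⟩, hv2, hu2⟩
  have := D.hitCount_clump hn hm (hle (v + 1) (by omega)) (hle (u + 1) (by omega)) hcl
  exact ⟨v, u, by omega, hcl⟩

end PeriodicData

end Overlaps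

/-! ### Splitting the number of hits -/

section Counting

variable {A : Type*} {ω : ℕ → A} {d : ℕ → ℕ} {ℓ r κ n m h N : ℕ}

/-- The times `m' ≤ N` whose windows all keep the distance `3 * n` from the windows of `m`. -/
def farTimes (d : ℕ → ℕ) (ℓ n N m : ℕ) : Finset ℕ :=
  (Finset.Icc 1 N).filter fun m' => ∀ i < ℓ + 1, ∀ j < ℓ + 1,
    d i * m' + 3 * n ≤ d j * m ∨ d j * m + 3 * n ≤ d i * m'

/-- The times `m' ≤ N` with a window close to a window of `m`. -/
def closeTimes (d : ℕ → ℕ) (ℓ n N m : ℕ) : Finset ℕ := Finset.Icc 1 N \ farTimes d ℓ n N m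

theorem disjoint_closeTimes_farTimes :
    Disjoint (closeTimes d ℓ n N m) (farTimes d ℓ n N m) := Finset.sdiff_disjoint

/-- For each of the (ℓ+1)² pairs (i, j), the injective map m' ↦ d_i m' sends the times close through
that pair into an interval of length at most 6n. -/
theorem card_closeTimes_le (hd : StrictMono d) (hd0 : 1 ≤ d 0) :
    (closeTimes d ℓ n N m).card ≤ (ℓ + 1) ^ 2 * (6 * n) := by
  set R := Finset.range (ℓ + 1) ×ˢ Finset.range (ℓ + 1)
  have hsub : closeTimes d ℓ n N m ⊆ R.biUnion fun x =>
      (Finset.Icc 1 N).filter fun m' =>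
        d x.2 * m < d x.1 * m' + 3 * n ∧ d x.1 * m' < d x.2 * m + 3 * n := by
    intro m' hm'
    simp only [closeTimes, farTimes, Finset.mem_sdiff, Finset.mem_filter, not_and, not_forall,
      not_or, not_le] at hm'
    obtain ⟨i, hi, j, hj, h1, h2⟩ := hm'.2 hm'.1
    exact Finset.mem_biUnion.mpr ⟨(i, j), Finset.mem_product.mpr
      ⟨Finset.mem_range.mpr hi, Finset.mem_range.mpr hj⟩, Finset.mem_filter.mpr ⟨hm'.1, h1, h2⟩⟩
  refine (Finset.card_le_card hsub).trans (Finset.card_biUnion_le.trans ?_)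
  have hcard : R.card = (ℓ + 1) ^ 2 := by simp [R, sq]
  rw [← hcard]
  refine (Finset.sum_le_card_nsmul R _ (6 * n) fun x _ => ?_).trans_eq (smul_eq_mul _ _)
  have hle : ∀ m', m' ≤ d x.1 * m' := fun m' => le_mul_of_strictMono hd hd0 x.1 m'
  have hinj : Function.Injective fun m' => d x.1 * m' := fun a b hab =>
    Nat.eq_of_mul_eq_mul_left (hd0.trans (hd.monotone (Nat.zero_le _))) hab
  calc _ ≤ (Finset.Ico (d x.2 * m - 3 * n) (d x.2 * m + 3 * n)).card := by
        refine Finset.card_le_card_of_injOn (fun m' => d x.1 * m') ?_ hinj.injOn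
        intro m' hm'
        simp only [Finset.coe_filter, Set.mem_ofPred_eq] at hm'
        simp only [Finset.coe_Ico, Set.mem_Ico]
        omega
    _ ≤ 6 * n := by
        rw [Nat.card_Ico]
        omega

theorem near_subset_closeTimes (D : PeriodicData ω d ℓ r κ) (hn : 2 * d ℓ * h + r ≤ n)
    (hm : h < m) (hN : m + h ≤ N) : Finset.Icc (m - h) (m + h) ⊆ closeTimes d ℓ n N m := by
  intro m' hm'
  rw [Finset.mem_Icc] at hm'
  simp only [closeTimes, farTimes, Finset.mem_sdiff, Finset.mem_filter, Finset.mem_Icc, not_and,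
    not_forall, not_or, not_le]
  -- The windows at the largest multiple are already close: they differ by at most d_ℓ h < n.
  refine ⟨by omega, fun _ => ⟨ℓ, by omega, ℓ, by omega, ?_⟩⟩
  have h1 : d ℓ * m' ≤ d ℓ * m + d ℓ * h := by
    rw [← mul_add]
    exact Nat.mul_le_mul_left _ hm'.2
  have h2 : d ℓ * m ≤ d ℓ * m' + d ℓ * h := by
    rw [← mul_add]
    exact Nat.mul_le_mul_left _ (by omega)
  have h3 := D.r_pos
  have h4 : 2 * d ℓ * h = 2 * (d ℓ * h) := by ring
  omega

namespace PeriodicData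

theorem hitCount_union {S T : Finset ℕ} (h : Disjoint S T) (γ : ℕ → A) :
    hitCount ω d ℓ n (S ∪ T) γ = hitCount ω d ℓ n S γ + hitCount ω d ℓ n T γ := by
  classical
  rw [hitCount, Finset.filter_union,
    Finset.card_union_of_disjoint (Finset.disjoint_filter_filter h)]
  rfl

theorem hitCount_eq_zero {S : Finset ℕ} {γ : ℕ → A} (h : ∀ m ∈ S, γ ∉ hit ω d ℓ n m) :
    hitCount ω d ℓ n S γ = 0 := by
  classical
  rw [hitCount, Finset.card_eq_zero, Finset.filter_eq_empty_iff]
  exact fun m hm => h m hm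

theorem hitCount_eq_sum_indicator (ω : ℕ → A) (d : ℕ → ℕ) (ℓ n : ℕ) (T : Finset ℕ) (γ : ℕ → A) :
    hitCount ω d ℓ n T γ = ∑ m ∈ T, (hit ω d ℓ n m).indicator (fun _ => 1) γ := by
  classical
  rw [hitCount, Finset.card_filter]
  exact Finset.sum_congr rfl fun m _ => by simp [Set.indicator_apply]

/-- The event of a hit at `m` and of another hit at a close time that is not very near to `m`. -/
def badEvent (ω : ℕ → A) (d : ℕ → ℕ) (ℓ n h N m : ℕ) : Set (ℕ → A) :=
  ⋃ m' ∈ closeTimes d ℓ n N m \ Finset.Icc (m - h) (m + h), hit ω d ℓ n m ∩ hit ω d ℓ n m'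

theorem hitCount_eq_add (D : PeriodicData ω d ℓ r κ) (hn : 2 * d ℓ * h + r ≤ n)
    (hm : h < m) (hN : m + h ≤ N) {γ : ℕ → A} (hγ : γ ∈ hit ω d ℓ n m)
    (hb : γ ∉ badEvent ω d ℓ n h N m) : hitCount ω d ℓ n (Finset.Icc 1 N) γ =
      hitCount ω d ℓ n (Finset.Icc (m - h) (m + h)) γ + hitCount ω d ℓ n (farTimes d ℓ n N m) γ := by
  have h1 : Finset.Icc 1 N = closeTimes d ℓ n N m ∪ farTimes d ℓ n N m :=
    (Finset.sdiff_union_of_subset (Finset.filter_subset _ _)).symm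
  have h2 := Finset.union_sdiff_of_subset (near_subset_closeTimes D hn hm hN)
  rw [h1, hitCount_union disjoint_closeTimes_farTimes, ← h2, hitCount_union Finset.disjoint_sdiff]
  rw [hitCount_eq_zero (S := closeTimes d ℓ n N m \ Finset.Icc (m - h) (m + h)), add_zero]
  intro m' hm' hhit
  exact hb (Set.mem_biUnion (x := m') (Finset.mem_coe.mpr hm') ⟨hγ, hhit⟩)

theorem dependsOnCoords_hitCount (T : Finset ℕ) (k : ℕ) :
    DependsOnCoords {γ | hitCount ω d ℓ n T γ = k}
      {s | ∃ m ∈ T, ∃ i < ℓ + 1, d i * m ≤ s ∧ s < d i * m + n} := by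
  classical
  intro γ γ' hγγ' hγ
  rw [Set.mem_ofPred_eq] at hγ ⊢
  rw [← hγ, hitCount, hitCount]
  congr 1
  refine Finset.filter_congr fun m hm => ?_
  rw [mem_hit, mem_hit]
  refine forall₂_congr fun i hi => forall₂_congr fun s hs => ?_
  rw [hγγ' (d i * m + s) ⟨m, hm, i, hi, by omega, by omega⟩]

theorem finite_windows_of_finset (d : ℕ → ℕ) (ℓ n : ℕ) (T : Finset ℕ) :
    {s | ∃ m ∈ T, ∃ i < ℓ + 1, d i * m ≤ s ∧ s < d i * m + n}.Finite := by
  refine ((T ×ˢ Finset.range (ℓ + 1)).biUnion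
    fun x => Finset.Ico (d x.2 * x.1) (d x.2 * x.1 + n)).finite_toSet.subset ?_
  rintro s ⟨m, hm, i, hi, h1, h2⟩
  simp only [Finset.coe_biUnion, Set.mem_iUnion, Finset.mem_coe, Finset.mem_Ico, exists_prop]
  exact ⟨(m, i), by simp [hm, hi], h1, h2⟩

/-- The pairs `(v, u)` with `v + u < k`. -/
def simplexPairs (k : ℕ) : Finset (ℕ × ℕ) :=
  (Finset.range k).biUnion fun i => Finset.HasAntidiagonal.antidiagonal i

theorem mem_simplexPairs {k : ℕ} {x : ℕ × ℕ} : x ∈ simplexPairs k ↔ x.1 + x.2 < k := by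
  simp [simplexPairs, Finset.HasAntidiagonal.mem_antidiagonal]

/-- The i + 1 positions of m inside a clump of i + 1 hits account for the factor in the Panjer
recursion. -/
theorem sum_simplexPairs (k : ℕ) (f : ℕ → ℝ) :
    ∑ x ∈ simplexPairs k, f (x.1 + x.2) = ∑ i ∈ Finset.range k, ((i : ℝ) + 1) * f i := by
  rw [simplexPairs, Finset.sum_biUnion]
  · refine Finset.sum_congr rfl fun i _ => ?_
    rw [Finset.sum_congr rfl fun x hx => by rw [Finset.HasAntidiagonal.mem_antidiagonal.mp hx], Finset.sum_const,
      Finset.Nat.card_antidiagonal, nsmul_eq_mul]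
    push_cast
    rfl
  · intro i _ j _ hij
    refine Finset.disjoint_left.mpr fun x hx hx' => hij ?_
    rw [← Finset.HasAntidiagonal.mem_antidiagonal.mp hx, ← Finset.HasAntidiagonal.mem_antidiagonal.mp hx']

/-- Off the bad event every hit is either near m or far from it. The near ones form a clump of v + u
+ 1 hits, so the far ones must supply the remaining k - 1 - (v + u). -/
theorem hit_inter_sdiff_badEvent (D : PeriodicData ω d ℓ r κ) (hn : 2 * d ℓ * h + r ≤ n)
    (hm : h < m) (hN : m + h ≤ N) {k : ℕ} (hk : κ * (k + 1) ≤ h) :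
    (hit ω d ℓ n m ∩ {γ | hitCount ω d ℓ n (Finset.Icc 1 N) γ = k}) \ badEvent ω d ℓ n h N m =
      (⋃ x ∈ simplexPairs k, clump ω d ℓ κ n m x.1 x.2 ∩
        {γ | hitCount ω d ℓ n (farTimes d ℓ n N m) γ = k - 1 - (x.1 + x.2)}) \
          badEvent ω d ℓ n h N m := by
  have hle : ∀ w ≤ k + 1, κ * w ≤ h := fun w hw => (Nat.mul_le_mul_left κ hw).trans hk
  ext γ
  simp only [Set.mem_sdiff, Set.mem_inter_iff, Set.mem_ofPred_eq, Set.mem_iUnion, exists_prop,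
    mem_simplexPairs, Prod.exists]
  refine and_congr_left fun hb => ⟨?_, ?_⟩
  · rintro ⟨hhit, hS⟩
    have hadd := D.hitCount_eq_add hn hm hN hhit hb
    obtain ⟨v, u, hvu, hcl⟩ := D.exists_clump hn hm.le hk hhit (by omega)
    have := D.hitCount_clump hn hm.le (hle (v + 1) (by omega)) (hle (u + 1) (by omega)) hcl
    exact ⟨v, u, hvu, hcl, by omega⟩
  · rintro ⟨v, u, hvu, hcl, hW⟩
    have hhit := D.clump_subset_hit hm.le (hle v (by omega)) hcl
    have hadd := D.hitCount_eq_add hn hm hN hhit hb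
    have := D.hitCount_clump hn hm.le (hle (v + 1) (by omega)) (hle (u + 1) (by omega)) hcl
    exact ⟨hhit, by omega⟩

/-! ### Probabilities of hits -/

variable [MeasurableSpace A] [MeasurableSingletonClass A] {P : Measure (ℕ → A)}
  [IsProbabilityMeasure P]

theorem measurableSet_wordsAt (ω : ℕ → A) (ℓ : ℕ) (a L : ℕ → ℕ) :
    MeasurableSet (wordsAt ω ℓ a L) := by
  have e : wordsAt ω ℓ a L = ⋂ i < ℓ, ⋂ s < L i, {γ | γ (a i + s) = ω s} := by
    ext γ
    simp [wordsAt]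
  rw [e]
  exact MeasurableSet.iInter fun i => MeasurableSet.iInter fun _ => MeasurableSet.iInter fun s =>
    MeasurableSet.iInter fun _ => (measurable_pi_apply (a i + s) : Measurable fun γ : ℕ → A => _)
      (measurableSet_singleton (ω s))

theorem measurableSet_hit (ω : ℕ → A) (d : ℕ → ℕ) (ℓ n m : ℕ) : MeasurableSet (hit ω d ℓ n m) :=
  measurableSet_wordsAt _ _ _ _

theorem measurableSet_run (ω : ℕ → A) (d : ℕ → ℕ) (ℓ n m j : ℕ) :
    MeasurableSet (run ω d ℓ n m j) :=
  measurableSet_wordsAt _ _ _ _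

theorem measurableSet_clump (ω : ℕ → A) (d : ℕ → ℕ) (ℓ κ n m v u : ℕ) :
    MeasurableSet (clump ω d ℓ κ n m v u) :=
  (measurableSet_run _ _ _ _ _ _).diff
    ((measurableSet_run _ _ _ _ _ _).union (measurableSet_run _ _ _ _ _ _))

theorem measurable_hitCount (ω : ℕ → A) (d : ℕ → ℕ) (ℓ n : ℕ) (T : Finset ℕ) :
    Measurable (hitCount ω d ℓ n T) := by
  have e : hitCount ω d ℓ n T = fun γ => ∑ m ∈ T, (hit ω d ℓ n m).indicator (fun _ => 1) γ :=
    funext fun γ => hitCount_eq_sum_indicator ω d ℓ n T γ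
  rw [e]
  exact Finset.measurable_sum T fun m _ =>
    measurable_const.indicator (measurableSet_hit ω d ℓ n m)

theorem measurableSet_hitCount_eq (ω : ℕ → A) (d : ℕ → ℕ) (ℓ n : ℕ) (T : Finset ℕ) (k : ℕ) :
    MeasurableSet {γ | hitCount ω d ℓ n T γ = k} :=
  measurable_hitCount ω d ℓ n T (measurableSet_singleton k)

theorem abs_real_sub_le_of_sdiff_eq {X : Type*} [MeasurableSpace X] {μ : Measure X}
    [IsFiniteMeasure μ] {U V B : Set X} (h : U \ B = V \ B) : |μ.real U - μ.real V| ≤ μ.real B := by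
  have aux : ∀ U V : Set X, U \ B = V \ B → μ.real U ≤ μ.real V + μ.real B := by
    intro U V h
    calc μ.real U ≤ μ.real (V ∪ B) := measureReal_mono fun x hx => by
          by_cases hB : x ∈ B
          · exact Or.inr hB
          · have : x ∈ V \ B := h ▸ ⟨hx, hB⟩
            exact Or.inl this.1
      _ ≤ _ := measureReal_union_le V B
  rw [abs_le]
  constructor
  · linarith [aux V U h.symm]
  · linarith [aux U V h]

theorem abs_real_hit_inter_sub_le (D : PeriodicData ω d ℓ r κ) (hn : 2 * d ℓ * h + r ≤ n)
    (hm : h < m) (hN : m + h ≤ N) {k : ℕ} (hk : κ * (k + 1) ≤ h) :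
    |P.real (hit ω d ℓ n m ∩ {γ | hitCount ω d ℓ n (Finset.Icc 1 N) γ = k}) -
      ∑ x ∈ simplexPairs k, P.real (clump ω d ℓ κ n m x.1 x.2 ∩
        {γ | hitCount ω d ℓ n (farTimes d ℓ n N m) γ = k - 1 - (x.1 + x.2)})| ≤
      P.real (badEvent ω d ℓ n h N m) := by
  have hle : ∀ w ≤ k + 1, κ * w ≤ h := fun w hw => (Nat.mul_le_mul_left κ hw).trans hk
  rw [← measureReal_biUnion_finset]
  · exact abs_real_sub_le_of_sdiff_eq (D.hit_inter_sdiff_badEvent hn hm hN hk)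
  · intro x hx y hy hxy
    rw [Finset.mem_coe, mem_simplexPairs] at hx hy
    refine Set.disjoint_left.mpr fun γ h1 h2 => hxy ?_
    have := D.clump_unique hn hm.le (hle _ (by omega)) (hle _ (by omega)) (hle _ (by omega))
      (hle _ (by omega)) h1.1 h2.1
    exact Prod.ext this.1 this.2
  · exact fun x _ => (measurableSet_clump _ _ _ _ _ _ _ _).inter
      (measurableSet_hitCount_eq _ _ _ _ _ _)

theorem real_hit_le (hinv : MeasurePreserving shift P P) (ω : ℕ → A) (d : ℕ → ℕ) (ℓ n m : ℕ) :
    P.real (hit ω d ℓ n m) ≤ P.real (cylinder ω n) := by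
  rw [← real_preimage_shift hinv (d 0 * m) (E := cylinder ω n) (measurableSet_atom ω _)]
  refine measureReal_mono fun γ hγ s hs => ?_
  rw [shift_iterate_apply, add_comm]
  exact hγ 0 (Nat.succ_pos ℓ) s hs

/-- A second hit more than h away, however its windows interleave with those of m, contains h
letters outside the range of the first: an earlier one has its first h letters at d_0 m' before all
windows of m, a later one its last h letters at d_ℓ m' after all of them. These letters cost the
factor b. -/
theorem real_hit_inter_hit_le (D : PeriodicData ω d ℓ r κ) (hinv : MeasurePreserving shift P P)
    {ε : ℝ} (hmix : MixesAt P 0 ε) (hε : 0 ≤ ε) {b : ℝ}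
    (hb : ∀ y : ℕ → A, P.real (cylinder y h) ≤ b) (hhn : h ≤ n) (hm : n ≤ m) {m' : ℕ}
    (hm' : m' ∉ Finset.Icc (m - h) (m + h)) :
    P.real (hit ω d ℓ n m ∩ hit ω d ℓ n m') ≤
      (1 + ε) ^ (2 * (ℓ + 1)) * (b * P.real (cylinder ω n) ^ (ℓ + 1)) := by
  rw [Finset.mem_Icc, not_and_or, not_le, not_le] at hm'
  rcases hm' with hlt | hlt
  · have hle : d 0 * (m' + h) ≤ d 0 * m := Nat.mul_le_mul_left _ (by omega)
    have h1 := le_mul_of_strictMono D.strictMono D.one_le 0 h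
    rw [mul_add] at hle
    refine le_trans (measureReal_mono ?_) ((real_wordsAt_inter_before_le (ℓ := ℓ + 1) hinv
      D.strictMono hm hmix hε ω ω (b := d 0 * m') (h := h) (by omega)).trans ?_)
    · exact Set.inter_subset_inter_right _ fun γ hγ s hs => hγ 0 (Nat.succ_pos ℓ) s (hs.trans_le hhn)
    · gcongr
      exact hb ω
  · have hle : d ℓ * (m + h) ≤ d ℓ * m' := Nat.mul_le_mul_left _ (by omega)
    have h1 := le_mul_of_strictMono D.strictMono D.one_le ℓ h
    rw [mul_add] at hle
    refine le_trans (measureReal_mono ?_) ((real_wordsAt_inter_after_le (ℓ := ℓ) hinv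
      D.strictMono hm hmix hε ω (shift^[n - h] ω) (b := d ℓ * m' + (n - h)) (h := h)
      (by omega)).trans ?_)
    · refine Set.inter_subset_inter_right _ fun γ hγ s hs => ?_
      rw [shift_iterate_apply, ← mem_hit.mp hγ ℓ (Nat.lt_succ_self ℓ) (s + (n - h)) (by omega)]
      congr 1
      ring
    · gcongr
      exact hb _

theorem real_badEvent_le (D : PeriodicData ω d ℓ r κ) (hinv : MeasurePreserving shift P P)
    {ε : ℝ} (hmix : MixesAt P 0 ε) (hε : 0 ≤ ε) {b : ℝ}
    (hb : ∀ y : ℕ → A, P.real (cylinder y h) ≤ b) (hhn : h ≤ n) (hm : n ≤ m) :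
    P.real (badEvent ω d ℓ n h N m) ≤ (((ℓ + 1) ^ 2 * (6 * n) : ℕ) : ℝ) *
      ((1 + ε) ^ (2 * (ℓ + 1)) * (b * P.real (cylinder ω n) ^ (ℓ + 1))) := by
  have hb0 : 0 ≤ b := measureReal_nonneg.trans (hb ω)
  refine (measureReal_biUnion_finset_le _ _).trans ((Finset.sum_le_card_nsmul _ _ _ fun m' hm' =>
    D.real_hit_inter_hit_le hinv hmix hε hb hhn hm (Finset.mem_sdiff.mp hm').2).trans ?_)
  rw [nsmul_eq_mul]
  gcongr
  exact (Finset.card_le_card Finset.sdiff_subset).trans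
    (card_closeTimes_le D.strictMono D.one_le)

/-- The two counts differ only if a close time is a hit, and there are O(n) close times. This
removes the dependence of the far count on m. -/
theorem abs_real_farCount_sub_le (D : PeriodicData ω d ℓ r κ) (hinv : MeasurePreserving shift P P)
    (k : ℕ) : |P.real {γ | hitCount ω d ℓ n (farTimes d ℓ n N m) γ = k} -
      P.real {γ | hitCount ω d ℓ n (Finset.Icc 1 N) γ = k}| ≤
      (((ℓ + 1) ^ 2 * (6 * n) : ℕ) : ℝ) * P.real (cylinder ω n) := by
  have h1 : Finset.Icc 1 N = closeTimes d ℓ n N m ∪ farTimes d ℓ n N m :=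
    (Finset.sdiff_union_of_subset (Finset.filter_subset _ _)).symm
  refine (abs_real_sub_le_of_sdiff_eq (B := ⋃ m' ∈ closeTimes d ℓ n N m, hit ω d ℓ n m') ?_).trans
    ((measureReal_biUnion_finset_le _ _).trans ((Finset.sum_le_card_nsmul _ _ _ fun m' _ =>
      real_hit_le hinv ω d ℓ n m').trans ?_))
  · ext γ
    simp only [Set.mem_sdiff, Set.mem_ofPred_eq, Set.mem_iUnion, not_exists]
    refine and_congr_left fun hb => ?_
    rw [h1, hitCount_union disjoint_closeTimes_farTimes, hitCount_eq_zero (S := closeTimes d ℓ n N m) hb,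
      zero_add]
  · rw [nsmul_eq_mul]
    gcongr
    exact card_closeTimes_le D.strictMono D.one_le

theorem sum_real_hit_inter (ω : ℕ → A) (d : ℕ → ℕ) (ℓ n : ℕ) (T : Finset ℕ) (E : Set (ℕ → A)) :
    ∑ m ∈ T, P.real (hit ω d ℓ n m ∩ E) = ∫ γ in E, (hitCount ω d ℓ n T γ : ℝ) ∂P := by
  have e : ∀ γ, (hitCount ω d ℓ n T γ : ℝ) =
      ∑ m ∈ T, (hit ω d ℓ n m).indicator (fun _ => (1 : ℝ)) γ := by
    intro γ
    rw [hitCount_eq_sum_indicator, Nat.cast_sum]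
    refine Finset.sum_congr rfl fun m _ => ?_
    by_cases hγ : γ ∈ hit ω d ℓ n m <;> simp [hγ]
  simp_rw [e]
  rw [integral_finsetSum _ fun m _ =>
    (integrable_const (1 : ℝ)).indicator (measurableSet_hit ω d ℓ n m)]
  refine Finset.sum_congr rfl fun m _ => ?_
  rw [integral_indicator_const _ (measurableSet_hit ω d ℓ n m),
    measureReal_restrict_apply (measurableSet_hit ω d ℓ n m), smul_eq_mul, mul_one]

/-- Double counting, or size biasing: on the event that the count is k, its integral is k times the
probability. This is the source of the recursion. -/
theorem sum_real_hit_inter_eq (ω : ℕ → A) (d : ℕ → ℕ) (ℓ n : ℕ) (T : Finset ℕ) (k : ℕ) :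
    ∑ m ∈ T, P.real (hit ω d ℓ n m ∩ {γ | hitCount ω d ℓ n T γ = k}) =
      k * P.real {γ | hitCount ω d ℓ n T γ = k} := by
  rw [sum_real_hit_inter,
    setIntegral_congr_fun (g := fun _ => (k : ℝ)) (measurableSet_hitCount_eq ω d ℓ n T k)
      fun γ hγ => by
        have : hitCount ω d ℓ n T γ = k := hγ
        simp only [this]]
  rw [setIntegral_const, smul_eq_mul, mul_comm]

/-- Markov's inequality for the count, whose mean is the sum on the right; it supplies the tightness
of the laws. -/
theorem mul_one_sub_sum_le (ω : ℕ → A) (d : ℕ → ℕ) (ℓ n : ℕ) (T : Finset ℕ) (K : ℕ) :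
    (K : ℝ) * (1 - ∑ k ∈ Finset.range K, P.real {γ | hitCount ω d ℓ n T γ = k}) ≤
      ∑ m ∈ T, P.real (hit ω d ℓ n m) := by
  have h1 : ∑ k ∈ Finset.range K, P.real {γ | hitCount ω d ℓ n T γ = k} =
      P.real {γ | hitCount ω d ℓ n T γ < K} := by
    rw [← measureReal_biUnion_finset]
    · congr 1
      ext γ
      simp
    · intro i _ j _ hij
      refine Set.disjoint_left.mpr fun γ h1 h2 => hij ?_
      rw [Set.mem_ofPred_eq] at h1 h2
      rw [← h1, ← h2]
    · exact fun k _ => measurableSet_hitCount_eq ω d ℓ n T k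
  have hm : MeasurableSet {γ | hitCount ω d ℓ n T γ < K} :=
    measurable_hitCount ω d ℓ n T (measurableSet_Iio (a := K))
  have h2 := sum_real_hit_inter (P := P) ω d ℓ n T Set.univ
  simp only [Set.inter_univ, Measure.restrict_univ] at h2
  rw [h1, ← probReal_compl_eq_one_sub hm, h2]
  have hi : Integrable (fun γ => (hitCount ω d ℓ n T γ : ℝ)) P := by
    refine Integrable.of_bound (C := (T.card : ℝ))
      (measurable_from_top.comp (measurable_hitCount ω d ℓ n T)).aestronglyMeasurable
      (ae_of_all _ fun γ => ?_)
    rw [Real.norm_natCast]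
    have : hitCount ω d ℓ n T γ ≤ T.card := by
      classical
      exact Finset.card_filter_le _ _
    exact_mod_cast this
  refine le_trans ?_ (mul_meas_ge_le_integral_of_nonneg (ae_of_all _ fun γ => Nat.cast_nonneg _)
    hi (K : ℝ))
  exact mul_le_mul_of_nonneg_left (measureReal_mono fun γ hγ => by simpa using hγ)
    (Nat.cast_nonneg K)

end PeriodicData

end Counting

/-! ### The compound Poisson limit theorem -/

section Limit

variable {A : Type*} [MeasurableSpace A]

theorem tendsto_ratio_pow {b : ℕ → ℝ} (hb : ∀ n, 0 < b n) {r : ℕ} {c : ℝ}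
    (h : Tendsto (fun n => b (n + r) / b n) atTop (𝓝 c)) (q : ℕ) :
    Tendsto (fun n => b (n + r * q) / b n) atTop (𝓝 (c ^ q)) := by
  induction q with
  | zero =>
    refine tendsto_const_nhds.congr fun n => ?_
    rw [mul_zero, add_zero, div_self (hb n).ne', pow_zero]
  | succ q ih =>
    have h1 := ih.mul (h.comp (tendsto_add_atTop_nat (r * q)))
    rw [← pow_succ] at h1
    refine h1.congr fun n => ?_
    have := (hb (n + r * q)).ne'
    have := (hb n).ne'
    simp only [Function.comp_apply]
    rw [mul_add, mul_one, ← add_assoc]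
    field_simp

/-- A `ψ`-mixing shift-invariant measure with uniformly exponentially small cylinders and a
periodic sequence `ω` along which the measures of the cylinders have the asymptotic ratio `lam`. -/
structure LimitData (P : Measure (ℕ → A)) (ω : ℕ → A) (d : ℕ → ℕ) (ℓ r κ : ℕ) (C θ lam : ℝ) : Prop
    extends PeriodicData ω d ℓ r κ where
  invariant : MeasurePreserving shift P P
  psiMixing : IsPsiMixing P
  pos : ∀ n, 0 < P.real (cylinder ω n)
  le_geom : ∀ y n, P.real (cylinder y n) ≤ C * θ ^ n
  base_nonneg : 0 ≤ θ
  base_lt : θ < 1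
  ratio : Tendsto (fun n => P.real (cylinder ω (n + r)) / P.real (cylinder ω n)) atTop (𝓝 lam)

/-- The asymptotic probability that a hit is followed by a hit after `κ` steps. -/
def overlapFactor (d : ℕ → ℕ) (ℓ r κ : ℕ) (lam : ℝ) : ℝ :=
  ∏ i ∈ Finset.range (ℓ + 1), lam ^ (d i * κ / r)

namespace LimitData

/-! ### Asymptotics of cylinders and of the range of overlaps. -/

variable {P : Measure (ℕ → A)} {ω : ℕ → A} {d : ℕ → ℕ} {ℓ r κ : ℕ} {C θ lam : ℝ}

theorem exists_mixesAt (D : LimitData P ω d ℓ r κ C θ lam) :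
    ∃ ψ : ℕ → ℝ, (∀ g, 0 ≤ ψ g) ∧ Tendsto ψ atTop (𝓝 0) ∧ ∀ g, MixesAt P g (ψ g) := by
  obtain ⟨ψ, h0, h1, h2⟩ := D.psiMixing
  exact ⟨ψ, h0, h1, fun g n E F hE hF => h2 g n E F hE hF⟩

theorem tendsto_ratio_mul (D : LimitData P ω d ℓ r κ C θ lam) (q : ℕ) :
    Tendsto (fun n => P.real (cylinder ω (n + r * q)) / P.real (cylinder ω n)) atTop
      (𝓝 (lam ^ q)) :=
  tendsto_ratio_pow D.pos D.ratio q

/-- Since r divides d_i κ, the i-th word is prolonged by a whole number of periods, each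
contributing a factor `lam` in the limit. -/
theorem tendsto_prod_ratio (D : LimitData P ω d ℓ r κ C θ lam) (j : ℕ) :
    Tendsto (fun n => (∏ i ∈ Finset.range (ℓ + 1), P.real (cylinder ω (n + d i * (κ * j)))) /
      P.real (cylinder ω n) ^ (ℓ + 1)) atTop (𝓝 (overlapFactor d ℓ r κ lam ^ j)) := by
  have h : Tendsto (fun n => ∏ i ∈ Finset.range (ℓ + 1),
      P.real (cylinder ω (n + r * (d i * κ / r * j))) / P.real (cylinder ω n)) atTop
      (𝓝 (∏ i ∈ Finset.range (ℓ + 1), lam ^ (d i * κ / r * j))) :=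
    tendsto_finsetProd _ fun i _ => D.tendsto_ratio_mul _
  have e : ∏ i ∈ Finset.range (ℓ + 1), lam ^ (d i * κ / r * j) =
      overlapFactor d ℓ r κ lam ^ j := by
    rw [overlapFactor, ← Finset.prod_pow]
    exact Finset.prod_congr rfl fun i _ => pow_mul _ _ _
  rw [e] at h
  refine h.congr fun n => ?_
  rw [Finset.prod_div_distrib, Finset.prod_const, Finset.card_range]
  congr 1
  refine Finset.prod_congr rfl fun i hi => ?_
  have := (D.κ_dvd_iff κ).mp dvd_rfl i (Finset.mem_range.mp hi)
  rw [← mul_assoc, Nat.mul_div_cancel' this, mul_assoc]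

theorem tendsto_mul_cylinder (D : LimitData P ω d ℓ r κ C θ lam) :
    Tendsto (fun n : ℕ => (n : ℝ) * P.real (cylinder ω n)) atTop (𝓝 0) := by
  have h := (tendsto_self_mul_const_pow_of_lt_one D.base_nonneg D.base_lt).const_mul C
  rw [mul_zero] at h
  refine squeeze_zero (fun n => mul_nonneg n.cast_nonneg measureReal_nonneg) (fun n => ?_) h
  calc _ ≤ (n : ℝ) * (C * θ ^ n) := mul_le_mul_of_nonneg_left (D.le_geom ω n) n.cast_nonneg
    _ = _ := by ring

theorem tendsto_cylinder (D : LimitData P ω d ℓ r κ C θ lam) :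
    Tendsto (fun n : ℕ => P.real (cylinder ω n)) atTop (𝓝 0) := by
  have h := (tendsto_pow_atTop_nhds_zero_of_lt_one D.base_nonneg D.base_lt).const_mul C
  rw [mul_zero] at h
  exact squeeze_zero (fun n => measureReal_nonneg) (fun n => D.le_geom ω n) h

/-- The range of overlaps that are controlled by the periodicity of `ω`. -/
def reach (d : ℕ → ℕ) (ℓ r n : ℕ) : ℕ := (n - r) / (2 * d ℓ)

theorem reach_spec {n : ℕ} (hn : r ≤ n) : 2 * d ℓ * reach d ℓ r n + r ≤ n := by
  have := Nat.mul_div_le (n - r) (2 * d ℓ)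
  rw [reach]
  omega

theorem reach_le {n : ℕ} : reach d ℓ r n ≤ n := (Nat.div_le_self _ _).trans (Nat.sub_le _ _)

theorem tendsto_reach (D : LimitData P ω d ℓ r κ C θ lam) :
    Tendsto (fun n => reach d ℓ r n) atTop atTop := by
  have h1 : Tendsto (fun n => n - r) atTop atTop := tendsto_sub_atTop_nat r
  exact (Nat.tendsto_div_const_atTop (by have := D.last_pos; omega)).comp h1

/-- The reach h is linear in n, so n θ^h is bounded by a combination of h θ^h and θ^h. This makes
the bad event negligible. -/
theorem tendsto_mul_pow_reach (D : LimitData P ω d ℓ r κ C θ lam) :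
    Tendsto (fun n : ℕ => (n : ℝ) * (C * θ ^ reach d ℓ r n)) atTop (𝓝 0) := by
  have hC : 0 ≤ C := by
    have := (measureReal_nonneg (μ := P) (s := cylinder ω 0)).trans (D.le_geom ω 0)
    simpa using this
  have h1 := ((tendsto_self_mul_const_pow_of_lt_one D.base_nonneg D.base_lt).const_mul
    (C * (2 * d ℓ : ℝ))).add ((tendsto_pow_atTop_nhds_zero_of_lt_one D.base_nonneg
      D.base_lt).const_mul (C * (2 * d ℓ + r : ℝ)))
  rw [mul_zero, mul_zero, add_zero] at h1
  refine squeeze_zero (fun n => mul_nonneg n.cast_nonneg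
    (mul_nonneg hC (pow_nonneg D.base_nonneg _))) (fun n => ?_) (h1.comp D.tendsto_reach)
  have hle : n ≤ 2 * d ℓ * reach d ℓ r n + 2 * d ℓ + r := by
    have hpos : 0 < 2 * d ℓ := by have := D.last_pos; omega
    have h2 := Nat.lt_div_mul_add (a := n - r) hpos
    rw [mul_comm (2 * d ℓ)]
    rw [reach]
    omega
  have hle' : (n : ℝ) ≤ 2 * d ℓ * reach d ℓ r n + 2 * d ℓ + r := by exact_mod_cast hle
  have h0 : 0 ≤ C * θ ^ reach d ℓ r n := mul_nonneg hC (pow_nonneg D.base_nonneg _)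
  calc _ ≤ (2 * d ℓ * reach d ℓ r n + 2 * d ℓ + r : ℝ) * (C * θ ^ reach d ℓ r n) := by gcongr
    _ = _ := by
      simp only [Function.comp_apply]
      ring

open PeriodicData

/-! ### Asymptotic probabilities of runs, clumps and hits. -/

variable [MeasurableSingletonClass A]

/-- The times involved in the hits that are far from `m`. -/
def farCoords (d : ℕ → ℕ) (ℓ n N m : ℕ) : Set ℕ :=
  {s | ∃ m' ∈ farTimes d ℓ n N m, ∃ i < ℓ + 1, d i * m' ≤ s ∧ s < d i * m' + n}

/-- Of the margin 3n between window starts, n is used up by the length of the word on the left side.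
-/
theorem farCoords_far {n N m : ℕ} : ∀ s ∈ farCoords d ℓ n N m, ∀ j < ℓ + 1,
    s + 2 * n < d j * m ∨ d j * m + 3 * n ≤ s := by
  rintro s ⟨m', hm', i, hi, h1, h2⟩ j hj
  have := (Finset.mem_filter.mp hm').2 i hi j hj
  omega

variable [IsProbabilityMeasure P]

/-- At times m < 5n the windows may be too close to decouple, but there only n P(A_n) → 0 is needed.
At later times each hit has probability of order P(A_n)^(ℓ+1), and there are N ~ t P(A_n)^{-(ℓ+1)}
of them. -/
theorem eventually_sum_real_hit_le (D : LimitData P ω d ℓ r κ C θ lam) {t : ℝ} {N : ℕ → ℕ}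
    (hN : Tendsto (fun n => (N n : ℝ) * P.real (cylinder ω n) ^ (ℓ + 1)) atTop (𝓝 t)) :
    ∃ B : ℝ, ∀ᶠ n in atTop, ∑ m ∈ Finset.Icc 1 (N n), P.real (hit ω d ℓ n m) ≤ B := by
  obtain ⟨ψ, hψ0, hψ, hmix⟩ := D.exists_mixesAt
  refine ⟨1 + 2 ^ (2 * (ℓ + 1)) * (t + 1), ?_⟩
  have hna := D.tendsto_mul_cylinder.const_mul 5
  rw [mul_zero] at hna
  filter_upwards [hna.eventually (gt_mem_nhds (show (0 : ℝ) < 1 by norm_num)),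
    hN.eventually (gt_mem_nhds (show t < t + 1 by linarith)),
    hψ.eventually (gt_mem_nhds (show (0 : ℝ) < 1 by norm_num))] with n h1 h2 h3
  have hlow : ∑ m ∈ (Finset.Icc 1 (N n)).filter (· < 5 * n), P.real (hit ω d ℓ n m) ≤ 1 := by
    refine (Finset.sum_le_card_nsmul _ _ (P.real (cylinder ω n)) fun m _ =>
      real_hit_le D.invariant ω d ℓ n m).trans (le_trans ?_ h1.le)
    rw [nsmul_eq_mul, ← mul_assoc]
    have : ((Finset.Icc 1 (N n)).filter (· < 5 * n)).card ≤ 5 * n := by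
      refine (Finset.card_le_card (t := Finset.range (5 * n)) fun x hx => ?_).trans_eq
        (Finset.card_range _)
      exact Finset.mem_range.mpr (Finset.mem_filter.mp hx).2
    gcongr
    exact_mod_cast this
  have hhigh : ∑ m ∈ (Finset.Icc 1 (N n)).filter (¬ · < 5 * n), P.real (hit ω d ℓ n m) ≤
      2 ^ (2 * (ℓ + 1)) * (t + 1) := by
    have hbound : ∀ m ∈ (Finset.Icc 1 (N n)).filter (¬ · < 5 * n), P.real (hit ω d ℓ n m) ≤
        2 ^ (2 * (ℓ + 1)) * P.real (cylinder ω n) ^ (ℓ + 1) := by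
      intro m hm
      have hm' : 5 * n ≤ m := not_lt.mp (Finset.mem_filter.mp hm).2
      refine (real_wordsAt_bounds (ℓ := ℓ + 1) D.invariant D.strictMono D.one_le hm' (hmix n)
        (hψ0 n) h3 ω (a := fun i => d i * m) (L := fun _ => n) (fun i _ => by omega)
        (fun i _ => by omega)).2.trans ?_
      rw [Finset.prod_const, Finset.card_range]
      gcongr
      · have := hψ0 n
        linarith
      · linarith
    refine (Finset.sum_le_card_nsmul _ _ _ hbound).trans ?_
    rw [nsmul_eq_mul, mul_left_comm]
    refine mul_le_mul_of_nonneg_left (le_trans ?_ h2.le) (by positivity)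
    gcongr
    exact_mod_cast (Finset.card_filter_le _ _).trans_eq (by simp)
  rw [← Finset.sum_filter_add_sum_filter_not _ (· < 5 * n)]
  linarith

variable [Countable A]

/-- Mixing at gap n both decouples the run from F and factorises it into its ℓ+1 words, whose
product relative to P(A_n)^(ℓ+1) tends to ρ^(v+u). The bound is uniform in m, N and F because it
depends on n only. -/
theorem eventually_abs_run_sub_le (D : LimitData P ω d ℓ r κ C θ lam) (v u : ℕ) {η : ℝ}
    (hη : 0 < η) : ∀ᶠ n in atTop, ∀ m N : ℕ, ∀ F : Set (ℕ → A), 5 * n ≤ m →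
      DependsOnCoords F (farCoords d ℓ n N m) →
      |P.real (run ω d ℓ n (m - κ * v) (κ * (v + u)) ∩ F) - P.real (cylinder ω n) ^ (ℓ + 1) *
        (overlapFactor d ℓ r κ lam ^ (v + u) * P.real F)| ≤
          P.real (cylinder ω n) ^ (ℓ + 1) * η := by
  obtain ⟨ψ, hψ0, hψ, hmix⟩ := D.exists_mixesAt
  set ρ := overlapFactor d ℓ r κ lam
  have hq := D.tendsto_prod_ratio (v + u)
  set q : ℕ → ℝ := fun n =>
    (∏ i ∈ Finset.range (ℓ + 1), P.real (cylinder ω (n + d i * (κ * (v + u))))) /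
      P.real (cylinder ω n) ^ (ℓ + 1) with hqdef
  have hδ : Tendsto (fun n => decouplingError (ℓ + 1) (ψ n)) atTop (𝓝 0) :=
    (tendsto_decouplingError (ℓ + 1)).comp hψ
  have hU : Tendsto (fun n => (1 + decouplingError (ℓ + 1) (ψ n)) *
      ((1 + ψ n) ^ (2 * (ℓ + 1)) * q n)) atTop (𝓝 (ρ ^ (v + u))) := by
    have := (hδ.const_add 1).mul (((hψ.const_add 1).pow (2 * (ℓ + 1))).mul hq)
    simpa using this
  have hL : Tendsto (fun n => (1 - decouplingError (ℓ + 1) (ψ n)) *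
      ((1 - ψ n) ^ (2 * (ℓ + 1)) * q n)) atTop (𝓝 (ρ ^ (v + u))) := by
    have := (hδ.const_sub 1).mul (((hψ.const_sub 1).pow (2 * (ℓ + 1))).mul hq)
    simpa using this
  filter_upwards [hU.eventually (gt_mem_nhds (show ρ ^ (v + u) < ρ ^ (v + u) + η by linarith)),
    hL.eventually (lt_mem_nhds (show ρ ^ (v + u) - η < ρ ^ (v + u) by linarith)),
    hψ.eventually (gt_mem_nhds (show (0 : ℝ) < 1 by norm_num)),
    hδ.eventually (gt_mem_nhds (show (0 : ℝ) < 1 by norm_num)),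
    eventually_ge_atTop (d ℓ * (κ * (v + u)))] with n hn1 hn2 hn3 hn4 hn5 m N F hm hF
  -- For large n the run reaches at most n before d_i m and at most 2n after it, as the decoupling
  -- estimate requires.
  have hdi : ∀ i < ℓ + 1, d i * (κ * v) + d i * (κ * u) ≤ n := fun i hi => by
    rw [← mul_add, ← mul_add]
    exact (Nat.mul_le_mul_right _ (D.le_last hi)).trans hn5
  have hle : κ * v ≤ m := by
    have := hdi ℓ (by omega)
    have := le_mul_of_strictMono D.strictMono D.one_le ℓ (κ * v)
    omega
  have ha : ∀ i < ℓ + 1, d i * m ≤ d i * (m - κ * v) + n := fun i hi => by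
    have := hdi i hi
    rw [Nat.mul_sub]
    omega
  have haL : ∀ i < ℓ + 1, d i * (m - κ * v) + (n + d i * (κ * (v + u))) ≤ d i * m + 2 * n :=
    fun i hi => by
      have := hdi i hi
      have h2 : d i * (κ * v) ≤ d i * m := Nat.mul_le_mul_left _ hle
      rw [Nat.mul_sub, mul_add κ, mul_add (d i)]
      omega
  have hdec := abs_real_wordsAt_inter_sub_le (ℓ := ℓ + 1) D.invariant D.strictMono D.one_le
    (by omega) hm (hmix n) (hψ0 n) hn3 ω ha haL (finite_windows_of_finset d ℓ n _)
    farCoords_far hF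
  have hb := real_wordsAt_bounds (ℓ := ℓ + 1) D.invariant D.strictMono D.one_le hm (hmix n)
    (hψ0 n) hn3 ω ha haL
  change |P.real (run ω d ℓ n (m - κ * v) (κ * (v + u)) ∩ F) -
    P.real (run ω d ℓ n (m - κ * v) (κ * (v + u))) * P.real F| ≤ _ *
    (P.real (run ω d ℓ n (m - κ * v) (κ * (v + u))) * P.real F) at hdec
  change _ ≤ P.real (run ω d ℓ n (m - κ * v) (κ * (v + u))) ∧
    P.real (run ω d ℓ n (m - κ * v) (κ * (v + u))) ≤ _ at hb
  have ha0 : 0 < P.real (cylinder ω n) ^ (ℓ + 1) := pow_pos (D.pos n) _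
  have hprod : ∏ i ∈ Finset.range (ℓ + 1), P.real (cylinder ω (n + d i * (κ * (v + u)))) =
      P.real (cylinder ω n) ^ (ℓ + 1) * q n := by
    rw [hqdef]
    field_simp
  rw [hprod] at hb
  have hδ0 := decouplingError_nonneg (ℓ + 1) (hψ0 n) hn3
  have hF1 : P.real F ≤ 1 := measureReal_le_one
  have hF0 : 0 ≤ P.real F := measureReal_nonneg
  set a := P.real (cylinder ω n) ^ (ℓ + 1)
  set δ := decouplingError (ℓ + 1) (ψ n)
  set R := P.real (run ω d ℓ n (m - κ * v) (κ * (v + u)))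
  set X := P.real (run ω d ℓ n (m - κ * v) (κ * (v + u)) ∩ F)
  rw [abs_le] at hdec ⊢
  have haη : a * η * P.real F ≤ a * η := mul_le_of_le_one_right (by positivity) hF1
  constructor
  · have h1 : (1 - δ) * R * P.real F ≤ X := by linarith [hdec.1]
    have h2 : (1 - δ) * ((1 - ψ n) ^ (2 * (ℓ + 1)) * (a * q n)) * P.real F ≤
        (1 - δ) * R * P.real F := by
      gcongr
      exact hb.1
    have h3 : a * (ρ ^ (v + u) - η) * P.real F ≤
        a * ((1 - δ) * ((1 - ψ n) ^ (2 * (ℓ + 1)) * q n)) * P.real F := by gcongr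
    linarith
  · have h1 : X ≤ (1 + δ) * R * P.real F := by linarith [hdec.2]
    have h2 : (1 + δ) * R * P.real F ≤
        (1 + δ) * ((1 + ψ n) ^ (2 * (ℓ + 1)) * (a * q n)) * P.real F := by
      gcongr
      exact hb.2
    have h3 : a * ((1 + δ) * ((1 + ψ n) ^ (2 * (ℓ + 1)) * q n)) * P.real F ≤
        a * (ρ ^ (v + u) + η) * P.real F := by gcongr
    linarith

theorem real_sdiff_union_inter {X : Type*} [MeasurableSpace X] {μ : Measure X}
    [IsFiniteMeasure μ] {R B₁ B₂ F : Set X} (h₁ : B₁ ⊆ R) (h₂ : B₂ ⊆ R) (hm₁ : MeasurableSet B₁)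
    (hm₂ : MeasurableSet B₂) (hF : MeasurableSet F) :
    μ.real ((R \ (B₁ ∪ B₂)) ∩ F) =
      μ.real (R ∩ F) - μ.real (B₁ ∩ F) - μ.real (B₂ ∩ F) + μ.real ((B₁ ∩ B₂) ∩ F) := by
  have e : (R \ (B₁ ∪ B₂)) ∩ F = (R ∩ F) \ ((B₁ ∪ B₂) ∩ F) := by
    ext x
    simp only [Set.mem_inter_iff, Set.mem_sdiff]
    tauto
  have e2 : (B₁ ∩ F) ∩ (B₂ ∩ F) = (B₁ ∩ B₂) ∩ F := by
    ext x
    simp only [Set.mem_inter_iff]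
    tauto
  have h := measureReal_union_add_inter (μ := μ) (s := B₁ ∩ F) (hm₂.inter hF)
  rw [e, measureReal_sdiff (Set.inter_subset_inter_left _ (Set.union_subset h₁ h₂))
    ((hm₁.union hm₂).inter hF), Set.union_inter_distrib_right]
  rw [e2] at h
  linarith

/-- Inclusion–exclusion over the extensions by one step on the left, on the right and on both sides
gives ρ^(v+u) - 2ρ^(v+u+1) + ρ^(v+u+2) = ρ^(v+u)(1-ρ)²; each of the four runs may err by η/4. -/
theorem eventually_abs_clump_sub_le (D : LimitData P ω d ℓ r κ C θ lam) (v u : ℕ) {η : ℝ}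
    (hη : 0 < η) : ∀ᶠ n in atTop, ∀ m N : ℕ, ∀ F : Set (ℕ → A), 5 * n ≤ m → MeasurableSet F →
      DependsOnCoords F (farCoords d ℓ n N m) →
      |P.real (clump ω d ℓ κ n m v u ∩ F) - P.real (cylinder ω n) ^ (ℓ + 1) *
        (overlapFactor d ℓ r κ lam ^ (v + u) * (1 - overlapFactor d ℓ r κ lam) ^ 2 * P.real F)| ≤
          P.real (cylinder ω n) ^ (ℓ + 1) * η := by
  have hη4 : 0 < η / 4 := by positivity
  filter_upwards [D.eventually_abs_run_sub_le v u hη4, D.eventually_abs_run_sub_le (v + 1) u hη4,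
    D.eventually_abs_run_sub_le v (u + 1) hη4, D.eventually_abs_run_sub_le (v + 1) (u + 1) hη4,
    eventually_ge_atTop r, D.tendsto_reach.eventually_ge_atTop (κ * (v + 1)),
    D.tendsto_reach.eventually_ge_atTop (κ * (u + 1))]
    with n h1 h2 h3 h4 hr hv hu m N F hm hF hdep
  have h1 := h1 m N F hm hdep
  have h2 := h2 m N F hm hdep
  have h3 := h3 m N F hm hdep
  have h4 := h4 m N F hm hdep
  have hn := reach_spec (d := d) (ℓ := ℓ) hr
  have hhm : reach d ℓ r n ≤ m := by
    have := reach_le (d := d) (ℓ := ℓ) (r := r) (n := n)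
    omega
  have hv' : κ * v ≤ reach d ℓ r n := (Nat.mul_le_mul_left κ (Nat.le_succ v)).trans hv
  have hu' : κ * u ≤ reach d ℓ r n := (Nat.mul_le_mul_left κ (Nat.le_succ u)).trans hu
  have hsub1 : run ω d ℓ n (m - κ * (v + 1)) (κ * (v + 1 + u)) ⊆
      run ω d ℓ n (m - κ * v) (κ * (v + u)) := by
    intro γ hγ
    have := D.run_subset_hit_sub hhm hv (Nat.le_succ v) hγ
    rw [D.run_eq_inter hn hhm hv hu'] at hγ
    rw [D.run_eq_inter hn hhm hv' hu']
    exact ⟨this, hγ.2⟩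
  have hsub2 : run ω d ℓ n (m - κ * v) (κ * (v + (u + 1))) ⊆
      run ω d ℓ n (m - κ * v) (κ * (v + u)) := by
    intro γ hγ
    have := D.run_subset_hit_add hhm hv' (Nat.le_succ u) hγ
    rw [D.run_eq_inter hn hhm hv' hu] at hγ
    rw [D.run_eq_inter hn hhm hv' hu']
    exact ⟨hγ.1, this⟩
  rw [clump, real_sdiff_union_inter hsub1 hsub2 (measurableSet_run _ _ _ _ _ _)
    (measurableSet_run _ _ _ _ _ _) hF, D.run_inter_run hn hhm hv hu]
  set ρ := overlapFactor d ℓ r κ lam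
  have e : ρ ^ (v + u) * (1 - ρ) ^ 2 * P.real F = ρ ^ (v + u) * P.real F -
      ρ ^ (v + 1 + u) * P.real F - ρ ^ (v + (u + 1)) * P.real F +
      ρ ^ (v + 1 + (u + 1)) * P.real F := by ring
  rw [e]
  rw [abs_le] at h1 h2 h3 h4 ⊢
  constructor <;> linarith [h1.1, h1.2, h2.1, h2.2, h3.1, h3.2, h4.1, h4.2]

/-- Three errors of size η/3 relative to P(A_n)^(ℓ+1): the bad event, the clump asymptotics, and the
passage from the far count to the full count. -/
theorem eventually_abs_hit_sub_le (D : LimitData P ω d ℓ r κ C θ lam) (k : ℕ) {η : ℝ}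
    (hη : 0 < η) : ∀ᶠ n in atTop, ∀ m N : ℕ, 5 * n ≤ m → m + n ≤ N →
      |P.real (hit ω d ℓ n m ∩ {γ | hitCount ω d ℓ n (Finset.Icc 1 N) γ = k}) -
        P.real (cylinder ω n) ^ (ℓ + 1) * ∑ x ∈ simplexPairs k,
          overlapFactor d ℓ r κ lam ^ (x.1 + x.2) * (1 - overlapFactor d ℓ r κ lam) ^ 2 *
            P.real {γ | hitCount ω d ℓ n (Finset.Icc 1 N) γ = k - 1 - (x.1 + x.2)}| ≤
          P.real (cylinder ω n) ^ (ℓ + 1) * η := by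
  obtain ⟨ψ, hψ0, -, hmix⟩ := D.exists_mixesAt
  set ρ := overlapFactor d ℓ r κ lam with hρ
  set M : ℝ := ∑ x ∈ simplexPairs k, |ρ ^ (x.1 + x.2) * (1 - ρ) ^ 2| with hM
  set η' : ℝ := η / (3 * ((simplexPairs k).card + 1)) with hη'def
  have hη' : 0 < η' := by positivity
  have hcl : ∀ᶠ n in atTop, ∀ x ∈ simplexPairs k, ∀ m N : ℕ, ∀ F : Set (ℕ → A), 5 * n ≤ m →
      MeasurableSet F → DependsOnCoords F (farCoords d ℓ n N m) →
      |P.real (clump ω d ℓ κ n m x.1 x.2 ∩ F) - P.real (cylinder ω n) ^ (ℓ + 1) *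
        (ρ ^ (x.1 + x.2) * (1 - ρ) ^ 2 * P.real F)| ≤ P.real (cylinder ω n) ^ (ℓ + 1) * η' :=
    (Filter.eventually_all_finset _).mpr fun x _ => D.eventually_abs_clump_sub_le x.1 x.2 hη'
  have hbad : Tendsto (fun n : ℕ => (((ℓ + 1) ^ 2 * (6 * n) : ℕ) : ℝ) *
      ((1 + ψ 0) ^ (2 * (ℓ + 1)) * (C * θ ^ reach d ℓ r n))) atTop (𝓝 0) := by
    have := D.tendsto_mul_pow_reach.const_mul (((ℓ + 1) ^ 2 * 6 : ℝ) * (1 + ψ 0) ^ (2 * (ℓ + 1)))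
    rw [mul_zero] at this
    refine this.congr fun n => ?_
    push_cast
    ring
  have hfar : Tendsto (fun n : ℕ => M * ((((ℓ + 1) ^ 2 * (6 * n) : ℕ) : ℝ) *
      P.real (cylinder ω n))) atTop (𝓝 0) := by
    have := D.tendsto_mul_cylinder.const_mul (M * ((ℓ + 1) ^ 2 * 6 : ℝ))
    rw [mul_zero] at this
    refine this.congr fun n => ?_
    push_cast
    ring
  have hη3 : 0 < η / 3 := by positivity
  filter_upwards [hcl, hbad.eventually (gt_mem_nhds hη3), hfar.eventually (gt_mem_nhds hη3),
    eventually_ge_atTop r, D.tendsto_reach.eventually_ge_atTop (κ * (k + 1))]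
    with n hcl hbad hfar hr hk m N hm hN
  have hn := reach_spec (d := d) (ℓ := ℓ) hr
  have hhn := reach_le (d := d) (ℓ := ℓ) (r := r) (n := n)
  have hrpos := D.r_pos
  set h := reach d ℓ r n
  set a := P.real (cylinder ω n) ^ (ℓ + 1) with ha
  have ha0 : 0 < a := pow_pos (D.pos n) _
  have h1 := D.abs_real_hit_inter_sub_le (P := P) (N := N) (m := m) hn (by omega) (by omega) hk
  have h2 := D.real_badEvent_le (N := N) (m := m) D.invariant (hmix 0) (hψ0 0)
    (fun y => D.le_geom y h) hhn (by omega)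
  have h2' : P.real (badEvent ω d ℓ n h N m) ≤ a * (η / 3) := by
    refine h2.trans ?_
    rw [mul_comm a]
    calc _ = ((((ℓ + 1) ^ 2 * (6 * n) : ℕ) : ℝ) *
      ((1 + ψ 0) ^ (2 * (ℓ + 1)) * (C * θ ^ h))) * a := by ring
      _ ≤ _ := by gcongr
  set W : ℕ × ℕ → Set (ℕ → A) := fun x =>
    {γ | hitCount ω d ℓ n (farTimes d ℓ n N m) γ = k - 1 - (x.1 + x.2)} with hW
  set S : ℕ × ℕ → Set (ℕ → A) := fun x =>
    {γ | hitCount ω d ℓ n (Finset.Icc 1 N) γ = k - 1 - (x.1 + x.2)} with hS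
  have h3 : |∑ x ∈ simplexPairs k, P.real (clump ω d ℓ κ n m x.1 x.2 ∩ W x) -
      a * ∑ x ∈ simplexPairs k, ρ ^ (x.1 + x.2) * (1 - ρ) ^ 2 * P.real (W x)| ≤ a * (η / 3) := by
    rw [Finset.mul_sum, ← Finset.sum_sub_distrib]
    refine (Finset.abs_sum_le_sum_abs _ _).trans ((Finset.sum_le_card_nsmul _ _ _ fun x hx =>
      hcl x hx m N (W x) hm (measurableSet_hitCount_eq _ _ _ _ _ _)
        (dependsOnCoords_hitCount _ _)).trans ?_)
    rw [nsmul_eq_mul, mul_left_comm]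
    refine mul_le_mul_of_nonneg_left ?_ ha0.le
    rw [hη'def, mul_div_assoc', div_le_div_iff₀ (by positivity) (by norm_num)]
    nlinarith
  have h4 : |a * ∑ x ∈ simplexPairs k, ρ ^ (x.1 + x.2) * (1 - ρ) ^ 2 * P.real (W x) -
      a * ∑ x ∈ simplexPairs k, ρ ^ (x.1 + x.2) * (1 - ρ) ^ 2 * P.real (S x)| ≤ a * (η / 3) := by
    rw [← mul_sub, ← Finset.sum_sub_distrib, abs_mul, abs_of_pos ha0]
    refine mul_le_mul_of_nonneg_left ((Finset.abs_sum_le_sum_abs _ _).trans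
      (le_trans ?_ hfar.le)) ha0.le
    rw [hM, Finset.sum_mul]
    refine Finset.sum_le_sum fun x _ => ?_
    rw [← mul_sub, abs_mul]
    exact mul_le_mul_of_nonneg_left (D.abs_real_farCount_sub_le D.invariant _) (abs_nonneg _)
  rw [abs_le] at h1 h3 h4 ⊢
  constructor <;> linarith [h1.1, h1.2, h3.1, h3.2, h4.1, h4.2]

/-- The asymptotic Panjer recursion for the number of hits. -/
theorem tendsto_recursion (D : LimitData P ω d ℓ r κ C θ lam) {t : ℝ} (ht : 0 < t) {N : ℕ → ℕ}
    (hN : Tendsto (fun n => (N n : ℝ) * P.real (cylinder ω n) ^ (ℓ + 1)) atTop (𝓝 t)) (k : ℕ) :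
    Tendsto (fun n => (k : ℝ) * P.real {γ | hitCount ω d ℓ n (Finset.Icc 1 (N n)) γ = k} -
      t * ∑ x ∈ simplexPairs k, overlapFactor d ℓ r κ lam ^ (x.1 + x.2) *
        (1 - overlapFactor d ℓ r κ lam) ^ 2 *
          P.real {γ | hitCount ω d ℓ n (Finset.Icc 1 (N n)) γ = k - 1 - (x.1 + x.2)}) atTop
      (𝓝 0) := by
  set ρ := overlapFactor d ℓ r κ lam with hρ
  set R : ℕ → ℝ := fun n => ∑ x ∈ simplexPairs k, ρ ^ (x.1 + x.2) * (1 - ρ) ^ 2 *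
    P.real {γ | hitCount ω d ℓ n (Finset.Icc 1 (N n)) γ = k - 1 - (x.1 + x.2)} with hR
  set a : ℕ → ℝ := fun n => P.real (cylinder ω n) ^ (ℓ + 1) with ha
  have ha0 : ∀ n, 0 < a n := fun n => pow_pos (D.pos n) _
  set M : ℝ := ∑ x ∈ simplexPairs k, |ρ ^ (x.1 + x.2) * (1 - ρ) ^ 2| with hM
  have hM0 : 0 ≤ M := Finset.sum_nonneg fun _ _ => abs_nonneg _
  have hRM : ∀ n, |R n| ≤ M := fun n => by
    refine (Finset.abs_sum_le_sum_abs _ _).trans (Finset.sum_le_sum fun x _ => ?_)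
    rw [abs_mul _ (P.real _), abs_of_nonneg (measureReal_nonneg (μ := P))]
    exact mul_le_of_le_one_right (abs_nonneg _) measureReal_le_one
  have hna : Tendsto (fun n : ℕ => 6 * (n : ℝ) * P.real (cylinder ω n)) atTop (𝓝 0) := by
    have := D.tendsto_mul_cylinder.const_mul 6
    rw [mul_zero] at this
    exact this.congr fun n => by ring
  have hale : ∀ n, a n ≤ P.real (cylinder ω n) := fun n => by
    rw [ha]
    exact pow_le_of_le_one measureReal_nonneg measureReal_le_one (Nat.succ_ne_zero ℓ)
  have hna' : Tendsto (fun n : ℕ => 6 * (n : ℝ) * a n) atTop (𝓝 0) :=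
    squeeze_zero (fun n => by have := ha0 n; positivity)
      (fun n => mul_le_mul_of_nonneg_left (hale n) (by positivity)) hna
  rw [Metric.tendsto_atTop]
  intro ε hε
  rw [← eventually_atTop]
  set η : ℝ := ε / (4 * (t + 1)) with hη
  have hηpos : 0 < η := by positivity
  have hη' : (t + 1) * η = ε / 4 := by
    rw [hη]
    field_simp
  have hx1 : Tendsto (fun n => M * (|(N n : ℝ) * a n - t| + 6 * (n : ℝ) * a n)) atTop (𝓝 0) := by
    have := (((hN.sub_const t).abs).add hna').const_mul M
    simpa using this
  filter_upwards [D.eventually_abs_hit_sub_le k hηpos,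
    hna.eventually (gt_mem_nhds (show (0 : ℝ) < ε / 4 by positivity)),
    hx1.eventually (gt_mem_nhds (show (0 : ℝ) < ε / 4 by positivity)),
    hN.eventually (gt_mem_nhds (show t < t + 1 by linarith)),
    (hN.sub hna').eventually (lt_mem_nhds (show (0 : ℝ) < t - 0 by linarith)),
    eventually_gt_atTop 0]
    with n h1 h2 h3 h4 h5 hn0
  have han := ha0 n
  have h6N : 6 * n ≤ N n := by
    have : 0 < ((N n : ℝ) - 6 * n) * a n := by
      have h5' : 0 < (N n : ℝ) * a n - 6 * n * a n := h5
      linarith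
    have := (pos_iff_pos_of_mul_pos this).mpr han
    have h' : (6 * n : ℝ) ≤ N n := by linarith
    exact_mod_cast h'
  set E : Set (ℕ → A) := {γ | hitCount ω d ℓ n (Finset.Icc 1 (N n)) γ = k} with hE
  -- On I both the decoupling and the neighbourhood [m-h, m+h] ⊆ [1, N] are available. At most 6n
  -- times are left out, each contributing at most P(A_n).
  set I := Finset.Icc (5 * n) (N n - n) with hI
  have hIsub : I ⊆ Finset.Icc 1 (N n) := by
    intro x hx
    rw [hI, Finset.mem_Icc] at hx
    rw [Finset.mem_Icc]
    omega
  have hcardI : I.card + 6 * n = N n + 1 := by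
    rw [hI, Nat.card_Icc]
    omega
  have hcard2 : (Finset.Icc 1 (N n) \ I).card ≤ 6 * n := by
    rw [Finset.card_sdiff_of_subset hIsub, Nat.card_Icc]
    omega
  have hsum := sum_real_hit_inter_eq (P := P) ω d ℓ n (Finset.Icc 1 (N n)) k
  rw [← Finset.sum_sdiff hIsub] at hsum
  have hout0 : 0 ≤ ∑ m ∈ Finset.Icc 1 (N n) \ I, P.real (hit ω d ℓ n m ∩ E) :=
    Finset.sum_nonneg fun _ _ => measureReal_nonneg
  have hout : ∑ m ∈ Finset.Icc 1 (N n) \ I, P.real (hit ω d ℓ n m ∩ E) ≤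
      6 * n * P.real (cylinder ω n) := by
    refine (Finset.sum_le_card_nsmul _ _ (P.real (cylinder ω n)) fun m _ =>
      (measureReal_mono Set.inter_subset_left).trans (real_hit_le D.invariant ω d ℓ n m)).trans ?_
    rw [nsmul_eq_mul]
    gcongr
    exact_mod_cast hcard2
  have hin : |∑ m ∈ I, P.real (hit ω d ℓ n m ∩ E) - I.card * (a n * R n)| ≤
      I.card * (a n * η) := by
    have e : (I.card : ℝ) * (a n * R n) = ∑ m ∈ I, a n * R n := by simp
    rw [e, ← Finset.sum_sub_distrib]
    refine (Finset.abs_sum_le_sum_abs _ _).trans ((Finset.sum_le_card_nsmul I _ (a n * η)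
      fun m hm => ?_).trans_eq (nsmul_eq_mul _ _))
    rw [hI, Finset.mem_Icc] at hm
    exact h1 m (N n) hm.1 (by omega)
  have hcR : (I.card : ℝ) + 6 * n = N n + 1 := by exact_mod_cast hcardI
  have hcle : (I.card : ℝ) ≤ N n := by
    have : I.card ≤ N n := by omega
    exact_mod_cast this
  have hIa : (I.card : ℝ) * (a n * η) ≤ ε / 4 := by
    calc _ = ((I.card : ℝ) * a n) * η := by ring
      _ ≤ ((N n : ℝ) * a n) * η := by gcongr
      _ ≤ (t + 1) * η := by gcongr
      _ = _ := hη'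
  have hmain : |(I.card : ℝ) * (a n * R n) - t * R n| ≤ ε / 4 := by
    have e : (I.card : ℝ) * (a n * R n) - t * R n = R n * ((I.card : ℝ) * a n - t) := by ring
    rw [e, abs_mul]
    refine le_trans ?_ h3.le
    refine mul_le_mul (hRM n) ?_ (abs_nonneg _) hM0
    have e2 : (I.card : ℝ) * a n - t = ((N n : ℝ) * a n - t) - (6 * n - 1) * a n := by
      have : (I.card : ℝ) = N n - (6 * n - 1) := by linarith
      rw [this]
      ring
    have h1n : (1 : ℝ) ≤ n := by exact_mod_cast hn0
    rw [e2]
    refine (abs_sub _ _).trans ?_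
    gcongr
    rw [abs_of_nonneg (mul_nonneg (by linarith) han.le)]
    gcongr
    linarith
  rw [Real.dist_eq, sub_zero, ← hsum]
  rw [abs_le] at hin hmain
  rw [abs_lt]
  constructor <;> linarith [hin.1, hin.2, hmain.1, hmain.2]

/-- The number of hits converges in distribution to a Pólya–Aeppli law. -/
theorem tendsto_real_hitCount (D : LimitData P ω d ℓ r κ C θ lam) {t : ℝ} (ht : 0 < t)
    (hρ0 : 0 ≤ overlapFactor d ℓ r κ lam) (hρ1 : overlapFactor d ℓ r κ lam < 1) {N : ℕ → ℕ}
    (hN : Tendsto (fun n => (N n : ℝ) * P.real (cylinder ω n) ^ (ℓ + 1)) atTop (𝓝 t)) (k : ℕ) :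
    Tendsto (fun n => P.real {γ | hitCount ω d ℓ n (Finset.Icc 1 (N n)) γ = k}) atTop
      (𝓝 (polyaAeppliWeight (t * (1 - overlapFactor d ℓ r κ lam))
        (overlapFactor d ℓ r κ lam) k)) := by
  obtain ⟨B, hB⟩ := D.eventually_sum_real_hit_le hN
  set ρ := overlapFactor d ℓ r κ lam with hρ
  refine tendsto_polyaAeppliWeight
    (q := fun n k => P.real {γ | hitCount ω d ℓ n (Finset.Icc 1 (N n)) γ = k})
    (mul_pos ht (by linarith)) hρ0 hρ1 (fun _ _ => measureReal_nonneg) (fun n K => ?_) (C := B)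
    ?_ (fun k _ => ?_) k
  · rw [← measureReal_biUnion_finset]
    · exact measureReal_le_one
    · intro i _ j _ hij
      refine Set.disjoint_left.mpr fun γ h1 h2 => hij ?_
      rw [Set.mem_ofPred_eq] at h1 h2
      rw [← h1, ← h2]
    · exact fun k _ => measurableSet_hitCount_eq ω d ℓ n _ k
  · filter_upwards [hB] with n hn K
    exact (mul_one_sub_sum_le ω d ℓ n _ K).trans hn
  -- Grouping pairs by v + u; one factor 1-ρ of (1-ρ)² is absorbed in s = t(1-ρ).
  · refine (D.tendsto_recursion ht hN k).congr fun n => ?_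
    rw [sum_simplexPairs k fun i => ρ ^ i * (1 - ρ) ^ 2 *
      P.real {γ | hitCount ω d ℓ n (Finset.Icc 1 (N n)) γ = k - 1 - i}, Finset.mul_sum,
      Finset.mul_sum]
    congr 1
    exact Finset.sum_congr rfl fun i _ => by ring

end LimitData

end Limit

namespace MarkovIntervalMap

/-! ### Cylinder intervals -/

section Intervals

variable {A : Type*} (F : MarkovIntervalMap A)

/-- The points whose first `n` iterates follow `ω`. -/
def interval (ω : ℕ → A) (n : ℕ) : Set ℝ := {y | ∀ j < n, F.toFun^[j] y ∈ F.U (ω j)}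

variable {F} {ω : ℕ → A}

theorem mem_interval_add {q n : ℕ} {y : ℝ} : y ∈ F.interval ω (q + n) ↔
    y ∈ F.interval ω q ∧ F.toFun^[q] y ∈ F.interval (shift^[q] ω) n := by
  simp only [interval, Set.mem_ofPred_eq, shift_iterate_apply, ← Function.iterate_add_apply]
  constructor
  · exact fun h => ⟨fun j hj => h j (by omega), fun j hj => h (j + q) (by omega)⟩
  · rintro ⟨h1, h2⟩ j hj
    rcases lt_or_ge j q with hjq | hjq
    · exact h1 j hjq
    · obtain ⟨i, rfl⟩ := Nat.exists_eq_add_of_le' hjq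
      exact h2 i (by omega)

theorem interval_anti {n m : ℕ} (h : n ≤ m) : F.interval ω m ⊆ F.interval ω n :=
  fun _ hy j hj => hy j (hj.trans_le h)

theorem interval_one : F.interval ω 1 = F.U (ω 0) := by
  ext y
  simp [interval]

theorem mem_interval_succ {n : ℕ} {y : ℝ} : y ∈ F.interval ω (n + 1) ↔
    y ∈ F.U (ω 0) ∧ F.toFun y ∈ F.interval (shift ω) n := by
  rw [add_comm, mem_interval_add, interval_one]
  rfl

theorem U_subset (a : A) : F.U a ⊆ Set.Icc 0 1 := fun _ hx =>
  ⟨(F.left_nonneg a).trans hx.1.le, hx.2.le.trans (F.right_le_one a)⟩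

theorem interval_subset (ω : ℕ → A) (n : ℕ) : F.interval ω (n + 1) ⊆ Set.Icc 0 1 :=
  fun _ hy => U_subset (ω 0) (mem_interval_succ.mp hy).1

theorem measurableSet_interval (ω : ℕ → A) (n : ℕ) : MeasurableSet (F.interval ω n) := by
  have e : F.interval ω n = ⋂ j < n, F.toFun^[j] ⁻¹' F.U (ω j) := by
    ext y
    simp [interval]
  rw [e]
  exact MeasurableSet.iInter fun j => MeasurableSet.iInter fun _ =>
    (F.measurable.iterate j) measurableSet_Ioo

theorem strictMonoOn_or_strictAntiOn (a : A) :
    StrictMonoOn F.toFun (F.U a) ∨ StrictAntiOn F.toFun (F.U a) := by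
  rcases F.branch_strict a with h | h
  · exact Or.inl ((h.mono Set.Ioo_subset_Icc_self).congr (F.branch_eqOn a))
  · exact Or.inr ((h.mono Set.Ioo_subset_Icc_self).congr (F.branch_eqOn a))

theorem injOn_U (a : A) : Set.InjOn F.toFun (F.U a) := by
  rcases F.strictMonoOn_or_strictAntiOn a with h | h
  · exact h.injOn
  · exact h.injOn

theorem hasDerivAt_of_mem {a : A} {x : ℝ} (hx : x ∈ F.U a) :
    HasDerivAt F.toFun (F.branchDeriv a x) x := by
  have hmem : Set.Icc (F.left a) (F.right a) ∈ 𝓝 x := Icc_mem_nhds hx.1 hx.2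
  have h1 := (((F.branch_contDiffOn a).differentiableOn one_ne_zero) x
    (Set.Ioo_subset_Icc_self hx)).hasDerivWithinAt.hasDerivAt hmem
  refine h1.congr_of_eventuallyEq ?_
  filter_upwards [isOpen_Ioo.mem_nhds hx] with y hy
  exact (F.branch_eqOn a hy).symm

theorem isOpen_interval (ω : ℕ → A) (n : ℕ) : IsOpen (F.interval ω n) := by
  induction n generalizing ω with
  | zero => simp [interval]
  | succ n ih =>
    have e : F.interval ω (n + 1) = F.U (ω 0) ∩ F.toFun ⁻¹' F.interval (shift ω) n := by
      ext y
      exact mem_interval_succ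
    rw [e]
    exact ContinuousOn.isOpen_inter_preimage (fun x hx =>
      (hasDerivAt_of_mem hx).continuousAt.continuousWithinAt) isOpen_Ioo (ih _)

/-- Each branch is monotone, so pulling back along it preserves order-connectedness. Diameters are
then bounded by lengths. -/
theorem ordConnected_interval (ω : ℕ → A) (n : ℕ) : (F.interval ω n).OrdConnected := by
  induction n generalizing ω with
  | zero => simpa [interval] using Set.ordConnected_univ
  | succ n ih =>
    refine ⟨fun x hx z hz y hy => ?_⟩
    rw [mem_interval_succ] at hx hz ⊢
    have hyU : y ∈ F.U (ω 0) := ⟨hx.1.1.trans_le hy.1, hy.2.trans_lt hz.1.2⟩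
    refine ⟨hyU, ?_⟩
    rcases F.strictMonoOn_or_strictAntiOn (ω 0) with h | h
    · exact (ih (shift ω)).out hx.2 hz.2
        ⟨h.monotoneOn hx.1 hyU hy.1, h.monotoneOn hyU hz.1 hy.2⟩
    · exact (ih (shift ω)).out hz.2 hx.2
        ⟨h.antitoneOn hyU hz.1 hy.2, h.antitoneOn hx.1 hyU hy.1⟩

theorem injOn_iterate (ω : ℕ → A) (q : ℕ) : Set.InjOn F.toFun^[q] (F.interval ω q) := by
  induction q generalizing ω with
  | zero => simp [Function.iterate_zero]
  | succ q ih =>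
    intro x hx y hy hxy
    rw [mem_interval_succ] at hx hy
    exact injOn_U _ hx.1 hy.1 (ih (shift ω) hx.2 hy.2 hxy)

/-! ### Expansion -/

/-- The uniform expansion of the `q`-th iterate with factor `τ`. -/
def Expands (F : MarkovIntervalMap A) (q : ℕ) (τ : ℝ) : Prop :=
  ∀ x : ℝ, (∀ j < q, F.toFun^[j] x ∈ ⋃ a, Set.Ioo (F.left a) (F.right a)) →
    τ ≤ |deriv (F.toFun^[q]) x|

theorem ofReal_mul_volume_interval_le {q : ℕ} {τ : ℝ} (hτ : 0 < τ) (hexp : F.Expands q τ)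
    (ω : ℕ → A) (n : ℕ) : ENNReal.ofReal τ * volume (F.interval ω (q + n)) ≤
      volume (F.interval (shift^[q] ω) n) := by
  have hsub : F.interval ω (q + n) ⊆ F.interval ω q := interval_anti (Nat.le_add_right q n)
  have hder : ∀ x ∈ F.interval ω (q + n), τ ≤ |deriv (F.toFun^[q]) x| := fun x hx =>
    hexp x fun j hj => Set.mem_iUnion.mpr ⟨ω j, hsub hx j hj⟩
  have himg : F.toFun^[q] '' F.interval ω (q + n) ⊆ F.interval (shift^[q] ω) n := by
    rintro _ ⟨x, hx, rfl⟩
    exact (mem_interval_add.mp hx).2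
  have hcov := lintegral_image_eq_lintegral_abs_deriv_mul (measurableSet_interval ω (q + n))
    (f := F.toFun^[q]) (f' := fun x => deriv (F.toFun^[q]) x) (fun x hx => by
      -- The lower bound on |deriv| also yields differentiability, since `deriv` is 0 at points of
      -- non-differentiability.
      have hne : deriv (F.toFun^[q]) x ≠ 0 := fun h0 => by
        have := hder x hx
        rw [h0, abs_zero] at this
        linarith
      exact (differentiableAt_of_deriv_ne_zero hne).hasDerivAt.hasDerivWithinAt)
    ((injOn_iterate ω q).mono hsub) (fun _ => 1)
  rw [setLIntegral_one] at hcov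
  calc _ = ∫⁻ _ in F.interval ω (q + n), ENNReal.ofReal τ := (setLIntegral_const _ _).symm
    _ ≤ ∫⁻ x in F.interval ω (q + n), ENNReal.ofReal |deriv (F.toFun^[q]) x| * 1 := by
      refine setLIntegral_mono' (measurableSet_interval ω (q + n)) fun x hx => ?_
      rw [mul_one]
      exact ENNReal.ofReal_le_ofReal (hder x hx)
    _ = volume (F.toFun^[q] '' F.interval ω (q + n)) := hcov.symm
    _ ≤ _ := measure_mono himg

theorem volume_interval_le_one (ω : ℕ → A) (n : ℕ) : volume (F.interval ω (n + 1)) ≤ 1 := by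
  refine (measure_mono (interval_subset ω n)).trans ?_
  simp

theorem volume_interval_ne_top (ω : ℕ → A) (n : ℕ) : volume (F.interval ω (n + 1)) ≠ ⊤ :=
  ((volume_interval_le_one ω n).trans_lt ENNReal.one_lt_top).ne

theorem mul_volume_real_interval_le {q : ℕ} {τ : ℝ} (hτ : 0 < τ) (hexp : F.Expands q τ)
    (ω : ℕ → A) (n : ℕ) : τ * volume.real (F.interval ω (q + (n + 1))) ≤
      volume.real (F.interval (shift^[q] ω) (n + 1)) := by
  have h := ofReal_mul_volume_interval_le hτ hexp ω (n + 1)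
  have := ENNReal.toReal_mono (volume_interval_ne_top _ n) h
  rwa [ENNReal.toReal_mul, ENNReal.toReal_ofReal hτ.le] at this

theorem pow_mul_volume_real_interval_le {q : ℕ} {τ : ℝ} (hτ : 0 < τ) (hexp : F.Expands q τ)
    (k : ℕ) (ω : ℕ → A) (n : ℕ) : τ ^ k * volume.real (F.interval ω (q * k + (n + 1))) ≤
      volume.real (F.interval (shift^[q * k] ω) (n + 1)) := by
  induction k generalizing ω with
  | zero => simp
  | succ k ih =>
    have h1 := mul_volume_real_interval_le hτ hexp ω (q * k + n)
    have h2 := ih (shift^[q] ω)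
    have e1 : q * (k + 1) + (n + 1) = q + (q * k + n + 1) := by ring
    have e2 : shift^[q * (k + 1)] ω = shift^[q * k] (shift^[q] ω) := by
      rw [← Function.iterate_add_apply]
      rfl
    rw [e1, e2, pow_succ]
    calc _ = τ ^ k * (τ * volume.real (F.interval ω (q + (q * k + n + 1)))) := by ring
      _ ≤ τ ^ k * volume.real (F.interval (shift^[q] ω) (q * k + n + 1)) := by gcongr
      _ ≤ _ := h2

/-- The lengths of the cylinder intervals decay exponentially, uniformly in the word. -/
theorem exists_volume_real_interval_le (F : MarkovIntervalMap A) :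
    ∃ C θ : ℝ, 0 ≤ C ∧ 0 ≤ θ ∧ θ < 1 ∧ ∀ (ω : ℕ → A) (n : ℕ),
      volume.real (F.interval ω (n + 1)) ≤ C * θ ^ (n + 1) := by
  obtain ⟨q, hq, τ, hτ, hexp⟩ := F.expanding
  have hτ0 : 0 < τ := by linarith
  have hq0 : (0 : ℝ) < q := by exact_mod_cast hq
  -- Length n + 1 contains ⌊n/q⌋ ≥ (n+1)/q - 1 full expansion steps; the constant τ compensates for
  -- the lost step.
  refine ⟨τ, τ ^ (-(1 / q : ℝ)), hτ0.le, by positivity,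
    Real.rpow_lt_one_of_one_lt_of_neg hτ (by simpa using hq0), fun ω n => ?_⟩
  set k := n / q with hk
  have h1 := pow_mul_volume_real_interval_le hτ0 hexp k ω (n - q * k)
  have hkn : q * k ≤ n := Nat.mul_div_le n q
  have e1 : q * k + (n - q * k + 1) = n + 1 := by omega
  rw [e1] at h1
  have h2 : volume.real (F.interval (shift^[q * k] ω) (n - q * k + 1)) ≤ 1 := by
    have := ENNReal.toReal_mono ENNReal.one_ne_top (volume_interval_le_one (F := F)
      (shift^[q * k] ω) (n - q * k))
    simpa [measureReal_def] using this
  have h3 : volume.real (F.interval ω (n + 1)) ≤ (τ ^ k)⁻¹ := by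
    rw [← one_div, le_div_iff₀ (by positivity), mul_comm]
    exact h1.trans h2
  refine h3.trans ?_
  rw [← Real.rpow_natCast, ← Real.rpow_natCast, ← Real.rpow_neg hτ0.le, ← Real.rpow_mul hτ0.le]
  nth_rewrite 2 [← Real.rpow_one τ]
  rw [← Real.rpow_add hτ0]
  apply Real.rpow_le_rpow_of_exponent_le hτ.le
  have h4 : n + 1 ≤ q * k + q := by
    have := Nat.lt_div_mul_add (a := n) (b := q) hq
    rw [← hk, mul_comm k] at this
    omega
  have h5 : ((n + 1 : ℕ) : ℝ) ≤ q * k + q := by exact_mod_cast h4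
  have h6 : ((n + 1 : ℕ) : ℝ) / q ≤ k + 1 := by
    rw [div_le_iff₀ hq0]
    linarith
  calc -(k : ℝ) ≤ 1 - ((n + 1 : ℕ) : ℝ) / q := by linarith
    _ = _ := by ring

/-! ### The coding map -/

/-- All cylinder intervals of `ω` are nonempty. -/
def Admissible (F : MarkovIntervalMap A) (ω : ℕ → A) : Prop := ∀ n, (F.interval ω n).Nonempty

theorem Admissible.shifted (h : F.Admissible ω) : F.Admissible (shift ω) := fun n => by
  obtain ⟨y, hy⟩ := h (n + 1)
  exact ⟨_, (mem_interval_succ.mp hy).2⟩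

theorem Admissible.shift_iterate (h : F.Admissible ω) (k : ℕ) : F.Admissible (shift^[k] ω) := by
  induction k with
  | zero => exact h
  | succ k ih =>
    rw [Function.iterate_succ_apply']
    exact ih.shifted

theorem Admissible.volume_real_pos (h : F.Admissible ω) (n : ℕ) :
    0 < volume.real (F.interval ω (n + 1)) :=
  ENNReal.toReal_pos ((isOpen_interval ω (n + 1)).measure_pos volume (h (n + 1))).ne'
    (volume_interval_ne_top ω n)

/-- Surjectivity is the Markov property: the image of the first interval meets the second one, hence
contains it. -/
theorem Admissible.image_interval (h : F.Admissible ω) (n : ℕ) :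
    F.toFun '' F.interval ω (n + 2) = F.interval (shift ω) (n + 1) := by
  ext z
  constructor
  · rintro ⟨x, hx, rfl⟩
    exact (mem_interval_succ.mp hx).2
  · intro hz
    obtain ⟨y, hy⟩ := h 2
    obtain ⟨hy1, hy2⟩ := mem_interval_succ.mp hy
    have hsub := F.markov (ω 0) (ω 1) ⟨F.toFun y, ⟨y, hy1, rfl⟩, (mem_interval_succ.mp hy2).1⟩
    obtain ⟨x, hx, rfl⟩ := hsub (mem_interval_succ.mp hz).1
    exact ⟨x, mem_interval_succ.mpr ⟨hx, hz⟩, rfl⟩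

theorem Admissible.coding_mem (h : F.Admissible ω) {n : ℕ} (hn : 1 ≤ n) :
    F.coding ω ∈ closure (F.interval ω n) := by
  have hex : ∃ x : ℝ, ∀ n ≥ 1, x ∈ closure {y : ℝ | ∀ j < n, F.toFun^[j] y ∈ F.U (ω j)} := by
    obtain ⟨x, hx⟩ := IsCompact.nonempty_iInter_of_sequence_nonempty_isCompact_isClosed
      (fun n => closure (F.interval ω (n + 1))) (fun n => closure_mono (interval_anti (by omega)))
      (fun n => (h (n + 1)).closure)
      (isCompact_Icc.of_isClosed_subset isClosed_closure
        (closure_minimal (interval_subset ω 0) isClosed_Icc)) (fun n => isClosed_closure)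
    refine ⟨x, fun n hn => ?_⟩
    obtain ⟨k, rfl⟩ := Nat.exists_eq_add_of_le' hn
    exact Set.mem_iInter.mp hx k
  exact Classical.epsilon_spec hex n hn

theorem dist_le_volume_real {x y : ℝ} {n : ℕ} (hx : x ∈ F.interval ω (n + 1))
    (hy : y ∈ F.interval ω (n + 1)) : dist x y ≤ volume.real (F.interval ω (n + 1)) := by
  wlog hxy : x ≤ y generalizing x y
  · rw [dist_comm]
    exact this hy hx (le_of_not_ge hxy)
  rw [dist_comm, Real.dist_eq, abs_of_nonneg (by linarith)]
  have hsub := (ordConnected_interval ω (n + 1)).out hx hy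
  have := measureReal_mono (μ := volume) hsub (volume_interval_ne_top ω n)
  rwa [Real.volume_real_Icc_of_le hxy] at this

/-- The filter of the cylinder intervals of `ω`. -/
def intervalFilter (F : MarkovIntervalMap A) (ω : ℕ → A) : Filter ℝ :=
  ⨅ n : ℕ, 𝓟 (F.interval ω n)

theorem hasBasis_intervalFilter (F : MarkovIntervalMap A) (ω : ℕ → A) :
    (F.intervalFilter ω).HasBasis (fun _ => True) (F.interval ω) :=
  hasBasis_iInf_principal (antitone_nat_of_succ_le fun n => interval_anti n.le_succ).directed_ge

theorem interval_mem_intervalFilter (ω : ℕ → A) (n : ℕ) :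
    F.interval ω n ∈ F.intervalFilter ω :=
  (hasBasis_intervalFilter F ω).mem_of_mem trivial

theorem eventually_of_intervalFilter {Q : ℝ → Prop} (h : ∀ᶠ x in F.intervalFilter ω, Q x) :
    ∀ᶠ n in atTop, ∀ x ∈ F.interval ω n, Q x := by
  obtain ⟨n, -, hn⟩ := (hasBasis_intervalFilter F ω).mem_iff.mp h
  filter_upwards [eventually_ge_atTop n] with m hm x hx
  exact hn (interval_anti hm hx)

/-- The cylinder intervals shrink to the coding point. This point may be a common end point lying
outside the open intervals, so limits are taken along their filter. -/
theorem Admissible.tendsto_intervalFilter (h : F.Admissible ω) :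
    Tendsto id (F.intervalFilter ω) (𝓝 (F.coding ω)) := by
  obtain ⟨C, θ, -, hθ, hθ1, hbound⟩ := F.exists_volume_real_interval_le
  rw [Metric.tendsto_nhds]
  intro ε hε
  have hlim : Tendsto (fun n => C * θ ^ (n + 1)) atTop (𝓝 0) := by
    have := ((tendsto_pow_atTop_nhds_zero_of_lt_one hθ hθ1).comp (tendsto_add_atTop_nat 1)).const_mul
      C
    simpa using this
  obtain ⟨n, hn⟩ := (hlim.eventually (gt_mem_nhds hε)).exists
  filter_upwards [interval_mem_intervalFilter ω (n + 1)] with x hx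
  have hcl : F.coding ω ∈ Metric.closedBall x (C * θ ^ (n + 1)) := by
    refine closure_minimal (fun y hy => ?_) Metric.isClosed_closedBall (h.coding_mem (n := n + 1)
      (by omega))
    exact (dist_le_volume_real hy hx).trans (hbound ω n)
  rw [Metric.mem_closedBall, dist_comm] at hcl
  exact hcl.trans_lt hn

theorem Admissible.coding_mem_Icc (h : F.Admissible ω) :
    F.coding ω ∈ Set.Icc (F.left (ω 0)) (F.right (ω 0)) := by
  have := h.coding_mem le_rfl
  rw [interval_one, U, closure_Ioo (F.left_lt_right _).ne] at this
  exact this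

theorem Admissible.coding_mem_unit (h : F.Admissible ω) : F.coding ω ∈ Set.Icc (0 : ℝ) 1 :=
  Set.Icc_subset_Icc (F.left_nonneg _) (F.right_le_one _) h.coding_mem_Icc

/-! ### Asymptotic ratios of the masses of cylinder intervals -/

/-- The mass of a set for the density `p`. -/
def mass (p : ℝ → ℝ) (s : Set ℝ) : ℝ := (∫⁻ x in s, ENNReal.ofReal (p x)).toReal

variable {p : ℝ → ℝ}

theorem lintegral_interval_ne_top (hp : ContinuousOn p (Set.Icc 0 1)) (ω : ℕ → A) (n : ℕ) :
    ∫⁻ x in F.interval ω (n + 1), ENNReal.ofReal (p x) ≠ ⊤ := by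
  obtain ⟨M, hM⟩ := isCompact_Icc.bddAbove_image hp
  refine (lt_of_le_of_lt (setLIntegral_mono' (measurableSet_interval ω (n + 1)) fun x hx =>
    ENNReal.ofReal_le_ofReal (hM ⟨x, interval_subset ω n hx, rfl⟩)) ?_).ne
  rw [setLIntegral_const]
  exact ENNReal.mul_lt_top ENNReal.ofReal_lt_top (volume_interval_ne_top ω n).lt_top

theorem exists_mass_interval_le (hp : ContinuousOn p (Set.Icc 0 1)) :
    ∃ M : ℝ, 0 ≤ M ∧ ∀ (ω : ℕ → A) (n : ℕ),
      mass p (F.interval ω (n + 1)) ≤ M * volume.real (F.interval ω (n + 1)) := by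
  obtain ⟨M, hM⟩ := isCompact_Icc.bddAbove_image hp
  refine ⟨max M 0, le_max_right _ _, fun ω n => ?_⟩
  have h : ∫⁻ x in F.interval ω (n + 1), ENNReal.ofReal (p x) ≤
      ENNReal.ofReal (max M 0) * volume (F.interval ω (n + 1)) := by
    rw [← setLIntegral_const]
    exact setLIntegral_mono' (measurableSet_interval ω (n + 1)) fun x hx =>
      ENNReal.ofReal_le_ofReal ((hM ⟨x, interval_subset ω n hx, rfl⟩).trans (le_max_left _ _))
  have := ENNReal.toReal_mono (ENNReal.mul_ne_top ENNReal.ofReal_ne_top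
    (volume_interval_ne_top ω n)) h
  rwa [ENNReal.toReal_mul, ENNReal.toReal_ofReal (le_max_right _ _)] at this

theorem Admissible.mass_pos (h : F.Admissible ω) (hp : ContinuousOn p (Set.Icc 0 1))
    (hpos : ∀ x ∈ Set.Icc (0 : ℝ) 1, 0 < p x) (n : ℕ) : 0 < mass p (F.interval ω (n + 1)) := by
  obtain ⟨x₀, hx₀, hmin⟩ := isCompact_Icc.exists_isMinOn (Set.nonempty_Icc.mpr zero_le_one) hp
  refine ENNReal.toReal_pos (ne_of_gt (lt_of_lt_of_le ?_
    (setLIntegral_mono' (g := fun x => ENNReal.ofReal (p x)) (f := fun _ => ENNReal.ofReal (p x₀))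
    (measurableSet_interval ω (n + 1)) fun x hx =>
      ENNReal.ofReal_le_ofReal (hmin (interval_subset ω n hx)))))
    (lintegral_interval_ne_top hp ω n)
  rw [setLIntegral_const]
  exact ENNReal.mul_pos (ENNReal.ofReal_pos.mpr (hpos x₀ hx₀)).ne'
    ((isOpen_interval ω (n + 1)).measure_pos volume (h (n + 1))).ne'

theorem Admissible.lintegral_interval_shift (h : F.Admissible ω) (n : ℕ) :
    ∫⁻ x in F.interval (shift ω) (n + 1), ENNReal.ofReal (p x) =
      ∫⁻ x in F.interval ω (n + 2), ENNReal.ofReal |F.branchDeriv (ω 0) x| *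
        ENNReal.ofReal (p (F.toFun x)) := by
  rw [← h.image_interval n]
  exact lintegral_image_eq_lintegral_abs_deriv_mul (measurableSet_interval ω (n + 2))
    (fun x hx => (hasDerivAt_of_mem (mem_interval_succ.mp hx).1).hasDerivWithinAt)
    ((injOn_U (ω 0)).mono fun x hx => (mem_interval_succ.mp hx).1) _

theorem Admissible.mass_shift_le (h : F.Admissible ω) (hp : ContinuousOn p (Set.Icc 0 1))
    (hpos : ∀ x ∈ Set.Icc (0 : ℝ) 1, 0 < p x) {n : ℕ} {K : ℝ} (hK : ∀ x ∈ F.interval ω (n + 2),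
      |F.branchDeriv (ω 0) x| * p (F.toFun x) / p x ≤ K) :
    mass p (F.interval (shift ω) (n + 1)) ≤ K * mass p (F.interval ω (n + 2)) := by
  obtain ⟨x₀, hx₀⟩ := h (n + 2)
  have hpx : ∀ x ∈ F.interval ω (n + 2), 0 < p x := fun x hx => hpos x (interval_subset ω (n + 1) hx)
  have hpf : ∀ x ∈ F.interval ω (n + 2), 0 ≤ p (F.toFun x) := fun x hx =>
    (hpos _ (F.mapsTo (interval_subset ω (n + 1) hx))).le
  have hK0 : 0 ≤ K := le_trans (div_nonneg (mul_nonneg (abs_nonneg _) (hpf x₀ hx₀))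
    (hpx x₀ hx₀).le) (hK x₀ hx₀)
  rw [mass, mass, h.lintegral_interval_shift n, ← ENNReal.toReal_ofReal hK0, ← ENNReal.toReal_mul,
    ← lintegral_const_mul' _ _ ENNReal.ofReal_ne_top]
  refine ENNReal.toReal_mono ?_ (setLIntegral_mono' (measurableSet_interval ω (n + 2))
    fun x hx => ?_)
  · rw [lintegral_const_mul' _ _ ENNReal.ofReal_ne_top]
    exact ENNReal.mul_ne_top ENNReal.ofReal_ne_top (lintegral_interval_ne_top hp ω (n + 1))
  · rw [← ENNReal.ofReal_mul (abs_nonneg _), ← ENNReal.ofReal_mul hK0]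
    exact ENNReal.ofReal_le_ofReal ((div_le_iff₀ (hpx x hx)).mp (hK x hx))

theorem Admissible.le_mass_shift (h : F.Admissible ω) (hp : ContinuousOn p (Set.Icc 0 1))
    (hpos : ∀ x ∈ Set.Icc (0 : ℝ) 1, 0 < p x) {n : ℕ} {K : ℝ} (hK : ∀ x ∈ F.interval ω (n + 2),
      K ≤ |F.branchDeriv (ω 0) x| * p (F.toFun x) / p x) :
    K * mass p (F.interval ω (n + 2)) ≤ mass p (F.interval (shift ω) (n + 1)) := by
  have hpx : ∀ x ∈ F.interval ω (n + 2), 0 < p x := fun x hx => hpos x (interval_subset ω (n + 1) hx)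
  rcases le_or_gt K 0 with hK0 | hK0
  · exact (mul_nonpos_of_nonpos_of_nonneg hK0 ENNReal.toReal_nonneg).trans ENNReal.toReal_nonneg
  have hfin := lintegral_interval_ne_top (F := F) hp (shift ω) n
  rw [mass, mass]
  rw [h.lintegral_interval_shift n] at hfin ⊢
  rw [← ENNReal.toReal_ofReal hK0.le, ← ENNReal.toReal_mul,
    ← lintegral_const_mul' _ _ ENNReal.ofReal_ne_top]
  refine ENNReal.toReal_mono hfin (setLIntegral_mono' (measurableSet_interval ω (n + 2))
    fun x hx => ?_)
  rw [← ENNReal.ofReal_mul (abs_nonneg _), ← ENNReal.ofReal_mul hK0.le]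
  exact ENNReal.ofReal_le_ofReal ((le_div_iff₀ (hpx x hx)).mp (hK x hx))

/-- By change of variables the mass of the image interval is the integral of |f'(x)| p(f x)/p(x)
against the mass on the original interval. This integrand converges along the shrinking intervals,
with f' continuous up to the end points through the C¹ branch. -/
theorem Admissible.tendsto_mass_ratio (h : F.Admissible ω) (hp : ContinuousOn p (Set.Icc 0 1))
    (hpos : ∀ x ∈ Set.Icc (0 : ℝ) 1, 0 < p x) :
    Tendsto (fun n => mass p (F.interval (shift ω) (n + 1)) /
      mass p (F.interval ω (n + 2))) atTop (𝓝 (|F.branchDeriv (ω 0) (F.coding ω)| *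
        p (F.coding (shift ω)) / p (F.coding ω))) := by
  set c := |F.branchDeriv (ω 0) (F.coding ω)| * p (F.coding (shift ω)) /
    p (F.coding ω) with hc
  have hU := interval_mem_intervalFilter (F := F) ω 1
  have hid : Tendsto id (F.intervalFilter ω) (𝓝[Set.Icc 0 1] F.coding ω) :=
    tendsto_nhdsWithin_iff.mpr ⟨h.tendsto_intervalFilter, by
      filter_upwards [hU] with x hx
      exact interval_subset ω 0 hx⟩
  have hid' : Tendsto id (F.intervalFilter ω)
      (𝓝[Set.Icc (F.left (ω 0)) (F.right (ω 0))] F.coding ω) :=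
    tendsto_nhdsWithin_iff.mpr ⟨h.tendsto_intervalFilter, by
      filter_upwards [hU] with x hx
      rw [interval_one] at hx
      exact Set.Ioo_subset_Icc_self hx⟩
  have hmap : Tendsto F.toFun (F.intervalFilter ω) (F.intervalFilter (shift ω)) := by
    refine (hasBasis_intervalFilter F _).tendsto_right_iff.mpr fun n _ => ?_
    filter_upwards [interval_mem_intervalFilter ω (n + 1)] with x hx
    exact (mem_interval_succ.mp hx).2
  have hf : Tendsto F.toFun (F.intervalFilter ω)
      (𝓝[Set.Icc 0 1] F.coding (shift ω)) :=
    tendsto_nhdsWithin_iff.mpr ⟨h.shifted.tendsto_intervalFilter.comp hmap, by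
      filter_upwards [hU] with x hx
      exact F.mapsTo (interval_subset ω 0 hx)⟩
  have hd : ContinuousWithinAt (F.branchDeriv (ω 0))
      (Set.Icc (F.left (ω 0)) (F.right (ω 0))) (F.coding ω) :=
    (F.branch_contDiffOn (ω 0)).continuousOn_derivWithin (uniqueDiffOn_Icc (F.left_lt_right _))
      le_rfl _ h.coding_mem_Icc
  have hlim : Tendsto (fun x => |F.branchDeriv (ω 0) x| * p (F.toFun x) / p x)
      (F.intervalFilter ω) (𝓝 c) :=
    (((hd.tendsto.comp hid').abs).mul ((hp _ h.shifted.coding_mem_unit).tendsto.comp hf)).div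
      ((hp _ h.coding_mem_unit).tendsto.comp hid) (hpos _ h.coding_mem_unit).ne'
  rw [Metric.tendsto_atTop]
  intro ε hε
  rw [← eventually_atTop]
  have hev := eventually_of_intervalFilter (hlim.eventually (Metric.closedBall_mem_nhds c
    (half_pos hε)))
  filter_upwards [(tendsto_add_atTop_nat 2).eventually hev] with n hn
  have hn' : ∀ x ∈ F.interval ω (n + 2),
      |(|F.branchDeriv (ω 0) x| * p (F.toFun x) / p x) - c| ≤ ε / 2 := fun x hx => hn x hx
  have h1 := h.mass_shift_le hp hpos (K := c + ε / 2) fun x hx => by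
    linarith [(abs_le.mp (hn' x hx)).2]
  have h2 := h.le_mass_shift hp hpos (K := c - ε / 2) fun x hx => by
    linarith [(abs_le.mp (hn' x hx)).1]
  have hm := h.mass_pos hp hpos (n + 1)
  rw [← div_le_iff₀ hm] at h1
  rw [← le_div_iff₀ hm] at h2
  rw [Real.dist_eq, abs_lt]
  constructor <;> linarith

theorem Admissible.tendsto_mass_ratio_iterate (h : F.Admissible ω)
    (hp : ContinuousOn p (Set.Icc 0 1)) (hpos : ∀ x ∈ Set.Icc (0 : ℝ) 1, 0 < p x) (k : ℕ) :
    Tendsto (fun n => mass p (F.interval (shift^[k] ω) (n + 1)) /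
      mass p (F.interval ω (n + k + 1))) atTop
      (𝓝 ((∏ j ∈ Finset.range k,
        |F.branchDeriv (ω j) (F.coding (shift^[j] ω))|) *
        p (F.coding (shift^[k] ω)) / p (F.coding ω))) := by
  induction k with
  | zero =>
    have h0 := (hpos _ h.coding_mem_unit).ne'
    simp only [Function.iterate_zero, id_eq, Finset.range_zero, Finset.prod_empty, one_mul,
      div_self h0, add_zero]
    exact tendsto_const_nhds.congr fun n => (div_self (h.mass_pos hp hpos n).ne').symm
  | succ k ih =>
    have hk := h.shift_iterate k
    have h1 := (hk.tendsto_mass_ratio hp hpos).mul (ih.comp (tendsto_add_atTop_nat 1))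
    have h0 := (hpos _ hk.coding_mem_unit).ne'
    rw [shift_iterate_apply, zero_add] at h1
    rw [Finset.prod_range_succ]
    simp only [Function.iterate_succ_apply']
    refine Tendsto.congr (fun n => ?_) (h1.trans_eq ?_)
    · have := (hk.mass_pos hp hpos (n + 1)).ne'
      simp only [Function.comp_apply]
      have e : n + 1 + k + 1 = n + (k + 1) + 1 := by ring
      rw [e]
      have e2 : n + 1 + 1 = n + 2 := rfl
      rw [e2]
      rw [e2] at this
      field_simp
    · congr 1
      field_simp

end Intervals

end MarkovIntervalMap

namespace MarkovIntervalMap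

/-! ### The symbolic measure -/

section Symbolic

variable {A : Type*} {F : MarkovIntervalMap A} {ω : ℕ → A} {p : ℝ → ℝ}

/-- The multiplier `∏_{j < r} |f'_{ω_j}(Θ(T^j ω))|`. -/
def multiplier (F : MarkovIntervalMap A) (ω : ℕ → A) (r : ℕ) : ℝ :=
  ∏ j ∈ Finset.range r, |F.branchDeriv (ω j) (F.coding (shift^[j] ω))|

theorem Admissible.tendsto_mass_ratio_of_periodic (h : F.Admissible ω)
    (hp : ContinuousOn p (Set.Icc 0 1)) (hpos : ∀ x ∈ Set.Icc (0 : ℝ) 1, 0 < p x) {r : ℕ}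
    (hr : shift^[r] ω = ω) :
    Tendsto (fun n => mass p (F.interval ω (n + 1)) / mass p (F.interval ω (n + r + 1))) atTop
      (𝓝 (F.multiplier ω r)) := by
  have h1 := h.tendsto_mass_ratio_iterate hp hpos r
  rw [hr, mul_div_assoc, div_self (hpos _ h.coding_mem_unit).ne', mul_one] at h1
  exact h1

/-- With the constant density 1 the multiplier is a limit of length ratios. Only f^q is known to
expand, so the ratio is taken over q periods: these are r blocks of length q, whence multiplier^q ≥
τ^r > 1. -/
theorem Admissible.one_lt_multiplier (h : F.Admissible ω) {r : ℕ} (hr0 : 0 < r)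
    (hr : shift^[r] ω = ω) : 1 < F.multiplier ω r := by
  obtain ⟨q, hq, τ, hτ, hexp⟩ := F.expanding
  have hmass : ∀ s : Set ℝ, mass (fun _ => 1) s = volume.real s := fun s => by
    simp [mass, measureReal_def]
  have h1 := h.tendsto_mass_ratio_of_periodic (p := fun _ => 1) continuousOn_const
    (fun _ _ => one_pos) hr
  simp only [hmass] at h1
  have hb : ∀ n, 0 < (volume.real (F.interval ω (n + 1)))⁻¹ := fun n =>
    inv_pos.mpr (h.volume_real_pos n)
  have h2 := tendsto_ratio_pow (b := fun n => (volume.real (F.interval ω (n + 1)))⁻¹) (r := r)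
    (c := F.multiplier ω r) hb (h1.congr fun n => by rw [inv_div_inv]) q
  have hper : shift^[q * r] ω = ω := by
    rw [mul_comm, Function.iterate_mul]
    exact Function.iterate_fixed hr q
  have h3 : τ ^ r ≤ F.multiplier ω r ^ q := by
    refine ge_of_tendsto' h2 fun n => ?_
    have h4 := pow_mul_volume_real_interval_le (by linarith) hexp r ω n
    rw [hper] at h4
    have e : q * r + (n + 1) = n + r * q + 1 := by ring
    rw [e] at h4
    rw [inv_div_inv, le_div_iff₀ (h.volume_real_pos _)]
    exact h4
  by_contra hle
  have h5 : F.multiplier ω r ^ q ≤ 1 :=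
    pow_le_one₀ (Finset.prod_nonneg fun _ _ => abs_nonneg _) (not_lt.mp hle)
  have h6 : 1 < τ ^ r := one_lt_pow₀ hτ hr0.ne'
  linarith

/-- The complement of U is null by absolute continuity, and invariance carries this to all iterates.
-/
theorem ae_forall_mem_U {μ : Measure ℝ} (hinv : MeasurePreserving F.toFun μ μ)
    (hμ : μ = (volume.restrict (Set.Icc (0 : ℝ) 1)).withDensity fun x => ENNReal.ofReal (p x)) :
    ∀ᵐ x ∂μ, ∀ j, ∃ a, F.toFun^[j] x ∈ F.U a := by
  have h0 : ∀ᵐ x ∂μ, ∃ a, x ∈ F.U a := by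
    have hac : μ ≪ volume.restrict (Set.Icc (0 : ℝ) 1) := hμ ▸ withDensity_absolutelyContinuous _ _
    refine hac.ae_le ((ae_restrict_iff' (p := fun x => ∃ a, x ∈ F.U a) measurableSet_Icc).mpr ?_)
    refine measure_mono_null (fun x hx => ?_) F.null_compl
    simp only [Set.mem_compl_iff, Set.mem_ofPred_eq, Classical.not_imp, not_exists] at hx
    exact ⟨hx.1, fun hU => by
      obtain ⟨a, ha⟩ := Set.mem_iUnion.mp hU
      exact hx.2 a ha⟩
  exact ae_all_iff.mpr fun j => (hinv.iterate j).quasiMeasurePreserving.ae h0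

variable [Nonempty A] [Countable A] [MeasurableSpace A] [MeasurableSingletonClass A]
  {μ : Measure ℝ}

theorem measurePreserving_shift_symbolicMeasure (hinv : MeasurePreserving F.toFun μ μ) :
    MeasurePreserving shift (F.symbolicMeasure μ) (F.symbolicMeasure μ) := by
  refine ⟨measurable_shift, ?_⟩
  rw [symbolicMeasure, Measure.map_map measurable_shift F.measurable_itinerary]
  have e : shift ∘ F.itinerary = F.itinerary ∘ F.toFun := rfl
  rw [e, ← Measure.map_map F.measurable_itinerary F.measurable, hinv.map_eq]

theorem symbolicMeasure_real_cylinder (hinv : MeasurePreserving F.toFun μ μ)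
    (hμ : μ = (volume.restrict (Set.Icc (0 : ℝ) 1)).withDensity fun x => ENNReal.ofReal (p x))
    (ω : ℕ → A) (n : ℕ) :
    (F.symbolicMeasure μ).real (cylinder ω (n + 1)) = mass p (F.interval ω (n + 1)) := by
  have hm : MeasurableSet (cylinder ω (n + 1)) := measurableSet_atom ω _
  rw [measureReal_def, symbolicMeasure, Measure.map_apply F.measurable_itinerary hm, mass]
  congr 1
  have e : F.itinerary ⁻¹' cylinder ω (n + 1) =ᵐ[μ] F.interval ω (n + 1) := by
    filter_upwards [ae_forall_mem_U hinv hμ] with x hx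
    refine propext (forall₂_congr fun j _ => ?_)
    obtain ⟨a, ha⟩ := hx j
    rw [F.itinerary_eq ha]
    constructor
    · rintro rfl
      exact ha
    · intro h'
      rw [← F.itinerary_eq ha, F.itinerary_eq h']
  rw [measure_congr e, hμ, withDensity_apply _ (measurableSet_interval ω (n + 1)),
    Measure.restrict_restrict (measurableSet_interval ω (n + 1)),
    Set.inter_eq_left.mpr (interval_subset ω n)]

end Symbolic

end MarkovIntervalMap

/-! ### Periods and the overlap factor -/

theorem kappa_pos {ℓ : ℕ} (d : Fin ℓ → ℕ) {r : ℕ} (hr : 0 < r) : 0 < kappa d r := by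
  rw [Nat.pos_iff_ne_zero, kappa, Ne, Finset.lcm_eq_zero_iff]
  simp only [Finset.mem_univ, true_and, not_exists]
  exact fun i => (Nat.div_pos (Nat.gcd_le_left _ hr) (Nat.gcd_pos_of_pos_left _ hr)).ne'

theorem kappa_dvd_iff {ℓ : ℕ} (d : Fin ℓ → ℕ) {r : ℕ} (hr : 0 < r) (j : ℕ) :
    kappa d r ∣ j ↔ ∀ i, r ∣ d i * j := by
  rw [kappa, Finset.lcm_dvd_iff]
  simp only [Finset.mem_univ, true_implies]
  refine forall_congr' fun i => ?_
  have hg : 0 < Nat.gcd r (d i) := Nat.gcd_pos_of_pos_left _ hr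
  have hcop := Nat.coprime_div_gcd_div_gcd hg
  -- With g = gcd(r, d_i), r/g is coprime to d_i/g, so r/g ∣ j is equivalent to r ∣ d_i j.
  rw [← hcop.dvd_mul_left, ← Nat.mul_dvd_mul_iff_left hg, ← mul_assoc,
    Nat.mul_div_cancel' (Nat.gcd_dvd_left r (d i)), Nat.mul_div_cancel' (Nat.gcd_dvd_right r (d i))]

/-- The extension of a strictly increasing finite sequence to all indices. -/
def extendTimes {ℓ : ℕ} (d : Fin ℓ → ℕ) (i : ℕ) : ℕ :=
  if h : i < ℓ then d ⟨i, h⟩ else ∑ j, d j + i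

theorem extendTimes_val {ℓ : ℕ} (d : Fin ℓ → ℕ) (i : Fin ℓ) : extendTimes d i = d i := by
  rw [extendTimes, dif_pos i.2]

theorem strictMono_extendTimes {ℓ : ℕ} {d : Fin ℓ → ℕ} (hd : StrictMono d) :
    StrictMono (extendTimes d) := by
  intro i j hij
  unfold extendTimes
  split_ifs with h1 h2 h2
  · exact hd hij
  · have := Finset.single_le_sum (f := d) (fun _ _ => Nat.zero_le _) (Finset.mem_univ ⟨i, h1⟩)
    omega
  · omega
  · omega

/-- The divisions d_i κ / r are exact, so the natural exponents add up to a = (κ/r) Σ d_i. -/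
theorem overlapFactor_eq {ℓ : ℕ} (d : Fin (ℓ + 1) → ℕ) {r : ℕ} (hr : 0 < r) {m : ℝ} (hm : 0 < m) :
    overlapFactor (extendTimes d) ℓ r (kappa d r) m⁻¹ = m ^ (-exponent d r) := by
  rw [overlapFactor, Finset.prod_pow_eq_pow_sum, inv_pow, ← Real.rpow_natCast,
    ← Real.rpow_neg hm.le, Finset.sum_range]
  congr 2
  simp only [extendTimes_val, Nat.cast_sum, exponent, Finset.mul_sum]
  refine Finset.sum_congr rfl fun i _ => ?_
  rw [Nat.cast_div ((kappa_dvd_iff d hr _).mp dvd_rfl i) (by positivity)]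
  push_cast
  ring

theorem recurrenceCount_eq_hitCount {A : Type*} {ℓ : ℕ} (d : Fin (ℓ + 1) → ℕ) (ω : ℕ → A)
    (n N : ℕ) : recurrenceCount d (cylinder ω n) N =
      PeriodicData.hitCount ω (extendTimes d) ℓ n (Finset.Icc 1 N) := by
  classical
  funext γ
  rw [PeriodicData.hitCount_eq_sum_indicator, recurrenceCount]
  refine Finset.sum_congr rfl fun k _ => ?_
  have h : (∀ i, shift^[d i * k] γ ∈ cylinder ω n) ↔
      γ ∈ hit ω (extendTimes d) ℓ n k := by
    rw [mem_hit]
    constructor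
    · intro h i hi s hs
      have := h ⟨i, hi⟩ s hs
      rw [shift_iterate_apply, add_comm] at this
      rwa [extendTimes, dif_pos hi]
    · intro h i s hs
      have := h i i.2 s hs
      rw [shift_iterate_apply, add_comm]
      rwa [extendTimes_val] at this
  by_cases hγ : γ ∈ hit ω (extendTimes d) ℓ n k
  · rw [Set.indicator_of_mem hγ]
    exact Finset.prod_eq_one fun i _ => Set.indicator_of_mem (h.mpr hγ i) _
  · rw [Set.indicator_of_notMem hγ]
    obtain ⟨i, hi⟩ := not_forall.mp (mt h.mp hγ)
    exact Finset.prod_eq_zero (Finset.mem_univ i) (Set.indicator_of_notMem hi _)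

theorem tendsto_timeScale_mul {A : Type*} [MeasurableSpace A] {P : Measure (ℕ → A)} {ω : ℕ → A}
    (hpos : ∀ n, 0 < P.real (cylinder ω n))
    (hlim : Tendsto (fun n => P.real (cylinder ω n)) atTop (𝓝 0)) {t : ℝ} (ht : 0 < t) (ℓ : ℕ) :
    Tendsto (fun n => (timeScale P (ℓ + 1) t ω n : ℝ) * P.real (cylinder ω n) ^ (ℓ + 1)) atTop
      (𝓝 t) := by
  have h1 : Tendsto (fun n => P.real (cylinder ω n) ^ (ℓ + 1)) atTop (𝓝[>] 0) :=
    tendsto_nhdsWithin_iff.mpr ⟨by simpa using hlim.pow (ℓ + 1),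
      Eventually.of_forall fun n => pow_pos (hpos n) _⟩
  refine ((tendsto_nat_floor_mul_div_atTop ht.le).comp (tendsto_inv_nhdsGT_zero.comp h1)).congr
    fun n => ?_
  simp only [Function.comp_apply, div_inv_eq_mul, timeScale]

end MarkovRecurrence

end

/-! ### Assembly of the limit theorem. -/

open MarkovRecurrence in
theorem corollary3p8 {A : Type*} [Countable A] [Nontrivial A]
    [MeasurableSpace A] [MeasurableSingletonClass A] [TopologicalSpace A] [DiscreteTopology A]
    (F : MarkovIntervalMap A)
    (μ : Measure ℝ) [IsProbabilityMeasure μ]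
    (hinv : MeasurePreserving F.toFun μ μ)
    (p : ℝ → ℝ) (hp_cont : ContinuousOn p (Set.Icc 0 1)) (hp_pos : ∀ x ∈ Set.Icc (0 : ℝ) 1, 0 < p x)
    (hμ : μ = (volume.restrict (Set.Icc (0 : ℝ) 1)).withDensity fun x => ENNReal.ofReal (p x))
    (htop : IsTopologicallyMixing F.trans)
    (hψ : IsPsiMixing (F.symbolicMeasure μ))
    {ℓ : ℕ} (hℓ : 1 ≤ ℓ) (d : Fin ℓ → ℕ) (hd_pos : ∀ i, 1 ≤ d i) (hd_mono : StrictMono d)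
    (t : ℝ) (ht : 0 < t)
    (ω : ℕ → A) (hω : ω ∈ cylinderSupport (F.symbolicMeasure μ))
    (hper : ω ∈ Function.periodicPts shift) :
    0 ≤ F.rho d ω ∧ F.rho d ω < 1 ∧
      ∃ _ : IsProbabilityMeasure (polyaAeppli (t * (1 - F.rho d ω)) (F.rho d ω)),
        TendstoInDistribution
          (fun n : ℕ => recurrenceCount d (cylinder ω n)
            (timeScale (F.symbolicMeasure μ) ℓ t ω n))
          atTop id (fun _ => F.symbolicMeasure μ)
          (polyaAeppli (t * (1 - F.rho d ω)) (F.rho d ω)) := by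
  obtain ⟨ℓ, rfl⟩ := Nat.exists_eq_add_of_le' hℓ
  set P := F.symbolicMeasure μ with hP
  set r := Function.minimalPeriod shift ω with hr
  have hr0 : 0 < r := Function.minimalPeriod_pos_of_mem_periodicPts hper
  have hrω : shift^[r] ω = ω := Function.iterate_minimalPeriod
  have hcyl := MarkovIntervalMap.symbolicMeasure_real_cylinder (F := F) hinv hμ
  have hcyl0 : ∀ y : ℕ → A, P.real (cylinder y 0) = 1 := fun y => by
    have : cylinder y 0 = Set.univ := by
      ext γ
      simp [MarkovRecurrence.cylinder]
    rw [this, probReal_univ]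
  have hposP : ∀ n, 0 < P.real (cylinder ω n) := fun n => by
    rcases Nat.eq_zero_or_pos n with rfl | hn
    · rw [hcyl0]
      exact one_pos
    · exact ENNReal.toReal_pos (hω n hn).ne' (measure_ne_top _ _)
  -- A cylinder of positive probability has a cylinder interval of positive mass, hence a nonempty
  -- one.
  have hadm : F.Admissible ω := fun n => by
    have h1 := hposP (n + 1)
    rw [hcyl ω n] at h1
    by_contra hne
    have h2 : F.interval ω (n + 1) = ∅ := Set.subset_empty_iff.mp
      ((MarkovIntervalMap.interval_anti n.le_succ).trans_eq (Set.not_nonempty_iff_eq_empty.mp hne))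
    rw [h2] at h1
    simp [MarkovIntervalMap.mass] at h1
  set m := F.multiplier ω r with hm
  have hm1 : 1 < m := hadm.one_lt_multiplier hr0 hrω
  have hm0 : 0 < m := by linarith
  have hrho : F.rho d ω = m ^ (-exponent d r) := rfl
  have hexp : 0 < exponent d r := by
    have hκ := kappa_pos d hr0
    have h1 : (0 : ℝ) < ∑ i, (d i : ℝ) :=
      Finset.sum_pos (fun i _ => by exact_mod_cast hd_pos i) Finset.univ_nonempty
    unfold exponent
    positivity
  have hρ0 : 0 ≤ F.rho d ω := by
    rw [hrho]
    positivity
  have hρ1 : F.rho d ω < 1 := by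
    rw [hrho]
    exact Real.rpow_lt_one_of_one_lt_of_neg hm1 (by linarith)
  have hprob := isProbabilityMeasure_polyaAeppli (mul_pos ht (show 0 < 1 - F.rho d ω by linarith))
    hρ0 hρ1
  refine ⟨hρ0, hρ1, hprob, ?_⟩
  obtain ⟨C, θ, hC, hθ, hθ1, hvol⟩ := F.exists_volume_real_interval_le
  obtain ⟨M, hM, hmass⟩ := MarkovIntervalMap.exists_mass_interval_le (F := F) hp_cont
  -- The maximum with 1 covers the empty word, whose cylinder has probability 1; longer words obey
  -- the density bound M times the length bound C θ^n.
  have hD : LimitData P ω (extendTimes d) ℓ r (kappa d r) (max (M * C) 1) θ m⁻¹ :=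
    { strictMono := strictMono_extendTimes hd_mono
      one_le := by
        have := extendTimes_val d 0
        rw [Fin.val_zero] at this
        exact this ▸ hd_pos 0
      r_pos := hr0
      dvd_iff := fun k => (Function.isPeriodicPt_iff_minimalPeriod_dvd (f := shift)).symm
      κ_pos := kappa_pos d hr0
      κ_dvd_iff := fun j => by
        rw [kappa_dvd_iff d hr0]
        constructor
        · intro h i hi
          rw [extendTimes, dif_pos hi]
          exact h ⟨i, hi⟩
        · intro h i
          have := h i i.2
          rwa [extendTimes_val] at this
      invariant := MarkovIntervalMap.measurePreserving_shift_symbolicMeasure hinv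
      psiMixing := hψ
      pos := hposP
      le_geom := fun y n => by
        cases n with
        | zero =>
          rw [hcyl0, pow_zero, mul_one]
          exact le_max_right _ _
        | succ n =>
          rw [hcyl y n]
          calc _ ≤ M * volume.real (F.interval y (n + 1)) := hmass y n
            _ ≤ M * (C * θ ^ (n + 1)) := by
              gcongr
              exact hvol y n
            _ = (M * C) * θ ^ (n + 1) := by ring
            _ ≤ _ := by
              gcongr
              exact le_max_left _ _
      base_nonneg := hθ
      base_lt := hθ1
      ratio := by
        have h1 := (hadm.tendsto_mass_ratio_of_periodic hp_cont hp_pos hrω).inv₀ hm0.ne'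
        rw [← tendsto_add_atTop_iff_nat 1]
        refine h1.congr fun n => ?_
        rw [inv_div, ← hcyl, ← hcyl, add_right_comm] }
  have hρ : overlapFactor (extendTimes d) ℓ r (kappa d r) m⁻¹ = F.rho d ω :=
    (overlapFactor_eq d hr0 hm0).trans hrho.symm
  refine tendstoInDistribution_nat_of_tendsto (fun n => ?_) fun k => ?_
  · rw [recurrenceCount_eq_hitCount]
    exact PeriodicData.measurable_hitCount _ _ _ _ _
  · rw [polyaAeppli_real_singleton (mul_pos ht (by linarith)) hρ0 hρ1]
    simp only [recurrenceCount_eq_hitCount]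
    have h1 := hD.tendsto_real_hitCount ht (hρ ▸ hρ0) (hρ ▸ hρ1)
      (tendsto_timeScale_mul hposP hD.tendsto_cylinder ht ℓ) k
    rw [hρ] at h1
    exact h1
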